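/- **Setting.** Fix $0<q<1$ and $\kappa,\zeta,\zeta',\upsilon,\upsilon'\in\mathbb C$. Write $\theta(x;q)=\prod_{j\ge 0}(1-q^jx)(1-q^{j+1}/x)$ and $\theta(x_1,\dots,x_r;q)=\prod_i\theta(x_i;q)$. Let $V=\mathbb C^2$ with basis $v_+,v_-$ and $h v_\pm=\pm v_\pm$; $h_i$ and the indices $1,2,3$ on operators denote tensor legs of $V^{\otimes n}$, and $S(\xi+\alpha h_i)v:=S(\xi+\alpha\mu)v$ whenever $h_iv=\mu v$. All identities are identities of meromorphic functions. A meromorphic family $R(z,\xi)$ of operators on $V\otimes V$, $(z,\xi)\in\mathbb C^2$, is a *dynamical $R$-matrix* if $$R_{12}(z_1-z_2,\xi-2\kappa h_3)R_{13}(z_1-z_3,\xi)R_{23}(z_2-z_3,\xi-2\kappa h_1)=R_{23}(z_2-z_3,\xi)R_{13}(z_1-z_3,\xi-2\kappa h_2)R_{12}(z_1-z_2,\xi),$$ and it is *unitary* if $R_{21}(z,\xi)R(-z,\xi)=\mathrm{Id}$. A meromorphic family $K(z,\xi)$ of operators on $V$ is a *right dynamical $K$-matrix associated to $R$* if $$R_{21}(z_1-z_2,2\xi)K_1(z_1,\xi-\kappa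 h_2)R_{12}(z_1+z_2,2\xi)K_2(z_2,\xi-\kappa h_1)=K_2(z_2,\xi-\kappa h_1)R_{21}(z_1+z_2,2\xi)K_1(z_1,\xi-\kappa h_2)R_{12}(z_1-z_2,2\xi),$$ and it is *unitary* if $K(z,\xi)K(-z,\xi)=\mathrm{Id}$. For functions $A,B,\alpha,\beta$ of $(z,\xi)$ consider, in the ordered bases $(v_+\otimes v_+,v_+\otimes v_-,v_-\otimes v_+,v_-\otimes v_-)$ and $(v_+,v_-)$, $$R(z,\xi)=\begin{pmatrix}1&0&0&0\\0&A(z,\xi)&B(z,\xi)&0\\0&B(z,-\xi)&A(z,-\xi)&0\\0&0&0&1\end{pmatrix},\qquad K(z,\xi)=\begin{pmatrix}\alpha(z,\xi)&\beta(z,\xi)\\\beta(z,-\xi)&\alpha(z,-\xi)\end{pmatrix}.$$ Let $\tilde a=q^{\zeta+\zeta'}$, $\tilde b=-q^{\zeta-\zeta'}$, $\tilde c=q^{\frac12+\upsilon+\upsilon'}$, $d=-q^{\frac12+\zeta'-\upsilon'}$, $$\mathcal C(z,\xi)=\frac{\theta(\tilde aq^\xi,\tilde bq^\xi,\tilde cq^\xi,dq^{\xi-z}/\tilde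 a;q)}{\theta(q^{2\xi},dq^{-z};q)}\,q^{-(\zeta+\upsilon-z)(\zeta+\zeta'-\xi)},$$ and let $\widetilde{\mathcal C}(z,\xi)$ be $\mathcal C(z,\xi)$ with $\upsilon$ and $\zeta'$ interchanged. Let $R_{cm},K_{cm}$ be the matrices of the above form with coefficients $$A_{cm}=\frac{\theta(q^{2\kappa-\xi},q^{-z};q)}{\theta(q^{2\kappa-z},q^{-\xi};q)}q^{2\kappa(z-\xi)},\quad B_{cm}=\frac{\theta(q^{2\kappa},q^{-z-\xi};q)}{\theta(q^{-\xi},q^{2\kappa-z};q)}q^{(2\kappa+\xi)z},$$ $$\alpha_{cm}=\frac{\mathcal C(z,\xi)-\widetilde{\mathcal C}(\xi,z)}{\widetilde{\mathcal C}(\xi,-z)},\quad \beta_{cm}=\frac{\mathcal C(z,\xi)}{\widetilde{\mathcal C}(-\xi,-z)},$$ and let $R_{Ba}$ (Baxter's 8-vertex face dynamical $R$-matrix) and $K_{Ba}$ be those with coefficients $$A_{Ba}=\frac{\theta(q^{-z},q^{2\kappa+\xi};q)}{\theta(q^{2\kappa-z},q^{\xi};q)},\quad B_{Ba}=\frac{\theta(q^{-z-\xi},q^{2\kappa};q)}{\theta(q^{2\kappa-z},q^{-\xi};q)},\quad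 \alpha_{Ba}=q^{2z\xi}\alpha_{cm},\quad \beta_{Ba}=\beta_{cm}.$$ **Theorem.** For all $0<q<1$ and $\kappa,\zeta,\zeta',\upsilon,\upsilon'\in\mathbb C$: 1. $R_{cm}$ is a unitary dynamical $R$-matrix and $K_{cm}$ is a unitary right dynamical $K$-matrix associated to $R_{cm}$. 2. $R_{Ba},K_{Ba}$ are obtained from $R_{cm},K_{cm}$ by applying successively the two gauges (i) $A\mapsto u(\xi)A$, with $B,\alpha,\beta$ unchanged, where $u(\xi)=\frac{\theta(q^{2\kappa+\xi},q^{-\xi};q)}{\theta(q^{2\kappa-\xi},q^{\xi};q)}$ is meromorphic and satisfies $u(\xi)u(-\xi)=1$; and (ii) $A\mapsto q^{2\kappa(\xi-z)}A$, $B\mapsto q^{-z(2\kappa+\xi)}B$, $\alpha\mapsto q^{2z\xi}\alpha$, with $\beta$ unchanged. 3. $R_{Ba}$ is a unitary dynamical $R$-matrix and $K_{Ba}$ is a unitary right dynamical $K$-matrix associated to $R_{Ba}$. -/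

import Mathlib

open Topology

namespace DynFace

/-! ### Meromorphic functions of several complex variables

A meromorphic function is represented by a total function; its values on a thin set
(where a local denominator vanishes) are irrelevant. -/

/-- `f` is meromorphic: near every point it is a quotient `g / h` of two analytic functions, where
`h` is not identically zero near that point. -/
def IsMeromorphic {E : Type*} [NormedAddCommGroup E] [NormedSpace ℂ E] (f : E → ℂ) : Prop :=
  ∀ x : E, ∃ g h : E → ℂ, AnalyticAt ℂ g x ∧ AnalyticAt ℂ h x ∧ (∃ᶠ y in 𝓝 x, h y ≠ 0) ∧
    ∀ᶠ y in 𝓝 x, h y ≠ 0 → f y = g y / h y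

/-- Equality as meromorphic functions (or as meromorphic families of operators): equality on a
dense open set. -/
def MerEq {E β : Type*} [TopologicalSpace E] (f g : E → β) : Prop :=
  ∃ U : Set E, IsOpen U ∧ Dense U ∧ ∀ x ∈ U, f x = g x

/-- A meromorphic family of operators (matrices) depending on `(z, ξ) ∈ ℂ²`. -/
def IsMeromorphicFamily {m : Type*} (S : ℂ → ℂ → Matrix m m ℂ) : Prop :=
  ∀ a b : m, IsMeromorphic (fun p : ℂ × ℂ => S p.1 p.2 a b)

/-! ### Tensor legs and dynamical shifts

`V` has a basis `(v_a)_{a ∈ I}` of eigenvectors of `h`, with `h v_a = wt a • v_a`. The space `V^{⊗ n}`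
has the basis `v_ε = v_{ε 0} ⊗ ⋯ ⊗ v_{ε (n-1)}`, `ε : Fin n → I`, and operators are matrices
with respect to it: `S v_δ = ∑ ε, S ε δ • v_ε`. Legs are numbered from `0`. -/

section Legs

variable {I : Type*} [DecidableEq I]

/-- The operator on `V^{⊗ n}` acting as `S : V → V` on leg `i`. -/
def leg₁ (n : ℕ) (i : Fin n) (S : Matrix I I ℂ) : Matrix (Fin n → I) (Fin n → I) ℂ :=
  fun ε δ => if ∀ k, k ≠ i → ε k = δ k then S (ε i) (δ i) else 0

/-- The operator on `V^{⊗ n}` acting as `S : V ⊗ V → V ⊗ V` on legs `i` and `j` (in this order);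
thus `leg₂ 2 1 0 R` is `R₂₁ = P R P`. -/
def leg₂ (n : ℕ) (i j : Fin n) (S : Matrix (I × I) (I × I) ℂ) :
    Matrix (Fin n → I) (Fin n → I) ℂ :=
  fun ε δ => if ∀ k, k ≠ i → k ≠ j → ε k = δ k then S (ε i, ε j) (δ i, δ j) else 0

/-- The dynamical shift `S(ξ + α hᵢ)`, with `S(ξ + α hᵢ) v_δ = S(ξ + α wt(δ i)) v_δ`. -/
def dynShift (wt : I → ℂ) {n : ℕ} (S : ℂ → Matrix (Fin n → I) (Fin n → I) ℂ)
    (ξ α : ℂ) (i : Fin n) : Matrix (Fin n → I) (Fin n → I) ℂ :=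
  fun ε δ => S (ξ + α * wt (δ i)) ε δ

variable [Fintype I]

/-- `R(z, ξ)` is a dynamical `R`-matrix: a meromorphic family of operators on `V ⊗ V` satisfying
the dynamical quantum Yang-Baxter equation with step `2κ`. -/
structure IsDynamicalR (wt : I → ℂ) (κ : ℂ) (R : ℂ → ℂ → Matrix (I × I) (I × I) ℂ) : Prop where
  meromorphic : IsMeromorphicFamily R
  yangBaxter : MerEq
    (fun p : ℂ × ℂ × ℂ × ℂ => match p with
      | (z₁, z₂, z₃, ξ) =>
        dynShift wt (fun x => leg₂ 3 0 1 (R (z₁ - z₂) x)) ξ (-(2 * κ)) 2 *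
        leg₂ 3 0 2 (R (z₁ - z₃) ξ) *
        dynShift wt (fun x => leg₂ 3 1 2 (R (z₂ - z₃) x)) ξ (-(2 * κ)) 0)
    (fun p : ℂ × ℂ × ℂ × ℂ => match p with
      | (z₁, z₂, z₃, ξ) =>
        leg₂ 3 1 2 (R (z₂ - z₃) ξ) *
        dynShift wt (fun x => leg₂ 3 0 2 (R (z₁ - z₃) x)) ξ (-(2 * κ)) 1 *
        leg₂ 3 0 1 (R (z₁ - z₂) ξ))

/-- Unitarity `R₂₁(z, ξ) R(-z, ξ) = Id`. -/
def IsUnitaryR (R : ℂ → ℂ → Matrix (I × I) (I × I) ℂ) : Prop :=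
  MerEq (fun p : ℂ × ℂ => leg₂ 2 1 0 (R p.1 p.2) * leg₂ 2 0 1 (R (-p.1) p.2))
    (fun _ => (1 : Matrix (Fin 2 → I) (Fin 2 → I) ℂ))

/-- `K(z, ξ)` is a right dynamical `K`-matrix with respect to `R(z, ξ)`: a meromorphic family of
operators on `V` satisfying the right dynamical reflection equation. -/
structure IsRightDynamicalK (wt : I → ℂ) (κ : ℂ) (R : ℂ → ℂ → Matrix (I × I) (I × I) ℂ)
    (K : ℂ → ℂ → Matrix I I ℂ) : Prop where
  meromorphic : IsMeromorphicFamily K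
  reflection : MerEq
    (fun p : ℂ × ℂ × ℂ => match p with
      | (z₁, z₂, ξ) =>
        leg₂ 2 1 0 (R (z₁ - z₂) (2 * ξ)) *
        dynShift wt (fun x => leg₁ 2 0 (K z₁ x)) ξ (-κ) 1 *
        leg₂ 2 0 1 (R (z₁ + z₂) (2 * ξ)) *
        dynShift wt (fun x => leg₁ 2 1 (K z₂ x)) ξ (-κ) 0)
    (fun p : ℂ × ℂ × ℂ => match p with
      | (z₁, z₂, ξ) =>
        dynShift wt (fun x => leg₁ 2 1 (K z₂ x)) ξ (-κ) 0 *
        leg₂ 2 1 0 (R (z₁ + z₂) (2 * ξ)) *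
        dynShift wt (fun x => leg₁ 2 0 (K z₁ x)) ξ (-κ) 1 *
        leg₂ 2 0 1 (R (z₁ - z₂) (2 * ξ)))

/-- Unitarity `K(z, ξ) K(-z, ξ) = Id`. -/
def IsUnitaryK (K : ℂ → ℂ → Matrix I I ℂ) : Prop :=
  MerEq (fun p : ℂ × ℂ => K p.1 p.2 * K (-p.1) p.2) (fun _ => (1 : Matrix I I ℂ))

end Legs

/-! ### The spin space `ℂ²` and gauges

`V = ℂ²` with basis `v₊, v₋` indexed by `0, 1 : Fin 2`, and `h v_± = ± v_±`. -/

/-- The weights of `h` on `v₊, v₋`. -/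
def spinWt : Fin 2 → ℂ := ![1, -1]

/-- The coefficient functions `A, B` of an `R`-matrix and `α, β` of a `K`-matrix. -/
structure Coeffs where
  A : ℂ → ℂ → ℂ
  B : ℂ → ℂ → ℂ
  α : ℂ → ℂ → ℂ
  β : ℂ → ℂ → ℂ

/-- The `R`-matrix with coefficients `A, B`, in the ordered basis
`v₊ ⊗ v₊, v₊ ⊗ v₋, v₋ ⊗ v₊, v₋ ⊗ v₋`. -/
def Coeffs.R (c : Coeffs) (z ξ : ℂ) : Matrix (Fin 2 × Fin 2) (Fin 2 × Fin 2) ℂ :=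
  (!![1, 0, 0, 0;
      0, c.A z ξ, c.B z ξ, 0;
      0, c.B z (-ξ), c.A z (-ξ), 0;
      0, 0, 0, 1] : Matrix (Fin 4) (Fin 4) ℂ).submatrix
    (finProdFinEquiv : Fin 2 × Fin 2 ≃ Fin 4) (finProdFinEquiv : Fin 2 × Fin 2 ≃ Fin 4)

/-- The `K`-matrix with coefficients `α, β`, in the ordered basis `v₊, v₋`. -/
def Coeffs.K (c : Coeffs) (z ξ : ℂ) : Matrix (Fin 2) (Fin 2) ℂ :=
  !![c.α z ξ, c.β z ξ;
     c.β z (-ξ), c.α z (-ξ)]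

/-- The first gauge: `A` is multiplied by `u(ξ)`. -/
def Coeffs.gauge₁ (c : Coeffs) (u : ℂ → ℂ) : Coeffs where
  A z ξ := u ξ * c.A z ξ
  B := c.B
  α := c.α
  β := c.β

/-- The condition on `u` in the first gauge: `u` is meromorphic and `u(ξ) u(-ξ) = 1`. -/
def IsGaugeFactor (u : ℂ → ℂ) : Prop :=
  IsMeromorphic u ∧ MerEq (fun ξ => u ξ * u (-ξ)) (fun _ => (1 : ℂ))

/-- The power `q ^ x` with complex exponent. -/
noncomputable def qpow (q : ℝ) (x : ℂ) : ℂ := (q : ℂ) ^ x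

/-- The second gauge. -/
noncomputable def Coeffs.gauge₂ (c : Coeffs) (q : ℝ) (κ : ℂ) : Coeffs where
  A z ξ := qpow q (2 * κ * (ξ - z)) * c.A z ξ
  B z ξ := qpow q (-z * (2 * κ + ξ)) * c.B z ξ
  α z ξ := qpow q (2 * z * ξ) * c.α z ξ
  β := c.β

/-! ### Theta functions and the explicit matrices -/

/-- The renormalised Jacobi theta function `θ(x; q) = ∏_{j ≥ 0} (1 - q^j x)(1 - q^{j+1} / x)`. -/
noncomputable def theta (q : ℝ) (x : ℂ) : ℂ :=
  ∏' j : ℕ, (1 - (q : ℂ) ^ j * x) * (1 - (q : ℂ) ^ (j + 1) / x)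

section Explicit

variable (q : ℝ) (κ : ℂ)

noncomputable def Acm (z ξ : ℂ) : ℂ :=
  theta q (qpow q (2 * κ - ξ)) * theta q (qpow q (-z)) /
    (theta q (qpow q (2 * κ - z)) * theta q (qpow q (-ξ))) * qpow q (2 * κ * (z - ξ))

noncomputable def Bcm (z ξ : ℂ) : ℂ :=
  theta q (qpow q (2 * κ)) * theta q (qpow q (-z - ξ)) /
    (theta q (qpow q (-ξ)) * theta q (qpow q (2 * κ - z))) * qpow q ((2 * κ + ξ) * z)

noncomputable def ABa (z ξ : ℂ) : ℂ :=
  theta q (qpow q (-z)) * theta q (qpow q (2 * κ + ξ)) /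
    (theta q (qpow q (2 * κ - z)) * theta q (qpow q ξ))

noncomputable def BBa (z ξ : ℂ) : ℂ :=
  theta q (qpow q (-z - ξ)) * theta q (qpow q (2 * κ)) /
    (theta q (qpow q (2 * κ - z)) * theta q (qpow q (-ξ)))

/-- The gauge factor relating `A_cm` to `A_Ba`. -/
noncomputable def uBa (ξ : ℂ) : ℂ :=
  theta q (qpow q (2 * κ + ξ)) * theta q (qpow q (-ξ)) /
    (theta q (qpow q (2 * κ - ξ)) * theta q (qpow q ξ))

variable (ζ ζ' υ υ' : ℂ)

/-- The function `𝒞(z, ξ)`, written with the dual Askey-Wilson parameters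
`ta = q^{ζ+ζ'}`, `tb = -q^{ζ-ζ'}`, `tc = q^{1/2+υ+υ'}` and with `d = -q^{1/2+ζ'-υ'}`. -/
noncomputable def calC (z ξ : ℂ) : ℂ :=
  let ta := qpow q (ζ + ζ')
  let tb := -qpow q (ζ - ζ')
  let tc := qpow q (1 / 2 + υ + υ')
  let d := -qpow q (1 / 2 + ζ' - υ')
  theta q (ta * qpow q ξ) * theta q (tb * qpow q ξ) * theta q (tc * qpow q ξ) *
      theta q (d * qpow q (ξ - z) / ta) /
    (theta q (qpow q (2 * ξ)) * theta q (d * qpow q (-z))) *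
    qpow q (-(ζ + υ - z) * (ζ + ζ' - ξ))

/-- The function `𝒞~(z, ξ)`: interchange `υ` and `ζ'` in `𝒞(z, ξ)`. -/
noncomputable def calCt (z ξ : ℂ) : ℂ := calC q ζ υ ζ' υ' z ξ

noncomputable def αcm (z ξ : ℂ) : ℂ :=
  (calC q ζ ζ' υ υ' z ξ - calCt q ζ ζ' υ υ' ξ z) / calCt q ζ ζ' υ υ' ξ (-z)

noncomputable def βcm (z ξ : ℂ) : ℂ :=
  calC q ζ ζ' υ υ' z ξ / calCt q ζ ζ' υ υ' (-ξ) (-z)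

/-- The coefficients of `R_cm` and `K_cm`. -/
noncomputable def cm : Coeffs where
  A := Acm q κ
  B := Bcm q κ
  α := αcm q ζ ζ' υ υ'
  β := βcm q ζ ζ' υ υ'

/-- The coefficients of Baxter's `R_Ba` and of `K_Ba`. -/
noncomputable def Ba : Coeffs where
  A := ABa q κ
  B := BBa q κ
  α z ξ := αcm q ζ ζ' υ υ' z ξ * qpow q (2 * z * ξ)
  β := βcm q ζ ζ' υ υ'

end Explicit

end DynFace

namespace DynFace

/-! ### The infinite product and the theta function -/

/-! Everything rests on the odd function σ(x) = q^{-x/2} θ(q^x; q) (`sig`) and Weierstrass's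
three-term identity for it. That identity is a dimension count: a function g holomorphic on ℂ \ {0}
with g(qw) = C w⁻² g(w) is determined by two Laurent coefficients, so any three of the kernels θ(wy,
w/y; q)/w are linearly dependent (`thetaKernel_plucker`). Translating one variable by a half-period
yields the same identity with one pair of σ's in each term replaced by a Jacobi function
(`sigmaPair_jac`).

Baxter's matrices are treated first. Written with σ, the coefficients of R_Ba contain no extra
powers of q, and the dynamical Yang-Baxter equation and unitarity reduce to instances of
Weierstrass's identity.

For K_Ba, the coefficient β factors as c(z) b(ξ), and α is c(z) times `kDiag`. The reflection
equation then reduces (`ReflectionEntries.of_linear`) to three equations linear in the diagonal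
coefficient and one quadratic condition: kDiag(z, ξ) kDiag(z, -ξ) - b(ξ) b(-ξ) must not depend on ξ.
Each Jacobi function g gives an elementary solution g(z - x)/(g(z) σ(x)), with x = 2ξ, of the linear
equations (`SigmaPair.faceLinear`), and an elliptic partial fraction expansion
(`exists_kDiag_expansion`) writes kDiag as a combination of these four with coefficients free of z
and ξ. The expansion also shows that kDiag is odd under (z, ξ) ↦ (-z, -ξ), which its closed form
hides; this gives the quadratic condition (`KGeneric.kDiag_mul`) and, with the value of c(z) c(-z),
unitarity of K.

The statements for R_cm and K_cm follow by undoing the gauges, which multiplies the two sides of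
each scalar equation by a common factor. All identities are proved off the zeros of finitely many
theta functions, hence on a dense open set. -/

/-- The infinite `q`-shifted factorial `(x; q)_∞`. -/
noncomputable def qPoch (q : ℝ) (x : ℂ) : ℂ := ∏' j : ℕ, (1 - (q : ℂ) ^ j * x)

section Theta

variable {q : ℝ} (hq0 : 0 < q) (hq1 : q < 1)
include hq0 hq1

theorem summable_norm_geometric_mul (x : ℂ) : Summable fun j : ℕ => ‖-((q : ℂ) ^ j * x)‖ := by
  simp only [norm_neg, norm_mul, norm_pow, Complex.norm_real, Real.norm_of_nonneg hq0.le]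
  exact (summable_geometric_of_lt_one hq0.le hq1).mul_right _

theorem multipliable_qPoch (x : ℂ) : Multipliable fun j : ℕ => 1 - (q : ℂ) ^ j * x := by
  simpa [sub_eq_add_neg] using
    multipliable_one_add_of_summable (summable_norm_geometric_mul hq0 hq1 x)

theorem differentiable_qPoch : Differentiable ℂ (qPoch q) := by
  intro x
  have h : HasProdLocallyUniformlyOn (fun (j : ℕ) (y : ℂ) => 1 + -((q : ℂ) ^ j * y))
      (fun y => ∏' j : ℕ, (1 + -((q : ℂ) ^ j * y))) (Metric.ball (0 : ℂ) (‖x‖ + 1)) := by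
    refine Summable.hasProdLocallyUniformlyOn_nat_one_add Metric.isOpen_ball
      ((summable_geometric_of_lt_one hq0.le hq1).mul_right (‖x‖ + 1)) ?_ ?_
    · refine Filter.Eventually.of_forall fun j y hy => ?_
      rw [mem_ball_zero_iff] at hy
      simp only [norm_neg, norm_mul, norm_pow, Complex.norm_real, Real.norm_of_nonneg hq0.le]
      gcongr
    · intro j
      fun_prop
  have hd := h.differentiableOn (Filter.Eventually.of_forall fun s => by
    refine DifferentiableOn.fun_finsetProd fun i _ => ?_
    fun_prop) Metric.isOpen_ball
  have e : qPoch q = fun y => ∏' j : ℕ, (1 + -((q : ℂ) ^ j * y)) := by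
    funext y
    simp only [qPoch, sub_eq_add_neg]
  rw [e]
  exact (hd x (by simp)).differentiableAt (Metric.isOpen_ball.mem_nhds (by simp))

theorem qPoch_eq (x : ℂ) : qPoch q x = (1 - x) * qPoch q (q * x) := by
  rw [qPoch, tprod_eq_zero_mul']
  · simp only [pow_zero, one_mul, qPoch, pow_succ, mul_assoc]
  · simpa only [pow_succ, mul_assoc] using multipliable_qPoch hq0 hq1 (q * x)

theorem qPoch_ne_zero {x : ℂ} (hx : ∀ j : ℕ, (q : ℂ) ^ j * x ≠ 1) : qPoch q x ≠ 0 := by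
  have := tprod_one_add_ne_zero_of_summable (f := fun j : ℕ => -((q : ℂ) ^ j * x))
    (fun j h => hx j (by linear_combination -h)) (summable_norm_geometric_mul hq0 hq1 x)
  simpa [qPoch, sub_eq_add_neg] using this

/-- Split the product by the parity of the index: 1 - q^{2j}x² = (1 - q^j x)(1 + q^j x), and the odd
factors have the same shape with x replaced by sx. -/
theorem qPoch_sq {s : ℂ} (hs : s ^ 2 = q) (x : ℂ) :
    qPoch q (x ^ 2) = qPoch q x * qPoch q (-x) * (qPoch q (s * x) * qPoch q (-(s * x))) := by
  have key : ∀ y : ℂ, HasProd (fun j : ℕ => 1 - (q : ℂ) ^ (2 * j) * y ^ 2)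
      (qPoch q y * qPoch q (-y)) := fun y => by
    convert (multipliable_qPoch hq0 hq1 y).hasProd.mul (multipliable_qPoch hq0 hq1 (-y)).hasProd
      using 1
    · funext j
      ring
    · rfl
  have h0 := key x
  have h1 := key (s * x)
  have e : (fun j : ℕ => 1 - (q : ℂ) ^ (2 * j) * (s * x) ^ 2) =
      fun j : ℕ => 1 - (q : ℂ) ^ (2 * j + 1) * x ^ 2 := by
    funext j
    rw [mul_pow, hs]
    ring
  rw [e] at h1
  rw [← h0.tprod_eq, ← h1.tprod_eq, qPoch]
  exact (tprod_even_mul_odd (f := fun j : ℕ => 1 - (q : ℂ) ^ j * x ^ 2) h0.multipliable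
    h1.multipliable).symm

theorem theta_eq (x : ℂ) : theta q x = qPoch q x * qPoch q (q / x) := by
  rw [theta, qPoch, qPoch, ← (multipliable_qPoch hq0 hq1 x).tprod_mul
    (multipliable_qPoch hq0 hq1 (q / x))]
  congr 1
  funext j
  ring

theorem theta_q_mul {x : ℂ} (hx : x ≠ 0) : theta q (q * x) = -(1 / x) * theta q x := by
  have hq : (q : ℂ) ≠ 0 := by exact_mod_cast hq0.ne'
  rw [theta_eq hq0 hq1, theta_eq hq0 hq1, qPoch_eq hq0 hq1 x,
    div_mul_cancel_left₀ hq, qPoch_eq hq0 hq1 x⁻¹, ← div_eq_mul_inv]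
  field_simp
  ring

theorem theta_inv {x : ℂ} (hx : x ≠ 0) : theta q (1 / x) = -(1 / x) * theta q x := by
  have hq : (q : ℂ) ≠ 0 := by exact_mod_cast hq0.ne'
  rw [theta_eq hq0 hq1, theta_eq hq0 hq1, qPoch_eq hq0 hq1 x, 
    qPoch_eq hq0 hq1 (1 / x), mul_one_div, div_div_eq_mul_div, div_one]
  field_simp
  ring

/-- The source of the duplication formula `jac_prod`: `qPoch_sq` is applied to x and to s/x, and the
resulting factors pair up because s · (s/x) = q/x. -/
theorem theta_sq {s : ℂ} (hs : s ^ 2 = q) {x : ℂ} (hx : x ≠ 0) :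
    theta q (x ^ 2) = theta q x * theta q (-x) * (theta q (s * x) * theta q (-(s * x))) := by
  have hq : (q : ℂ) ≠ 0 := by exact_mod_cast hq0.ne'
  have hs0 : s ≠ 0 := by rintro rfl; exact hq (by rw [← hs]; ring)
  simp only [theta_eq hq0 hq1, qPoch_sq hq0 hq1 hs x]
  have e : (q : ℂ) / x ^ 2 = (s / x) ^ 2 := by rw [← hs]; ring
  rw [e, qPoch_sq hq0 hq1 hs (s / x)]
  have e1 : (q : ℂ) / (s * x) = s / x := by rw [← hs]; field_simp
  have e2 : (q : ℂ) / -(s * x) = -(s / x) := by rw [← hs]; field_simp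
  have e3 : s * (s / x) = q / x := by rw [← hs]; ring
  have e4 : -(q / x) = q / -x := by ring
  rw [e1, e2, e3, e4]
  ring

theorem differentiableAt_theta {x : ℂ} (hx : x ≠ 0) : DifferentiableAt ℂ (theta q) x := by
  have : theta q = fun x => qPoch q x * qPoch q (q / x) := funext (theta_eq hq0 hq1)
  rw [this]
  exact (differentiable_qPoch hq0 hq1 x).mul
    ((differentiable_qPoch hq0 hq1 _).fun_comp' x (by fun_prop (disch := exact hx)))

theorem theta_ne_zero {x : ℂ} (hx : ∀ j : ℕ, (q : ℂ) ^ j * x ≠ 1)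
    (hx' : ∀ j : ℕ, (q : ℂ) ^ (j + 1) ≠ x) : theta q x ≠ 0 := by
  rw [theta_eq hq0 hq1]
  refine mul_ne_zero (qPoch_ne_zero hq0 hq1 hx) (qPoch_ne_zero hq0 hq1 fun j h => hx' j ?_)
  have h0 : x ≠ 0 := by rintro rfl; simp at h
  field_simp at h
  rw [pow_succ, h]

end Theta

/-! ### Laurent coefficients and the Weierstrass identity -/

/-- The `n`-th Laurent coefficient of `g`, up to the factor `2πi`, computed on the circle `|w| = r`. -/
noncomputable def laurentCoeff (r : ℝ) (n : ℤ) (g : ℂ → ℂ) : ℂ :=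
  ∮ w in C(0, r), (w - 0)⁻¹ • (w ^ (-n) * g w)

theorem laurentCoeff_eq_intervalIntegral {r : ℝ} (hr : r ≠ 0) (n : ℤ) (g : ℂ → ℂ) :
    laurentCoeff r n g =
      ∫ t in (0 : ℝ)..2 * Real.pi, Complex.I * (circleMap 0 r t ^ (-n) * g (circleMap 0 r t)) := by
  simp only [laurentCoeff, circleIntegral, deriv_circleMap, smul_eq_mul, sub_zero]
  refine intervalIntegral.integral_congr fun t _ => ?_
  have : circleMap 0 r t ≠ 0 := circleMap_ne_center hr
  field_simp

theorem laurentCoeff_radius {g : ℂ → ℂ} (hg : ∀ w ≠ 0, DifferentiableAt ℂ g w) (n : ℤ) {r R : ℝ}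
    (hr : 0 < r) (hR : r ≤ R) : laurentCoeff R n g = laurentCoeff r n g := by
  have hd : ∀ w : ℂ, w ≠ 0 → DifferentiableAt ℂ (fun w => w ^ (-n) * g w) w := fun w hw =>
    (differentiableAt_zpow.2 (Or.inl hw)).mul (hg w hw)
  -- Deformation of the contour across the annulus; the shape `(w - 0)⁻¹ •` in `laurentCoeff` is
  -- chosen to match it.
  refine Complex.circleIntegral_sub_center_inv_smul_eq_of_differentiable_on_annulus_off_countable
    hr hR Set.countable_empty ?_ ?_
  · intro w hw
    refine (hd w ?_).continuousAt.continuousWithinAt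
    rintro rfl
    exact hw.2 (by simpa using hr)
  · intro w hw
    refine hd w ?_
    rintro rfl
    exact hw.1.2 (by simpa using hr.le)

/-- On the circle of radius r the Laurent coefficients are, up to nonzero factors, the Fourier
coefficients of a continuous function. When they all vanish the Fourier series is trivially
summable, so it converges to the function, which is therefore 0. -/
theorem eq_zero_of_laurentCoeff {g : ℂ → ℂ} (hg : ∀ w ≠ 0, DifferentiableAt ℂ g w) {r : ℝ}
    (hr : 0 < r) (h : ∀ n, laurentCoeff r n g = 0) {w : ℂ} (hw : ‖w‖ = r) : g w = 0 := by
  have : Fact (0 < 2 * Real.pi) := ⟨Real.two_pi_pos⟩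
  have hr0 : (r : ℂ) ≠ 0 := by exact_mod_cast hr.ne'
  have hcont : Continuous fun t : AddCircle (2 * Real.pi) => g (r * (AddCircle.toCircle t : ℂ)) := by
    refine continuous_iff_continuousAt.2 fun t => ?_
    refine ContinuousAt.comp' (hg _ ?_).continuousAt ?_
    · exact mul_ne_zero hr0 (Circle.coe_ne_zero _)
    · have := AddCircle.continuous_toCircle (T := 2 * Real.pi)
      fun_prop
  set F : C(AddCircle (2 * Real.pi), ℂ) := ⟨_, hcont⟩ with hF
  have hc : ∀ t : ℝ, (AddCircle.toCircle (t : AddCircle (2 * Real.pi)) : ℂ) =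
      Complex.exp (t * Complex.I) := fun t => by
    rw [AddCircle.toCircle_apply_mk, Circle.coe_exp]
    congr 2
    field_simp
  have hco : ∀ n, fourierCoeff F n = 0 := by
    intro n
    rw [fourierCoeff_eq_intervalIntegral _ _ 0]
    have h1 := h n
    rw [laurentCoeff_eq_intervalIntegral hr.ne'] at h1
    have e : ∀ t : ℝ, Complex.I * (circleMap 0 r t ^ (-n) * g (circleMap 0 r t)) =
        (Complex.I * (r : ℂ) ^ (-n)) * (@fourier (2 * Real.pi) (-n) t • F t) := fun t => by
      rw [fourier_apply, hF]
      simp only [ContinuousMap.coe_mk, AddCircle.toCircle_zsmul, Circle.coe_zpow, hc, circleMap,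
        zero_add, mul_zpow, smul_eq_mul]
      ring
    simp_rw [e] at h1
    rw [intervalIntegral.integral_const_mul] at h1
    rw [zero_add, (mul_eq_zero.1 h1).resolve_left
      (mul_ne_zero Complex.I_ne_zero (zpow_ne_zero _ hr0)), smul_zero]
  have hs := hasSum_fourier_series_of_summable (f := F) (summable_zero.congr fun n => (hco n).symm)
  simp only [hco, zero_smul] at hs
  have hF0 : F = 0 := hs.unique hasSum_zero
  have h2 : F (Complex.arg w : ℝ) = 0 := by rw [hF0]; rfl
  rw [hF] at h2
  simp only [ContinuousMap.coe_mk, hc] at h2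
  rwa [← hw, Complex.norm_mul_exp_arg_mul_I] at h2

/-- The substitution w ↦ qw in the integral. With independence of the radius it becomes a recursion
linking coefficients n and n + 2. -/
theorem laurentCoeff_shift {g : ℂ → ℂ} {q : ℝ} (hq0 : 0 < q) {r : ℝ} (hr : 0 < r) {C : ℂ}
    (hg : ∀ w ≠ 0, g (q * w) = C * w ^ (-2 : ℤ) * g w) (n : ℤ) :
    laurentCoeff (q * r) n g = (q : ℂ) ^ (-n) * C * laurentCoeff r (n + 2) g := by
  rw [laurentCoeff_eq_intervalIntegral (mul_pos hq0 hr).ne', laurentCoeff_eq_intervalIntegral hr.ne',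
    ← intervalIntegral.integral_const_mul]
  refine intervalIntegral.integral_congr fun t _ => ?_
  have h0 : circleMap 0 r t ≠ 0 := circleMap_ne_center hr.ne'
  have e : circleMap 0 (q * r) t = q * circleMap 0 r t := by
    simp [circleMap, mul_assoc]
  simp only [e]
  rw [hg _ h0, mul_zpow, neg_add, zpow_add₀ h0]
  ring

/-- The recursion of step 2 propagates the vanishing of coefficients 0 and 1 to all integers in both
directions. So the quasi-periodic functions with a given C form a space of dimension at most 2. -/
theorem eq_zero_of_quasiperiodic {g : ℂ → ℂ} {q : ℝ} (hq0 : 0 < q) (hq1 : q < 1)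
    (hd : ∀ w ≠ 0, DifferentiableAt ℂ g w) {C : ℂ} (hC : C ≠ 0)
    (hg : ∀ w ≠ 0, g (q * w) = C * w ^ (-2 : ℤ) * g w)
    (h0 : laurentCoeff 1 0 g = 0) (h1 : laurentCoeff 1 1 g = 0) {w : ℂ} (hw : w ≠ 0) : g w = 0 := by
  have hq : (q : ℂ) ≠ 0 := by exact_mod_cast hq0.ne'
  have step : ∀ n, laurentCoeff 1 n g = 0 ↔ laurentCoeff 1 (n + 2) g = 0 := fun n => by
    have h := laurentCoeff_shift hq0 one_pos hg n
    rw [mul_one, ← laurentCoeff_radius hd n hq0 hq1.le] at h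
    rw [h]
    simp [hq, hC, zpow_ne_zero]
  have both : ∀ n : ℤ, laurentCoeff 1 n g = 0 ∧ laurentCoeff 1 (n + 1) g = 0 := fun n => by
    induction n using Int.induction_on with
    | zero => exact ⟨h0, h1⟩
    | succ k ih => exact ⟨ih.2, by have := (step _).1 ih.1; rwa [add_assoc, one_add_one_eq_two]⟩
    | pred k ih =>
      refine ⟨(step _).2 ?_, by rw [sub_add_cancel]; exact ih.1⟩
      have := ih.2
      rwa [show (-(k : ℤ) - 1 + 2) = -(k : ℤ) + 1 by ring]
  refine eq_zero_of_laurentCoeff hd (norm_pos_iff.2 hw) (fun n => ?_) rfl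
  rcases le_total 1 ‖w‖ with h | h
  · rw [laurentCoeff_radius hd n one_pos h, (both n).1]
  · rw [← laurentCoeff_radius hd n (norm_pos_iff.2 hw) h, (both n).1]

theorem laurentCoeff_sum {ι : Type*} (s : Finset ι) (a : ι → ℂ) (g : ι → ℂ → ℂ)
    (hg : ∀ i, ∀ w ≠ 0, DifferentiableAt ℂ (g i) w) (n : ℤ) :
    laurentCoeff 1 n (fun w => ∑ i ∈ s, a i * g i w) = ∑ i ∈ s, a i * laurentCoeff 1 n (g i) := by
  simp only [laurentCoeff_eq_intervalIntegral one_ne_zero]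
  simp_rw [← intervalIntegral.integral_const_mul]
  rw [← intervalIntegral.integral_finsetSum]
  · refine intervalIntegral.integral_congr fun t _ => ?_
    simp only [Finset.mul_sum]
    exact Finset.sum_congr rfl fun i _ => by ring
  · intro i _
    refine Continuous.intervalIntegrable ?_ _ _
    refine continuous_iff_continuousAt.2 fun t => ?_
    have h0 : circleMap 0 1 t ≠ 0 := circleMap_ne_center one_ne_zero
    have hc : ContinuousAt (circleMap 0 1) t := (continuous_circleMap 0 1).continuousAt
    exact continuousAt_const.mul (continuousAt_const.mul ((hc.zpow₀ _ (Or.inl h0)).mul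
      (ContinuousAt.comp' (hg i _ h0).continuousAt hc)))

/-- The antisymmetric kernel `θ(xy, x/y; q) / x`. -/
noncomputable def thetaKernel (q : ℝ) (x y : ℂ) : ℂ := x⁻¹ * (theta q (x * y) * theta q (x / y))

section

variable {q : ℝ} (hq0 : 0 < q) (hq1 : q < 1)
include hq0 hq1

theorem thetaKernel_antisymm {x y : ℂ} (hx : x ≠ 0) (hy : y ≠ 0) :
    thetaKernel q y x = -thetaKernel q x y := by
  have h := theta_inv hq0 hq1 (div_ne_zero hx hy)
  rw [one_div_div] at h
  rw [thetaKernel, thetaKernel, h, mul_comm y x]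
  field_simp

theorem thetaKernel_q_mul {x y : ℂ} (hx : x ≠ 0) (hy : y ≠ 0) :
    thetaKernel q (q * x) y = (q : ℂ)⁻¹ * x ^ (-2 : ℤ) * thetaKernel q x y := by
  have hq : (q : ℂ) ≠ 0 := by exact_mod_cast hq0.ne'
  rw [thetaKernel, thetaKernel, mul_assoc, mul_div_assoc, theta_q_mul hq0 hq1 (mul_ne_zero hx hy),
    theta_q_mul hq0 hq1 (div_ne_zero hx hy)]
  have e : x ^ (-2 : ℤ) = (x ^ 2)⁻¹ := by
    rw [zpow_neg]
    rfl
  rw [e]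
  field_simp

theorem differentiableAt_thetaKernel {x y : ℂ} (hx : x ≠ 0) (hy : y ≠ 0) :
    DifferentiableAt ℂ (fun x => thetaKernel q x y) x := by
  unfold thetaKernel
  refine (differentiableAt_inv hx).mul (DifferentiableAt.mul ?_ ?_)
  · exact (differentiableAt_theta hq0 hq1 (mul_ne_zero hx hy)).fun_comp' x (by fun_prop)
  · exact (differentiableAt_theta hq0 hq1 (div_ne_zero hx hy)).fun_comp' x (by fun_prop)

/-- The three kernels with second arguments y₁, y₂, y₃ share one quasi-periodicity factor, so a
nonzero kernel vector a of their 2 × 3 matrix of Laurent coefficients is a linear relation between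
them as functions. Evaluating it at the yᵢ, where the diagonal terms vanish by antisymmetry,
identifies a up to scale, with no need for the yᵢ to be distinct. -/
theorem thetaKernel_plucker {x y₁ y₂ y₃ : ℂ} (hx : x ≠ 0) (h₁ : y₁ ≠ 0) (h₂ : y₂ ≠ 0)
    (h₃ : y₃ ≠ 0) :
    thetaKernel q x y₁ * thetaKernel q y₂ y₃ + thetaKernel q x y₂ * thetaKernel q y₃ y₁ +
      thetaKernel q x y₃ * thetaKernel q y₁ y₂ = 0 := by
  set y : Fin 3 → ℂ := ![y₁, y₂, y₃] with hy
  have hy0 : ∀ i, y i ≠ 0 := by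
    intro i
    fin_cases i <;> simpa [hy]
  set c : Matrix (Fin 2) (Fin 3) ℂ :=
    fun n i => laurentCoeff 1 (n : ℕ) fun w => thetaKernel q w (y i) with hc
  have hker := LinearMap.ker_ne_bot_of_finrank_lt (f := Matrix.toLin' c) (by simp)
  obtain ⟨a, ha, ha0⟩ := (Submodule.ne_bot_iff _).1 hker
  rw [LinearMap.mem_ker, Matrix.toLin'_apply] at ha
  have hco : ∀ n : Fin 2, ∑ i, a i * laurentCoeff 1 (n : ℕ) (fun w => thetaKernel q w (y i)) = 0 :=
    fun n => by
      have := congrFun ha n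
      simpa only [Matrix.mulVec, dotProduct, hc, mul_comm, Pi.zero_apply] using this
  have hd : ∀ i, ∀ w ≠ 0, DifferentiableAt ℂ (fun w => thetaKernel q w (y i)) w := fun i w hw =>
    differentiableAt_thetaKernel hq0 hq1 hw (hy0 i)
  have hz : ∀ w ≠ 0, ∑ i, a i * thetaKernel q w (y i) = 0 := by
    intro w hw
    refine eq_zero_of_quasiperiodic (g := fun w => ∑ i, a i * thetaKernel q w (y i))
      (C := (q : ℂ)⁻¹) hq0 hq1 ?_ ?_ ?_ ?_ ?_ hw
    · exact fun w hw => DifferentiableAt.fun_sum fun i _ => (hd i w hw).const_mul _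
    · exact inv_ne_zero (by exact_mod_cast hq0.ne')
    · intro w hw
      simp only [Finset.mul_sum, thetaKernel_q_mul hq0 hq1 hw (hy0 _)]
      exact Finset.sum_congr rfl fun i _ => by ring
    · rw [laurentCoeff_sum _ _ _ hd]
      exact hco 0
    · rw [laurentCoeff_sum _ _ _ hd]
      exact hco 1
  simp only [Fin.sum_univ_three, hy, Matrix.cons_val_zero, Matrix.cons_val_one,
    Matrix.cons_val] at hz
  have s₁ : thetaKernel q y₁ y₁ = 0 := by
    have := thetaKernel_antisymm hq0 hq1 h₁ h₁
    linear_combination this / 2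
  have s₂ : thetaKernel q y₂ y₂ = 0 := by
    have := thetaKernel_antisymm hq0 hq1 h₂ h₂
    linear_combination this / 2
  have s₃ : thetaKernel q y₃ y₃ = 0 := by
    have := thetaKernel_antisymm hq0 hq1 h₃ h₃
    linear_combination this / 2
  have e₁ := hz y₁ h₁
  have e₂ := hz y₂ h₂
  have e₃ := hz y₃ h₃
  have e := hz x hx
  rw [s₁, thetaKernel_antisymm hq0 hq1 h₃ h₁] at e₁
  rw [s₂, thetaKernel_antisymm hq0 hq1 h₁ h₂] at e₂
  rw [s₃, thetaKernel_antisymm hq0 hq1 h₂ h₃] at e₃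
  by_contra hne
  refine ha0 (funext fun i => ?_)
  -- The evaluations `e₁`, `e₂`, `e₃` say that the cross product of a with (k(y₂,y₃), k(y₃,y₁),
  -- k(y₁,y₂)) is zero, k being the kernel; inserting this parallelism into the relation `e` at x
  -- gives aᵢ times the claim.
  have main : ∀ i, a i * (thetaKernel q x y₁ * thetaKernel q y₂ y₃ +
      thetaKernel q x y₂ * thetaKernel q y₃ y₁ + thetaKernel q x y₃ * thetaKernel q y₁ y₂) = 0 := by
    intro i
    fin_cases i
    · simp only [Fin.zero_eta, Fin.isValue]
      linear_combination thetaKernel q y₂ y₃ * e + thetaKernel q x y₂ * e₃ -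
        thetaKernel q x y₃ * e₂
    · simp only [Fin.mk_one, Fin.isValue]
      linear_combination thetaKernel q y₃ y₁ * e + thetaKernel q x y₃ * e₁ -
        thetaKernel q x y₁ * e₃
    · simp only [Fin.reduceFinMk, Fin.isValue]
      linear_combination thetaKernel q y₁ y₂ * e + thetaKernel q x y₁ * e₂ -
        thetaKernel q x y₂ * e₁
  exact (mul_eq_zero.1 (main i)).resolve_right hne

end

/-! ### The odd function `σ(x) = q^{-x/2} θ(q^x)` and its half-period translates -/

/-- `f` is odd, `g` is even or odd, and the two satisfy the mixed Weierstrass three-term identity. -/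
structure SigmaPair (f g : ℂ → ℂ) (ε : ℂ) : Prop where
  odd : ∀ x, f (-x) = -f x
  parity : ∀ x, g (-x) = ε * g x
  ne_zero : ε ≠ 0
  weierstrass : ∀ x y u v, g (x + y) * g (x - y) * (f (u + v) * f (u - v)) +
    g (x + u) * g (x - u) * (f (v + y) * f (v - y)) +
    g (x + v) * g (x - v) * (f (y + u) * f (y - u)) = 0

/-- A form convenient for use: the twelve arguments are read off the expected statement and matched
by `ring`, so each application only has to supply the four half-sums. -/
theorem SigmaPair.weierstrass' {f g : ℂ → ℂ} {ε : ℂ} (h : SigmaPair f g ε) (x y u v : ℂ)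
    {a₁ a₂ a₃ a₄ b₁ b₂ b₃ b₄ c₁ c₂ c₃ c₄ : ℂ}
    (ha₁ : a₁ = x + y := by ring) (ha₂ : a₂ = x - y := by ring)
    (ha₃ : a₃ = u + v := by ring) (ha₄ : a₄ = u - v := by ring)
    (hb₁ : b₁ = x + u := by ring) (hb₂ : b₂ = x - u := by ring)
    (hb₃ : b₃ = v + y := by ring) (hb₄ : b₄ = v - y := by ring)
    (hc₁ : c₁ = x + v := by ring) (hc₂ : c₂ = x - v := by ring)
    (hc₃ : c₃ = y + u := by ring) (hc₄ : c₄ = y - u := by ring) :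
    g a₁ * g a₂ * (f a₃ * f a₄) + g b₁ * g b₂ * (f b₃ * f b₄) +
      g c₁ * g c₂ * (f c₃ * f c₄) = 0 := by
  subst ha₁ ha₂ ha₃ ha₄ hb₁ hb₂ hb₃ hb₄ hc₁ hc₂ hc₃ hc₄
  exact h.weierstrass x y u v

theorem SigmaPair.odd_sub {f g : ℂ → ℂ} {ε : ℂ} (h : SigmaPair f g ε) (x y : ℂ) :
    f (x - y) = -f (y - x) := by
  rw [← h.odd, neg_sub]

/-- The odd theta function `q^{-x/2} θ(q^x; q)`. -/
noncomputable def sig (q : ℝ) (x : ℂ) : ℂ := qpow q (-x / 2) * theta q (qpow q x)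

/-- The half-period with `q^{τ} = -1`. -/
noncomputable def tau (q : ℝ) : ℂ := Real.pi * Complex.I / Complex.log q

/-- The half-periods `0, τ, 1/2, 1/2 + τ`. -/
noncomputable def halfPeriod (q : ℝ) : Fin 4 → ℂ := ![0, tau q, 1 / 2, 1 / 2 + tau q]

/-- The exponents that make the translates of `sig` by the half-periods even or odd. -/
noncomputable def halfExp : Fin 4 → ℂ := ![0, 0, 1 / 2, 1 / 2]

/-- The four Jacobi theta functions, as normalised translates of `sig` by half-periods. -/
noncomputable def jac (q : ℝ) (i : Fin 4) (x : ℂ) : ℂ :=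
  qpow q (halfExp i * x) * sig q (x + halfPeriod q i)

/-- The parities of the four functions `jac`. -/
def jacSign : Fin 4 → ℂ := ![-1, 1, 1, 1]

section

variable {q : ℝ} (hq0 : 0 < q) (hq1 : q < 1)

include hq0 in
theorem ofReal_q_ne_zero : (q : ℂ) ≠ 0 := by exact_mod_cast hq0.ne'

include hq0 in
theorem qpow_ne_zero (x : ℂ) : qpow q x ≠ 0 := by
  simp [qpow, Complex.cpow_eq_zero_iff, ofReal_q_ne_zero hq0]

include hq0 in
theorem qpow_add (x y : ℂ) : qpow q (x + y) = qpow q x * qpow q y :=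
  Complex.cpow_add _ _ (ofReal_q_ne_zero hq0)

theorem qpow_zero : qpow q 0 = 1 := Complex.cpow_zero _

theorem qpow_one : qpow q 1 = q := Complex.cpow_one _

theorem qpow_neg (x : ℂ) : qpow q (-x) = (qpow q x)⁻¹ := Complex.cpow_neg _ _

include hq0 in
theorem qpow_sub (x y : ℂ) : qpow q (x - y) = qpow q x / qpow q y :=
  Complex.cpow_sub _ _ (ofReal_q_ne_zero hq0)

include hq0 in
theorem qpow_half_sq : qpow q (1 / 2) ^ 2 = q := by
  rw [sq, ← qpow_add hq0, add_halves, qpow_one]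

include hq0 hq1 in
theorem qpow_tau : qpow q (tau q) = -1 := by
  have hl : Complex.log q ≠ 0 := by
    rw [← Complex.ofReal_log hq0.le]
    exact_mod_cast (Real.log_neg hq0 hq1).ne
  rw [qpow, Complex.cpow_def_of_ne_zero (ofReal_q_ne_zero hq0), tau, mul_div_cancel₀ _ hl,
    Complex.exp_pi_mul_I]

include hq0 hq1

theorem sig_neg (x : ℂ) : sig q (-x) = -sig q x := by
  have h := theta_inv hq0 hq1 (qpow_ne_zero hq0 x)
  rw [sig, sig, qpow_neg, ← one_div, h]
  have e : qpow q x = qpow q (-(-x) / 2) * qpow q (-(-x) / 2) := by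
    rw [← qpow_add hq0]
    ring_nf
  have e' : qpow q (-x / 2) = (qpow q (-(-x) / 2))⁻¹ := by
    rw [← qpow_neg]
    ring_nf
  have h0 := qpow_ne_zero hq0 (-(-x) / 2)
  rw [e', ← mul_assoc, e]
  field_simp

theorem sig_add_one (x : ℂ) : sig q (x + 1) = -qpow q (-x - 1 / 2) * sig q x := by
  rw [sig, sig, qpow_add hq0 x, qpow_one, mul_comm (qpow q x),
    theta_q_mul hq0 hq1 (qpow_ne_zero hq0 x), one_div, ← qpow_neg]
  have e : qpow q (-(x + 1) / 2) * qpow q (-x) = qpow q (-x - 1 / 2) * qpow q (-x / 2) := by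
    rw [← qpow_add hq0, ← qpow_add hq0]
    ring_nf
  linear_combination -theta q (qpow q x) * e

theorem sig_add_two_tau (x : ℂ) : sig q (x + 2 * tau q) = -sig q x := by
  have e : qpow q (-(x + 2 * tau q) / 2) = -qpow q (-x / 2) := by
    rw [show -(x + 2 * tau q) / 2 = -x / 2 - tau q by ring, qpow_sub hq0, qpow_tau hq0 hq1]
    ring
  have e' : qpow q (x + 2 * tau q) = qpow q x := by
    rw [two_mul, qpow_add hq0, qpow_add hq0, qpow_tau hq0 hq1]
    ring
  rw [sig, sig, e, e']
  ring

-- The two half-integral powers of q combine to q^{-x}, so the product depends only on q^x and q^y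
-- and the identity for the kernel transfers to `sig`.
omit hq1 in
theorem sig_mul_sig (x y : ℂ) :
    sig q (x + y) * sig q (x - y) = thetaKernel q (qpow q x) (qpow q y) := by
  have e : qpow q (-(x + y) / 2) * qpow q (-(x - y) / 2) = (qpow q x)⁻¹ := by
    rw [← qpow_add hq0, ← qpow_neg]
    ring_nf
  rw [sig, sig, thetaKernel, ← qpow_add hq0, ← qpow_sub hq0, ← e]
  ring

theorem sig_weierstrass (x y u v : ℂ) :
    sig q (x + y) * sig q (x - y) * (sig q (u + v) * sig q (u - v)) +
    sig q (x + u) * sig q (x - u) * (sig q (v + y) * sig q (v - y)) +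
    sig q (x + v) * sig q (x - v) * (sig q (y + u) * sig q (y - u)) = 0 := by
  simp only [sig_mul_sig hq0]
  exact thetaKernel_plucker hq0 hq1 (qpow_ne_zero hq0 _) (qpow_ne_zero hq0 _) (qpow_ne_zero hq0 _)
    (qpow_ne_zero hq0 _)

theorem sigmaPair_sig : SigmaPair (sig q) (sig q) (-1) where
  odd := sig_neg hq0 hq1
  parity x := by rw [sig_neg hq0 hq1, neg_one_mul]
  ne_zero := by norm_num
  weierstrass := sig_weierstrass hq0 hq1

omit hq0 hq1 in
theorem jac_zero (x : ℂ) : jac q 0 x = sig q x := by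
  simp [jac, halfExp, halfPeriod, qpow_zero]

omit hq0 hq1 in
theorem jac_one (x : ℂ) : jac q 1 x = sig q (x + tau q) := by
  simp [jac, halfExp, halfPeriod, qpow_zero]

omit hq0 hq1 in
theorem jac_two (x : ℂ) : jac q 2 x = qpow q (x / 2) * sig q (x + 1 / 2) := by
  simp [jac, halfExp, halfPeriod, div_eq_inv_mul]

omit hq0 hq1 in
theorem jac_three (x : ℂ) : jac q 3 x = qpow q (x / 2) * sig q (x + 1 / 2 + tau q) := by
  simp [jac, halfExp, halfPeriod, div_eq_inv_mul, add_assoc]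

/-- A half-period and its negative differ by a full period (2τ, 1, or both); the multiplier of `sig`
under that period is absorbed by the exponent `halfExp`. -/
theorem jac_parity (i : Fin 4) (x : ℂ) : jac q i (-x) = jacSign i * jac q i x := by
  fin_cases i
  · simp [jac_zero, jacSign, sig_neg hq0 hq1]
  · have h := sig_add_two_tau hq0 hq1 (x - tau q)
    have h' := sig_neg hq0 hq1 (x - tau q)
    rw [show x - tau q + 2 * tau q = x + tau q by ring] at h
    rw [show -(x - tau q) = -x + tau q by ring] at h'
    simp [jac_one, jacSign, h, h']
  · have h := sig_add_one hq0 hq1 (x - 1 / 2)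
    have h' := sig_neg hq0 hq1 (x - 1 / 2)
    rw [show x - 1 / 2 + 1 = x + 1 / 2 by ring] at h
    rw [show -(x - 1 / 2) = -x + 1 / 2 by ring] at h'
    have e : qpow q (x / 2) * qpow q (-(x - 1 / 2) - 1 / 2) = qpow q (-x / 2) := by
      rw [← qpow_add hq0]
      ring_nf
    simp only [Fin.reduceFinMk, jac_two, jacSign, h, h', Matrix.cons_val]
    linear_combination sig q (x - 1 / 2) * e
  · have h := sig_add_one hq0 hq1 (x - 1 / 2 - tau q)
    have h1 := sig_add_two_tau hq0 hq1 (x - 1 / 2 - tau q + 1)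
    have h' := sig_neg hq0 hq1 (x - 1 / 2 - tau q)
    rw [show x - 1 / 2 - tau q + 1 + 2 * tau q = x + 1 / 2 + tau q by ring] at h1
    rw [show -(x - 1 / 2 - tau q) = -x + 1 / 2 + tau q by ring] at h'
    have e : qpow q (x / 2) * qpow q (-(x - 1 / 2 - tau q) - 1 / 2) = -qpow q (-x / 2) := by
      rw [← qpow_add hq0, show x / 2 + (-(x - 1 / 2 - tau q) - 1 / 2) = -x / 2 + tau q by ring,
        qpow_add hq0, qpow_tau hq0 hq1]
      ring
    simp only [Fin.reduceFinMk, jac_three, jacSign, h, h', h1, Matrix.cons_val]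
    linear_combination -sig q (x - 1 / 2 - tau q) * e

/-- Translate x by the half-period in Weierstrass's identity. The exponential factors at x + y and x
- y multiply to one depending on x alone, hence common to the three terms. -/
theorem sigmaPair_jac (i : Fin 4) : SigmaPair (sig q) (jac q i) (jacSign i) where
  odd := sig_neg hq0 hq1
  parity := jac_parity hq0 hq1 i
  ne_zero := by fin_cases i <;> simp [jacSign]
  weierstrass x y u v := by
    have h := sig_weierstrass hq0 hq1 (x + halfPeriod q i) y u v
    have e : ∀ y, jac q i (x + y) * jac q i (x - y) = qpow q (halfExp i * (2 * x)) *
        (sig q (x + halfPeriod q i + y) * sig q (x + halfPeriod q i - y)) := fun y => by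
      rw [jac, jac, show halfExp i * (2 * x) = halfExp i * (x + y) + halfExp i * (x - y) by ring,
        qpow_add hq0, add_right_comm x y, sub_add_eq_add_sub x y]
      ring
    rw [e, e, e]
    linear_combination qpow q (halfExp i * (2 * x)) * h

/-- The duplication formula: the four half-periods are the zeros of x ↦ σ(2x) modulo periods. -/
theorem jac_prod : ∃ C : ℂ, C ≠ 0 ∧ ∀ x,
    jac q 0 x * jac q 1 x * jac q 2 x * jac q 3 x = C * sig q (2 * x) := by
  refine ⟨qpow q (-tau q / 2) * qpow q (-1 / 4) * qpow q (-(1 / 2 + tau q) / 2),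
    mul_ne_zero (mul_ne_zero (qpow_ne_zero hq0 _) (qpow_ne_zero hq0 _)) (qpow_ne_zero hq0 _),
    fun x => ?_⟩
  have h := theta_sq hq0 hq1 (qpow_half_sq hq0) (qpow_ne_zero hq0 x)
  have e1 : qpow q (x + tau q) = -qpow q x := by
    rw [qpow_add hq0, qpow_tau hq0 hq1]
    ring
  have e2 : qpow q (x + 1 / 2) = qpow q (1 / 2) * qpow q x := by
    rw [qpow_add hq0, mul_comm]
  have e3 : qpow q (x + 1 / 2 + tau q) = -(qpow q (1 / 2) * qpow q x) := by
    rw [qpow_add hq0, e2, qpow_tau hq0 hq1]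
    ring
  have e4 : qpow q (2 * x) = qpow q x ^ 2 := by
    rw [two_mul, qpow_add hq0, sq]
  rw [jac_zero, jac_one, jac_two, jac_three]
  simp only [sig, e1, e2, e3, e4, h]
  have c1 : qpow q (-(x + tau q) / 2) = qpow q (-x / 2) * qpow q (-tau q / 2) := by
    rw [← qpow_add hq0]
    ring_nf
  have c2 : qpow q (x / 2) * qpow q (-(x + 1 / 2) / 2) = qpow q (-1 / 4) := by
    rw [← qpow_add hq0]
    ring_nf
  have c3 : qpow q (x / 2) * qpow q (-(x + 1 / 2 + tau q) / 2) =
      qpow q (-(1 / 2 + tau q) / 2) := by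
    rw [← qpow_add hq0]
    ring_nf
  have c4 : qpow q (-(2 * x) / 2) = qpow q (-x / 2) * qpow q (-x / 2) := by
    rw [← qpow_add hq0]
    ring_nf
  rw [c1, c4, ← c2, ← c3]
  ring

omit hq1 in
theorem differentiable_qpow : Differentiable ℂ (qpow q) := fun x => by
  unfold qpow
  exact (differentiableAt_id.const_cpow (Or.inl (ofReal_q_ne_zero hq0)))

theorem differentiable_theta_qpow : Differentiable ℂ fun x => theta q (qpow q x) := fun x =>
  (differentiableAt_theta hq0 hq1 (qpow_ne_zero hq0 x)).fun_comp' x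
    (differentiable_qpow hq0 x)

theorem theta_ne_zero_of_norm {x : ℂ} (h : ∀ n : ℤ, q ^ n ≠ ‖x‖) : theta q x ≠ 0 := by
  refine theta_ne_zero hq0 hq1 (fun j e => h (-j) ?_) (fun j e => h (j + 1) ?_)
  · have := congrArg norm e
    rw [norm_mul, norm_pow, Complex.norm_real, Real.norm_of_nonneg hq0.le, norm_one] at this
    rw [zpow_neg, zpow_natCast, inv_eq_of_mul_eq_one_right this]
  · have := congrArg norm e
    rw [norm_pow, Complex.norm_real, Real.norm_of_nonneg hq0.le] at this
    rw [← this]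
    norm_cast

theorem theta_neg_one_ne_zero : theta q (-1) ≠ 0 := by
  refine theta_ne_zero hq0 hq1 (fun j e => ?_) (fun j e => ?_)
  · have h : (q : ℝ) ^ j * -1 = 1 := by exact_mod_cast e
    have := pow_pos hq0 j
    linarith
  · have h : (q : ℝ) ^ (j + 1) = -1 := by exact_mod_cast e
    have := pow_pos hq0 (j + 1)
    linarith

theorem norm_half_ne (n : ℤ) : q ^ n ≠ ‖qpow q (1 / 2)‖ := by
  intro h
  have h2 : q ^ (2 * n) = q ^ (1 : ℤ) := by
    have := congrArg norm (qpow_half_sq hq0)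
    rw [norm_pow, Complex.norm_real, Real.norm_of_nonneg hq0.le, ← h] at this
    rw [mul_comm, zpow_mul, zpow_one]
    exact_mod_cast this
  have := (zpow_right_injective₀ hq0 hq1.ne) h2
  omega

/-- Up to sign the differences are τ, 1/2 and 1/2 ± τ. There q^x is -1 or has modulus q^{1/2}, which
is not an integral power of q, so θ does not vanish. This makes the poles of the partial fraction
expansion distinct. -/
theorem sig_halfPeriod_sub_ne_zero {i j : Fin 4} (hij : i ≠ j) :
    sig q (halfPeriod q i - halfPeriod q j) ≠ 0 := by
  have key : sig q (tau q) ≠ 0 ∧ sig q (1 / 2) ≠ 0 ∧ sig q (1 / 2 + tau q) ≠ 0 ∧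
      sig q (1 / 2 - tau q) ≠ 0 := by
    refine ⟨?_, ?_, ?_, ?_⟩ <;> refine mul_ne_zero (qpow_ne_zero hq0 _) ?_
    · rw [qpow_tau hq0 hq1]
      exact theta_neg_one_ne_zero hq0 hq1
    · exact theta_ne_zero_of_norm hq0 hq1 (norm_half_ne hq0 hq1)
    · rw [qpow_add hq0, qpow_tau hq0 hq1, mul_neg_one]
      refine theta_ne_zero_of_norm hq0 hq1 ?_
      rw [norm_neg]
      exact norm_half_ne hq0 hq1
    · rw [qpow_sub hq0, qpow_tau hq0 hq1, div_neg, div_one]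
      refine theta_ne_zero_of_norm hq0 hq1 ?_
      rw [norm_neg]
      exact norm_half_ne hq0 hq1
  obtain ⟨k1, k2, k3, k4⟩ := key
  have hlt : ∀ i j : Fin 4, i < j → sig q (halfPeriod q j - halfPeriod q i) ≠ 0 := by
    intro i j h
    fin_cases i <;> fin_cases j <;> first | exact absurd h (by decide) | skip
    all_goals
      simpa [halfPeriod] using by
        first | exact k1 | simpa using k2 | simpa using k3 | simpa using k4
  rcases lt_or_gt_of_ne hij with h | h
  · rw [← neg_sub, sig_neg hq0 hq1]
    exact neg_ne_zero.2 (hlt i j h)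
  · exact hlt j i h

end

/-! ### Consequences of the three-term identity -/

section

variable {f g : ℂ → ℂ} {ε : ℂ}

/-- With denominators cleared, this says that φ₂(x - k) + B(z₁ + z₂, -x) φ₁(k - x), for φᵢ = `faceφ
f g zᵢ`, collapses to a single product. The combination occurs in the linear entries of the
reflection equation. -/
theorem SigmaPair.bracket (h : SigmaPair f g ε) (z₁ z₂ x k : ℂ) :
    f x * f (k - (z₁ + z₂)) * g (z₂ - x + k) * g z₁ +
      f (z₁ + z₂ - x) * f k * g (z₁ + x - k) * g z₂ =
    f (z₁ + z₂) * f (k - x) * g (z₂ - x) * g (z₁ - k) := by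
  have w : g z₁ * g (-(z₂ - x + k)) * (f x * f (z₁ + z₂ - k)) +
      g (z₁ + x - k) * g (-z₂) * (f k * f (x - (z₁ + z₂))) +
      g (-(z₂ - x)) * g (z₁ - k) * (f (z₁ + z₂) * f (k - x)) = 0 :=
    h.weierstrass' ((z₁ - z₂ + x - k) / 2) ((z₁ + z₂ - x + k) / 2) ((z₁ + z₂ + x - k) / 2)
      ((x - (z₁ + z₂) + k) / 2)
  simp only [h.parity] at w
  rw [h.odd_sub (z₁ + z₂) k, h.odd_sub x] at w
  refine mul_left_cancel₀ h.ne_zero ?_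
  linear_combination -w

/-- This and the next two identities are what remains of `l1`, `l2`, `l3` in `FaceLinear` once the
brackets have been collapsed. -/
theorem SigmaPair.three_term_one (h : SigmaPair f g ε) (a b x k : ℂ) :
    f (a - b) * f (k - x) * g (a - x - k) * g b - f (a - b - x) * f k * g (b - x) * g (a - k) =
      f x * f (k - (a - b)) * g (a - x) * g (b - k) := by
  have w : g (a - x - k) * g b * (f (a - b) * f (-(k - x))) +
      g (a - k) * g (b - x) * (f (a - b - x) * f k) +
      g (a - x) * g (b - k) * (f (-(k - (a - b))) * f (-x)) = 0 :=
    h.weierstrass' ((a + b - x - k) / 2) ((a - b - x - k) / 2) ((a - b + x - k) / 2)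
      ((a - b - x + k) / 2)
  simp only [h.odd] at w
  linear_combination -w

theorem SigmaPair.three_term_two (h : SigmaPair f g ε) (a b x k : ℂ) :
    f (a - b + x) * f k * g (a - x - k) * g b - f (a - b) * f (k + x) * g (b - x) * g (a - k) =
      f (k - (a - b)) * f x * g a * g (b - x - k) := by
  have w : g (a - x - k) * g b * (f (a - b + x) * f k) +
      g a * g (b - x - k) * (f (-(k - (a - b))) * f x) +
      g (a - k) * g (b - x) * (f (a - b) * f (-(k + x))) = 0 :=
    h.weierstrass' ((a + b - x - k) / 2) ((a - b - x - k) / 2) ((a - b + x + k) / 2)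
      ((a - b + x - k) / 2)
  simp only [h.odd] at w
  linear_combination w

theorem SigmaPair.three_term_three (h : SigmaPair f g ε) (a b x k : ℂ) :
    f (a - b - x) * f k * g (a + x - k) * g b - f (a - b) * f (k - x) * g (b + x) * g (a - k) =
      -(f x * f (k - (a - b)) * g (b + x - k) * g a) := by
  have w : g (b + x - k) * g a * (f x * f (-(k - (a - b)))) +
      g (a + x - k) * g b * (f (-(a - b - x)) * f k) +
      g (b + x) * g (a - k) * (f (-(k - x)) * f (-(a - b))) = 0 :=
    h.weierstrass' ((a + b + x - k) / 2) ((-a + b + x - k) / 2) ((a - b + x - k) / 2)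
      ((-a + b + x + k) / 2)
  simp only [h.odd] at w
  linear_combination -w

/-! ### Coefficients of the face `R`-matrix -/

/-- The diagonal coefficient of the face `R`-matrix built from an odd function `f`. -/
noncomputable def faceA (f : ℂ → ℂ) (k z x : ℂ) : ℂ := f (-z) * f (k + x) / (f (k - z) * f x)

/-- The off-diagonal coefficient of the face `R`-matrix built from an odd function `f`. -/
noncomputable def faceB (f : ℂ → ℂ) (k z x : ℂ) : ℂ := f (z + x) * f k / (f (k - z) * f x)

/-- The summands of the diagonal coefficient of the `K`-matrix. -/
noncomputable def faceφ (f g : ℂ → ℂ) (z x : ℂ) : ℂ := g (z - x) / (g z * f x)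

/-- The entries of the dynamical Yang-Baxter equation on the weight space of weight `1`. -/
structure FaceYangBaxter (A B : ℂ → ℂ → ℂ) (k u v w x : ℂ) : Prop where
  e11 : A w (-x) * A u (k - x) = A u (-x) * A w (k - x)
  e21 : A w (-x) * B u (x - k) = B u x * A v (-x) + A u (-x) * B w (x - k) * B v (-x)
  e31 : B w x = B u x * B v x + A u (-x) * B w (x - k) * A v x
  e12 : A v (k - x) * B u (k - x) + B v (x - k) * B w (-x) * A u (k - x) = B u (-x) * A w (k - x)
  e22 : A v (k - x) * A u (x - k) + B v (x - k) * B w (-x) * B u (x - k) =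
    A u x * A v (-x) + B u (-x) * B w (x - k) * B v (-x)
  e32 : B v (x - k) * A w x = A u x * B v x + B u (-x) * B w (x - k) * A v x
  e13 : B v (k - x) * B u (k - x) + A v (x - k) * B w (-x) * A u (k - x) = B w (k - x)
  e23 : B v (k - x) * A u (x - k) + A v (x - k) * B w (-x) * B u (x - k) = A w (x - k) * B v (-x)
  e33 : A v (x - k) * A w x = A w (x - k) * A v x

/-- The entries `e11` and `e33` are cancellations of factors, and every other entry except `e22` is
one instance of Weierstrass's identity, found by clearing denominators. -/
theorem SigmaPair.faceYangBaxter (h : SigmaPair f f ε) {k u v x : ℂ} (hx : f x ≠ 0)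
    (hkx : f (k - x) ≠ 0) (hu : f (k - u) ≠ 0) (hv : f (k - v) ≠ 0) (hw : f (k - (u + v)) ≠ 0) :
    FaceYangBaxter (faceA f k) (faceB f k) k u v (u + v) x := by
  have n1 : ∀ z, z + -x = z - x := fun z => by ring
  have n2 : k + (x - k) = x := by ring
  have n3 : k + (k - x) = 2 * k - x := by ring
  have n4 : f (x - k) = -f (k - x) := h.odd_sub _ _
  have n5 : ∀ z, z + (x - k) = z + x - k := fun z => by ring
  have n6 : ∀ z, z + (k - x) = z + k - x := fun z => by ring
  constructor
  · simp only [faceA, n1, n3, h.odd]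
    field_simp
  · have w : f (u + v) * f (u + x - k) * (f x * f (k - v)) +
        f (u + x) * f (-(k - (u + v))) * (f v * f (-(k - x))) +
        f (u + v + x - k) * f u * (f k * f (v - x)) = 0 :=
      h.weierstrass' ((2 * u + v + x - k) / 2) ((v - x + k) / 2) ((-v + x + k) / 2)
        ((v + x - k) / 2)
    simp only [h.odd] at w
    simp only [faceA, faceB, n1, n5, n4, h.odd]
    field_simp
    linear_combination -f k * w
  · have w : f (u + v + x) * f x * (f (k - u) * f (-(k - v))) +
        f (v + x) * f (u + x) * (f k * f (k - (u + v))) +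
        f (k + x) * f (u + v + x - k) * (f v * f u) = 0 :=
      h.weierstrass' ((u + v + 2 * x) / 2) ((u + v) / 2) ((-u + v) / 2) ((-u - v + 2 * k) / 2)
    simp only [h.odd] at w
    simp only [faceA, faceB, n1, n5, n4, h.odd]
    field_simp
    linear_combination -f k * w
  · have w : f v * f x * (f (u + k - x) * f (k - (u + v))) +
        f k * f (v + x - k) * (f (u + v - x) * f u) +
        f (u + v) * f (-(u - x)) * (f (k - x) * f (-(k - v))) = 0 :=
      h.weierstrass' ((v + x) / 2) ((v - x) / 2) ((-v - x + 2 * k) / 2) ((2 * u + v - x) / 2)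
    simp only [h.odd] at w
    simp only [faceA, faceB, n1, n3, n5, n6, n4, h.odd]
    field_simp
    linear_combination -(f k * f (2 * k - x)) * w
  -- The central entry needs two instances: `w₁`, free of u and v, rewrites the difference of the
  -- two products of diagonal coefficients as a multiple of f(k)³, and `w₂` then accounts for the
  -- off-diagonal terms.
  · have w₁ : f (2 * k - x) * f x * (f x * f x) +
        f (k + x) * f (k - x) * (f (k - x) * f (-(k - x))) +
        f k * f k * (f k * f (-(2 * x - k))) = 0 :=
      h.weierstrass' k (k - x) x 0
    have w₂ : f x * f (-(v + x - k)) * (f (u + v - x) * f (-(u + x - k))) +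
        f (k - x) * f (-(v - x)) * (f (u + v + x - k) * f (u - x)) +
        f u * f (k - (u + v)) * (f v * f (2 * x - k)) = 0 :=
      h.weierstrass' ((-v + k) / 2) ((v + 2 * x - k) / 2) ((v - 2 * x + k) / 2)
        ((2 * u + v - k) / 2)
    simp only [h.odd] at w₁ w₂
    simp only [faceA, faceB, n1, n2, n3, n5, n4, h.odd]
    field_simp
    linear_combination -(f u * f v * f (k - (u + v))) * w₁ - f k ^ 3 * w₂
  · have w : f (v + x - k) * f (-(u + v)) * (f x * f (-(k - u))) +
        f (-(k - x)) * f (-u) * (f (v + x) * f (k - (u + v))) +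
        f (-(u - x)) * f (-k) * (f (u + v + x - k) * f v) = 0 :=
      h.weierstrass' ((-u + x - k) / 2) ((u + 2 * v + x - k) / 2) ((u + x - k) / 2)
        ((-u + x + k) / 2)
    simp only [h.odd] at w
    simp only [faceA, faceB, n1, n5, n4, h.odd]
    field_simp
    linear_combination f k * f (k + x) * w
  · have w : f (v + k - x) * f (-(u + k - x)) * (f k * f (-(k - (u + v)))) +
        f v * f (-u) * (f (k * 2 - x) * f (-(u + v - x))) +
        f (k - u) * f (-(k - v)) * (f (u + v + k - x) * f (k - x)) = 0 :=
      h.weierstrass' ((-u + v) / 2) ((u + v - 2 * x + 2 * k) / 2) ((u + v) / 2)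
        ((-u - v + 2 * k) / 2)
    simp only [h.odd] at w
    simp only [faceA, faceB, n1, n2, n3, n6, n4, h.odd]
    field_simp
    linear_combination f k * w
  · have w : f (v + k - x) * f (-u) * (f x * f (-(k - (u + v)))) +
        f v * f (-(u + x - k)) * (f k * f (-(u + v - x))) +
        f (k - u) * f (v - x) * (f (u + v) * f (k - x)) = 0 :=
      h.weierstrass' ((-u + v - x + k) / 2) ((u + v - x + k) / 2) ((u + v + x - k) / 2)
        ((-u - v + x + k) / 2)
    simp only [h.odd] at w
    simp only [faceA, faceB, n1, n2, n5, n6, n4, h.odd]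
    field_simp
    linear_combination f k * w
  · simp only [faceA, n2, n4, h.odd]
    field_simp

/-- The entries of the unitarity relation of the `R`-matrix. -/
structure FaceUnitary (A B : ℂ → ℂ → ℂ) (z x : ℂ) : Prop where
  diag : A z (-x) * A (-z) x + B z (-x) * B (-z) (-x) = 1
  offDiag : B z x * A (-z) x + A z x * B (-z) (-x) = 0

theorem SigmaPair.faceUnitary (h : SigmaPair f f ε) {k z x : ℂ} (hx : f x ≠ 0)
    (hz : f (k - z) ≠ 0) (hz' : f (k + z) ≠ 0) : FaceUnitary (faceA f k) (faceB f k) z x := by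
  have n1 : ∀ z, z + -x = z - x := fun z => by ring
  have n2 : -z - x = -(z + x) := by ring
  constructor
  · have w : f z * f z * (f (k - x) * f (-(k + x))) + f (z - x) * f (z + x) * (f k * f k) +
        f (k + z) * f (-(k - z)) * (f (-x) * f x) = 0 := h.weierstrass' z 0 (-x) k
    simp only [h.odd] at w
    simp only [faceA, faceB, n1, n2, sub_neg_eq_add, neg_neg, h.odd]
    field_simp
    linear_combination -w
  · simp only [faceA, faceB, n1, n2, sub_neg_eq_add, neg_neg, h.odd]
    field_simp
    ring

end

/-! ### The linear part of the reflection equation and elliptic partial fractions -/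

section

variable {f g : ℂ → ℂ} {ε : ℂ}

/-- The entries of the reflection equation that are linear in the diagonal coefficient `φ` of the
`K`-matrix, with `φ₁, φ₂` its values at the two spectral parameters. -/
structure FaceLinear (A B : ℂ → ℂ → ℂ) (φ₁ φ₂ : ℂ → ℂ) (k m p x : ℂ) : Prop where
  l1 : A m (-x) * A p x * φ₁ (x + k) + B m (-x) * (φ₂ (x - k) + B p (-x) * φ₁ (k - x)) =
    φ₁ (x - k) + B p (-x) * φ₂ (k - x)
  l2 : B m x * A p x * φ₁ (x + k) + A m x * (φ₂ (x - k) + B p (-x) * φ₁ (k - x)) =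
    A p x * φ₂ (x + k)
  l3 : A m x * B p x * φ₁ (x + k) + B m (-x) * A p x * φ₁ (k - x) + A m x * φ₂ (-x - k) =
    A p x * φ₂ (k - x)

/-- The equations are linear in the pair (φ₁, φ₂), so the same rᵢ must serve both spectral
parameters. This is why coefficients independent of z are needed later. -/
theorem FaceLinear.sum {A B : ℂ → ℂ → ℂ} {ι : Type*} (s : Finset ι) (r : ι → ℂ)
    {φ₁ φ₂ : ι → ℂ → ℂ} {k m p x : ℂ} (h : ∀ i, FaceLinear A B (φ₁ i) (φ₂ i) k m p x) :
    FaceLinear A B (fun y => ∑ i ∈ s, r i * φ₁ i y) (fun y => ∑ i ∈ s, r i * φ₂ i y) k m p x := by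
  constructor <;>
  · simp only [Finset.mul_sum, ← Finset.sum_add_distrib]
    refine Finset.sum_congr rfl fun i _ => ?_
    first
      | linear_combination r i * (h i).l1
      | linear_combination r i * (h i).l2
      | linear_combination r i * (h i).l3

/-- In each entry `SigmaPair.bracket` collapses the two-term combinations, with a and b exchanged on
the right of `l1` and with -x for x in `l3`; a single three-term identity remains. -/
theorem SigmaPair.faceLinear (h : SigmaPair f g ε) {k a b x : ℂ}
    (hx : f x ≠ 0) (h₁ : f (k - x) ≠ 0) (h₂ : f (k + x) ≠ 0) (hm : f (k - (a - b)) ≠ 0)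
    (hp : f (k - (a + b)) ≠ 0) (ha : g a ≠ 0) (hb : g b ≠ 0) :
    FaceLinear (faceA f k) (faceB f k) (faceφ f g a) (faceφ f g b) k (a - b) (a + b) x := by
  have n1 : ∀ z, z + -x = z - x := fun z => by ring
  have n2 : ∀ z, z - (x + k) = z - x - k := fun z => by ring
  have n3 : ∀ z, z - (x - k) = z - x + k := fun z => by ring
  have n4 : ∀ z, z - (k - x) = z + x - k := fun z => by ring
  have n5 : f (x - k) = -f (k - x) := h.odd_sub _ _
  have n6 : f (x + k) = f (k + x) := by rw [add_comm]
  have n7 : ∀ z, z - (-x - k) = z + x + k := fun z => by ring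
  have n8 : f (-x - k) = -f (k + x) := by rw [← h.odd]; ring_nf
  have br := h.bracket a b x k
  constructor
  · have br' := h.bracket b a x k
    rw [add_comm b a] at br'
    have t := h.three_term_one a b x k
    simp only [faceA, faceB, faceφ, n1, n2, n3, n4, n5, n6, h.odd]
    field_simp
    linear_combination -f (a + b) * f (k - x) * t + f k * f (a - b - x) * br +
      f x * f (k - (a - b)) * br'
  · have t := h.three_term_two a b x k
    simp only [faceA, faceB, faceφ, n1, n2, n3, n4, n5, n6, h.odd]
    field_simp
    linear_combination -f (a + b) * f (k - x) * t + f (k + x) * f (a - b) * br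
  · have br' := h.bracket a b (-x) k
    simp only [sub_neg_eq_add, ← sub_eq_add_neg, h.odd] at br'
    have t := h.three_term_three a b x k
    simp only [faceA, faceB, faceφ, n1, n2, n4, n6, n7, n8, h.odd]
    field_simp
    linear_combination f (a + b) * f (k + x) * t - f (a - b) * f (k - x) * br'

/-- Fay's identity for the Kronecker function F(z, t) = f(z + t)/(f(z) f(t)), multiplied by f(t)
f(s) f(t + s) so that t, s and t + s may be zeros of f. -/
theorem SigmaPair.fay (h : SigmaPair f f ε) {z b b' t s : ℂ} (h₁ : f (z - b') ≠ 0)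
    (h₂ : f (z - b) ≠ 0) (h₃ : f (b' - b) ≠ 0) :
    f (t + s) * (f (z - b' + t) / f (z - b')) * (f (z - b + s) / f (z - b)) =
      f t * (f (b' - b + s) / f (b' - b)) * (f (z - b' + (t + s)) / f (z - b')) +
      f s * (f (b - b' + t) / f (b - b')) * (f (z - b + (t + s)) / f (z - b)) := by
  have w : f (z - b' + t) * f (z - b + s) * (f (t + s) * f (-(b' - b))) +
      f (z - b' + (t + s)) * f (z - b) * (f t * f (b' - b + s)) +
      f (z - b + (t + s)) * f (z - b') * (f (b - b' + t) * f (-s)) = 0 :=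
    h.weierstrass' ((2 * z - b - b' + t + s) / 2) ((b - b' + t - s) / 2) ((b - b' + t + s) / 2)
      ((-b + b' + t + s) / 2)
  simp only [h.odd] at w
  rw [h.odd_sub b b']
  field_simp
  linear_combination -w

/-- Partial fraction expansion of a quotient of products of `f`. The pole `b₀` is singled out
because the partial sums of `b - a` that contain its contribution must not be zeros of `f`. -/
theorem SigmaPair.partialFractions (h : SigmaPair f f ε) {ι : Type*} [DecidableEq ι] (d b : ι → ℂ)
    (d₀ b₀ : ℂ) (hb : ∀ i j, i ≠ j → f (b i - b j) ≠ 0) (hb₀ : ∀ i, f (b₀ - b i) ≠ 0)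
    (ht : ∀ s : Finset ι, f (d₀ + ∑ i ∈ s, d i) ≠ 0) (s : Finset ι) :
    ∀ z, f (z - b₀) ≠ 0 → (∀ i ∈ s, f (z - b i) ≠ 0) →
    f (d₀ + ∑ i ∈ s, d i) * ((f (z - b₀ + d₀) / f (z - b₀)) *
        ∏ i ∈ s, f (z - b i + d i) / f (z - b i)) =
      f d₀ * (∏ i ∈ s, f (b₀ - b i + d i) / f (b₀ - b i)) *
        (f (z - b₀ + (d₀ + ∑ i ∈ s, d i)) / f (z - b₀)) +
      ∑ j ∈ s, f (d j) * (f (b j - b₀ + d₀) / f (b j - b₀)) *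
        (∏ i ∈ s.erase j, f (b j - b i + d i) / f (b j - b i)) *
        (f (z - b j + (d₀ + ∑ i ∈ s, d i)) / f (z - b j)) := by
  induction s using Finset.induction_on with
  | empty =>
    intro z hz _
    simp
  | insert l s hl ih =>
    intro z hz hs
    have hzl : f (z - b l) ≠ 0 := hs l (Finset.mem_insert_self _ _)
    have hzs : ∀ i ∈ s, f (z - b i) ≠ 0 := fun i hi => hs i (Finset.mem_insert_of_mem hi)
    have hls : ∀ i ∈ s, l ≠ i := fun i hi e => hl (e ▸ hi)
    have hb0l : f (b l - b₀) ≠ 0 := by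
      rw [h.odd_sub]
      exact neg_ne_zero.2 (hb₀ l)
    have ihz := ih z hz hzs
    -- The induction hypothesis at the new pole: it evaluates the coefficient that this pole
    -- acquires.
    have ihl := ih (b l) hb0l fun i hi => hb l i (hls i hi)
    have et : d₀ + ∑ i ∈ insert l s, d i = d₀ + ∑ i ∈ s, d i + d l := by
      rw [Finset.sum_insert hl]
      ring
    rw [et, Finset.prod_insert hl, Finset.prod_insert hl, Finset.sum_insert hl,
      Finset.erase_insert hl]
    set t := d₀ + ∑ i ∈ s, d i with htdef
    have ht0 : f t ≠ 0 := ht s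
    have e₀ := h.fay (t := t) (s := d l) hz hzl (hb₀ l)
    have ej : ∀ j ∈ s, f (t + d l) * (f (z - b j + t) / f (z - b j)) *
        (f (z - b l + d l) / f (z - b l)) =
      f t * (f (b j - b l + d l) / f (b j - b l)) * (f (z - b j + (t + d l)) / f (z - b j)) +
      f (d l) * (f (b l - b j + t) / f (b l - b j)) * (f (z - b l + (t + d l)) / f (z - b l)) :=
      fun j hj => h.fay (hzs j hj) hzl (hb j l (hls j hj).symm)
    have er : ∑ j ∈ s, f (d j) * (f (b j - b₀ + d₀) / f (b j - b₀)) *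
        (∏ i ∈ (insert l s).erase j, f (b j - b i + d i) / f (b j - b i)) *
        (f (z - b j + (t + d l)) / f (z - b j)) =
      ∑ j ∈ s, f (d j) * (f (b j - b₀ + d₀) / f (b j - b₀)) *
        (∏ i ∈ s.erase j, f (b j - b i + d i) / f (b j - b i)) *
        ((f (b j - b l + d l) / f (b j - b l)) * (f (z - b j + (t + d l)) / f (z - b j))) := by
      refine Finset.sum_congr rfl fun j hj => ?_
      rw [Finset.erase_insert_of_ne (hls j hj), Finset.prod_insert
        (fun hm => hl (Finset.mem_of_mem_erase hm))]
      ring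
    rw [er]
    -- Fay's identity produces a factor f(t), t being the partial sum before the new term; this is
    -- where partial sums must avoid the zeros of f.
    refine mul_left_cancel₀ ht0 ?_
    have es : f (t + d l) * (f (z - b l + d l) / f (z - b l)) *
        ∑ j ∈ s, f (d j) * (f (b j - b₀ + d₀) / f (b j - b₀)) *
          (∏ i ∈ s.erase j, f (b j - b i + d i) / f (b j - b i)) * (f (z - b j + t) / f (z - b j)) =
      f t * (∑ j ∈ s, f (d j) * (f (b j - b₀ + d₀) / f (b j - b₀)) *
        (∏ i ∈ s.erase j, f (b j - b i + d i) / f (b j - b i)) *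
        ((f (b j - b l + d l) / f (b j - b l)) * (f (z - b j + (t + d l)) / f (z - b j)))) +
      f (d l) * (f (z - b l + (t + d l)) / f (z - b l)) *
        ∑ j ∈ s, f (d j) * (f (b j - b₀ + d₀) / f (b j - b₀)) *
          (∏ i ∈ s.erase j, f (b j - b i + d i) / f (b j - b i)) *
          (f (b l - b j + t) / f (b l - b j)) := by
      rw [Finset.mul_sum, Finset.mul_sum, Finset.mul_sum, ← Finset.sum_add_distrib]
      refine Finset.sum_congr rfl fun j hj => ?_
      linear_combination (f (d j) * (f (b j - b₀ + d₀) / f (b j - b₀)) *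
        (∏ i ∈ s.erase j, f (b j - b i + d i) / f (b j - b i))) * ej j hj
    -- Multiply the old expansion by the new factor, split every product by Fay's identity (`e₀` for
    -- the pole b₀, `es` for the others), and collect the contributions at b l with `ihl`.
    linear_combination (f (t + d l) * (f (z - b l + d l) / f (z - b l))) * ihz + es +
      f d₀ * (∏ i ∈ s, f (b₀ - b i + d i) / f (b₀ - b i)) * e₀ -
      f (d l) * (f (z - b l + (t + d l)) / f (z - b l)) * ihl

end

/-! ### From scalar identities to operator identities -/

section Sums

variable {I M : Type*} [Fintype I] [AddCommMonoid M]

theorem sum_fin_two_fun (g : (Fin 2 → I) → M) : ∑ γ, g γ = ∑ a, ∑ b, g ![a, b] := by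
  rw [← (finTwoArrowEquiv I).symm.sum_comp, Fintype.sum_prod_type]
  rfl

theorem sum_fin_three_fun (g : (Fin 3 → I) → M) : ∑ γ, g γ = ∑ a, ∑ b, ∑ c, g ![a, b, c] := by
  rw [← (Fin.consEquiv fun _ : Fin 3 => I).sum_comp, Fintype.sum_prod_type]
  refine Finset.sum_congr rfl fun a _ => ?_
  rw [sum_fin_two_fun]
  rfl

end Sums

section Entries

variable {I : Type*} [DecidableEq I]

theorem leg₂_three_zero_one (S : Matrix (I × I) (I × I) ℂ) (a b c a' b' c' : I) :
    leg₂ 3 0 1 S ![a, b, c] ![a', b', c'] = if c = c' then S (a, b) (a', b') else 0 := by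
  simp [leg₂, Fin.forall_fin_succ]

theorem leg₂_three_zero_two (S : Matrix (I × I) (I × I) ℂ) (a b c a' b' c' : I) :
    leg₂ 3 0 2 S ![a, b, c] ![a', b', c'] = if b = b' then S (a, c) (a', c') else 0 := by
  simp [leg₂, Fin.forall_fin_succ]

theorem leg₂_three_one_two (S : Matrix (I × I) (I × I) ℂ) (a b c a' b' c' : I) :
    leg₂ 3 1 2 S ![a, b, c] ![a', b', c'] = if a = a' then S (b, c) (b', c') else 0 := by
  simp [leg₂, Fin.forall_fin_succ]

theorem leg₂_two_zero_one (S : Matrix (I × I) (I × I) ℂ) (a b a' b' : I) :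
    leg₂ 2 0 1 S ![a, b] ![a', b'] = S (a, b) (a', b') := by
  simp [leg₂, Fin.forall_fin_succ]

theorem leg₂_two_one_zero (S : Matrix (I × I) (I × I) ℂ) (a b a' b' : I) :
    leg₂ 2 1 0 S ![a, b] ![a', b'] = S (b, a) (b', a') := by
  simp [leg₂, Fin.forall_fin_succ]

theorem leg₁_two_zero (S : Matrix I I ℂ) (a b a' b' : I) :
    leg₁ 2 0 S ![a, b] ![a', b'] = if b = b' then S a a' else 0 := by
  simp [leg₁, Fin.forall_fin_succ]

theorem leg₁_two_one (S : Matrix I I ℂ) (a b a' b' : I) :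
    leg₁ 2 1 S ![a, b] ![a', b'] = if a = a' then S b b' else 0 := by
  simp [leg₁, Fin.forall_fin_succ]

omit [DecidableEq I] in
theorem matrix_ext_two {M N : Matrix (Fin 2 → I) (Fin 2 → I) ℂ}
    (h : ∀ a b a' b', M ![a, b] ![a', b'] = N ![a, b] ![a', b']) : M = N := by
  ext ε δ
  have e : ∀ ε : Fin 2 → I, ε = ![ε 0, ε 1] := fun ε => by
    ext i
    fin_cases i <;> rfl
  rw [e ε, e δ]
  exact h _ _ _ _

omit [DecidableEq I] in
theorem matrix_ext_three {M N : Matrix (Fin 3 → I) (Fin 3 → I) ℂ}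
    (h : ∀ a b c a' b' c', M ![a, b, c] ![a', b', c'] = N ![a, b, c] ![a', b', c']) : M = N := by
  ext ε δ
  have e : ∀ ε : Fin 3 → I, ε = ![ε 0, ε 1, ε 2] := fun ε => by
    ext i
    fin_cases i <;> rfl
  rw [e ε, e δ]
  exact h _ _ _ _ _ _

variable [Fintype I]

/-- The Kronecker deltas on the untouched legs leave three intermediate labels; the leg controlling
a shift is untouched by the shifted operator, so its label is c, respectively a'. -/
theorem yangBaxter_left_apply (wt : I → ℂ) (S T U : ℂ → Matrix (I × I) (I × I) ℂ) (ξ s : ℂ)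
    (a b c a' b' c' : I) :
    (dynShift wt (fun x => leg₂ 3 0 1 (S x)) ξ s 2 * leg₂ 3 0 2 (T ξ) *
      dynShift wt (fun x => leg₂ 3 1 2 (U x)) ξ s 0) ![a, b, c] ![a', b', c'] =
    ∑ j, ∑ k, ∑ i, S (ξ + s * wt c) (a, b) (i, j) * T ξ (i, c) (a', k) *
      U (ξ + s * wt a') (j, k) (b', c') := by
  simp only [Matrix.mul_apply, sum_fin_three_fun, dynShift, leg₂_three_zero_one,
    leg₂_three_zero_two, leg₂_three_one_two, Matrix.cons_val_zero, Matrix.cons_val, ite_mul, mul_ite,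
    zero_mul, mul_zero, Finset.sum_ite_irrel, Finset.sum_const_zero, Finset.sum_ite_eq,
    Finset.sum_ite_eq', Finset.mem_univ, if_true, Finset.sum_mul]

theorem yangBaxter_right_apply (wt : I → ℂ) (S T U : ℂ → Matrix (I × I) (I × I) ℂ) (ξ s : ℂ)
    (a b c a' b' c' : I) :
    (leg₂ 3 1 2 (U ξ) * dynShift wt (fun x => leg₂ 3 0 2 (T x)) ξ s 1 *
      leg₂ 3 0 1 (S ξ)) ![a, b, c] ![a', b', c'] =
    ∑ i, ∑ j, ∑ k, U ξ (b, c) (j, k) * T (ξ + s * wt j) (a, k) (i, c') *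
      S ξ (i, j) (a', b') := by
  simp only [Matrix.mul_apply, sum_fin_three_fun, dynShift, leg₂_three_zero_one,
    leg₂_three_zero_two, leg₂_three_one_two, Matrix.cons_val_zero, Matrix.cons_val_one,
    ite_mul, mul_ite,
    zero_mul, mul_zero, Finset.sum_ite_irrel, Finset.sum_const_zero, Finset.sum_ite_eq,
    Finset.sum_ite_eq', Finset.mem_univ, if_true, Finset.sum_mul]

end Entries

section Spin

variable (c : Coeffs)

theorem Coeffs.R_apply (z ξ : ℂ) (a b a' b' : Fin 2) :
    c.R z ξ (a, b) (a', b') =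
      if a = b then (if a' = a ∧ b' = a then 1 else 0)
      else if a' = a ∧ b' = b then c.A z (if a = 0 then ξ else -ξ)
      else if a' = b ∧ b' = a then c.B z (if a = 0 then ξ else -ξ) else 0 := by
  fin_cases a <;> fin_cases b <;> fin_cases a' <;> fin_cases b' <;>
    simp [Coeffs.R, finProdFinEquiv]

theorem Coeffs.K_apply (z ξ : ℂ) (a a' : Fin 2) :
    c.K z ξ a a' =
      if a = a' then c.α z (if a = 0 then ξ else -ξ) else c.β z (if a = 0 then ξ else -ξ) := by
  fin_cases a <;> fin_cases a' <;> simp [Coeffs.K]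

/-- R preserves weight, so the equation splits into blocks. Weights ±3 are trivial, weight 1 is `h`,
and weight -1 is `h'`, because exchanging v₊ with v₋ amounts to ξ ↦ -ξ. -/
theorem Coeffs.yangBaxter_of_entries {κ u v w ξ : ℂ}
    (h : FaceYangBaxter c.A c.B (2 * κ) u v w ξ) (h' : FaceYangBaxter c.A c.B (2 * κ) u v w (-ξ)) :
    dynShift spinWt (fun x => leg₂ 3 0 1 (c.R u x)) ξ (-(2 * κ)) 2 * leg₂ 3 0 2 (c.R w ξ) *
      dynShift spinWt (fun x => leg₂ 3 1 2 (c.R v x)) ξ (-(2 * κ)) 0 =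
    leg₂ 3 1 2 (c.R v ξ) * dynShift spinWt (fun x => leg₂ 3 0 2 (c.R w x)) ξ (-(2 * κ)) 1 *
      leg₂ 3 0 1 (c.R u ξ) := by
  have s0 : ξ + -(2 * κ) * spinWt 0 = ξ - 2 * κ := by simp [spinWt]; ring
  have s1 : ξ + -(2 * κ) * spinWt 1 = ξ + 2 * κ := by simp [spinWt]
  have n1 : -(ξ - 2 * κ) = 2 * κ - ξ := by ring
  have n2 : 2 * κ - -ξ = ξ + 2 * κ := by ring
  have n3 : -ξ - 2 * κ = -(ξ + 2 * κ) := by ring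
  obtain ⟨h11, h21, h31, h12, h22, h32, h13, h23, h33⟩ := h
  obtain ⟨k11, k21, k31, k12, k22, k32, k13, k23, k33⟩ := h'
  simp only [neg_neg, n2, n3] at k11 k21 k31 k12 k22 k32 k13 k23 k33
  refine matrix_ext_three fun a₁ a₂ a₃ b₁ b₂ b₃ => ?_
  rw [yangBaxter_left_apply spinWt (c.R u) (c.R w) (c.R v),
    yangBaxter_right_apply spinWt (c.R u) (c.R w) (c.R v)]
  simp only [Fin.sum_univ_two, Coeffs.R_apply]
  fin_cases a₁ <;> fin_cases a₂ <;> fin_cases a₃ <;> fin_cases b₁ <;> fin_cases b₂ <;>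
    fin_cases b₃ <;>
  simp only [Fin.zero_eta, Fin.mk_one, zero_ne_one, one_ne_zero, and_true, and_false, if_true, if_false, zero_mul, mul_zero, add_zero, zero_add, one_mul, mul_one, and_self,
    s0, s1, n1] <;>
  first
    | linear_combination h11
    | linear_combination h21
    | linear_combination h31
    | linear_combination h12
    | linear_combination h22
    | linear_combination h32
    | linear_combination h13
    | linear_combination h23
    | linear_combination h33
    | linear_combination k11
    | linear_combination k21
    | linear_combination k31
    | linear_combination k12
    | linear_combination k22
    | linear_combination k32
    | linear_combination k13
    | linear_combination k23
    | linear_combination k33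

theorem Coeffs.unitaryR_of_entries {z ξ : ℂ} (h : FaceUnitary c.A c.B z ξ)
    (h' : FaceUnitary c.A c.B z (-ξ)) :
    leg₂ 2 1 0 (c.R z ξ) * leg₂ 2 0 1 (c.R (-z) ξ) = 1 := by
  obtain ⟨h1, h2⟩ := h
  obtain ⟨k1, k2⟩ := h'
  simp only [neg_neg] at k1 k2
  refine matrix_ext_two fun a₁ a₂ b₁ b₂ => ?_
  simp only [Matrix.mul_apply, sum_fin_two_fun, leg₂_two_zero_one, leg₂_two_one_zero,
    Fin.sum_univ_two, Coeffs.R_apply, Matrix.one_apply, Matrix.vecCons_inj]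
  fin_cases a₁ <;> fin_cases a₂ <;> fin_cases b₁ <;> fin_cases b₂ <;>
  simp only [Fin.zero_eta, Fin.mk_one, zero_ne_one, one_ne_zero, and_true, and_false, if_true, if_false, zero_mul, mul_zero, add_zero, zero_add, mul_one, and_self]
    <;>
  first
    | linear_combination h1
    | linear_combination h2
    | linear_combination k1
    | linear_combination k2

/-- The entries of the reflection equation in the first two columns. -/
structure ReflectionEntries (A B α β : ℂ → ℂ → ℂ) (z₁ z₂ m p κ ξ : ℂ) : Prop where
  r00 : β z₁ (ξ - κ) * B p (-(2 * ξ)) * β z₂ (κ - ξ) = β z₁ (κ - ξ) * B p (-(2 * ξ)) * β z₂ (ξ - κ)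
  r10 : A m (-(2 * ξ)) * α z₁ (ξ + κ) * A p (2 * ξ) * β z₂ (κ - ξ) + B m (-(2 * ξ)) *
      (β z₁ (κ - ξ) * α z₂ (ξ - κ) + α z₁ (κ - ξ) * B p (-(2 * ξ)) * β z₂ (κ - ξ)) =
    α z₁ (ξ - κ) * β z₂ (κ - ξ) + β z₁ (κ - ξ) * B p (-(2 * ξ)) * α z₂ (κ - ξ)
  r20 : B m (2 * ξ) * α z₁ (ξ + κ) * A p (2 * ξ) * β z₂ (κ - ξ) + A m (2 * ξ) *
      (β z₁ (κ - ξ) * α z₂ (ξ - κ) + α z₁ (κ - ξ) * B p (-(2 * ξ)) * β z₂ (κ - ξ)) =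
    β z₁ (κ - ξ) * A p (2 * ξ) * α z₂ (ξ + κ)
  r30 : β z₁ (-(ξ + κ)) * A p (2 * ξ) * β z₂ (κ - ξ) = β z₁ (κ - ξ) * A p (2 * ξ) * β z₂ (-(ξ + κ))
  r01 : β z₂ (ξ - κ) * α z₁ (ξ - κ) + α z₂ (κ - ξ) * B p (-(2 * ξ)) * β z₁ (ξ - κ) =
    B m (-(2 * ξ)) * β z₁ (ξ - κ) * α z₂ (ξ - κ) +
      (A m (2 * ξ) * A p (-(2 * ξ)) * α z₁ (ξ + κ) +
        B m (-(2 * ξ)) * B p (-(2 * ξ)) * α z₁ (κ - ξ)) * β z₂ (ξ - κ)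
  r11 : A m (-(2 * ξ)) * α z₁ (ξ + κ) * A p (2 * ξ) * α z₂ (κ - ξ) + B m (-(2 * ξ)) *
      (β z₂ (ξ - κ) * β z₁ (κ - ξ) + α z₂ (κ - ξ) * B p (-(2 * ξ)) * α z₁ (κ - ξ)) =
    B m (-(2 * ξ)) * β z₁ (ξ - κ) * β z₂ (κ - ξ) +
      (A m (2 * ξ) * A p (-(2 * ξ)) * α z₁ (ξ + κ) +
        B m (-(2 * ξ)) * B p (-(2 * ξ)) * α z₁ (κ - ξ)) * α z₂ (κ - ξ)
  r21 : B m (2 * ξ) * α z₁ (ξ + κ) * A p (2 * ξ) * α z₂ (κ - ξ) + A m (2 * ξ) *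
      (β z₂ (ξ - κ) * β z₁ (κ - ξ) + α z₂ (κ - ξ) * B p (-(2 * ξ)) * α z₁ (κ - ξ)) =
    (A m (2 * ξ) * B p (2 * ξ) * α z₁ (ξ + κ) + B m (-(2 * ξ)) * A p (2 * ξ) * α z₁ (κ - ξ)) *
      α z₂ (ξ + κ) + A m (2 * ξ) * β z₁ (-(ξ + κ)) * β z₂ (ξ + κ)
  r31 : α z₂ (κ - ξ) * A p (2 * ξ) * β z₁ (-(ξ + κ)) =
    (A m (2 * ξ) * B p (2 * ξ) * α z₁ (ξ + κ) + B m (-(2 * ξ)) * A p (2 * ξ) * α z₁ (κ - ξ)) *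
      β z₂ (-(ξ + κ)) + A m (2 * ξ) * β z₁ (-(ξ + κ)) * α z₂ (-(ξ + κ))

/-- Exchanging v₊ and v₋ on both legs, with ξ ↦ -ξ, preserves the equation and carries the first two
columns to the last two; hence `h` and `h'` suffice. -/
theorem Coeffs.reflection_of_entries {κ z₁ z₂ m p ξ : ℂ}
    (h : ReflectionEntries c.A c.B c.α c.β z₁ z₂ m p κ ξ)
    (h' : ReflectionEntries c.A c.B c.α c.β z₁ z₂ m p κ (-ξ)) :
    leg₂ 2 1 0 (c.R m (2 * ξ)) * dynShift spinWt (fun x => leg₁ 2 0 (c.K z₁ x)) ξ (-κ) 1 *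
      leg₂ 2 0 1 (c.R p (2 * ξ)) * dynShift spinWt (fun x => leg₁ 2 1 (c.K z₂ x)) ξ (-κ) 0 =
    dynShift spinWt (fun x => leg₁ 2 1 (c.K z₂ x)) ξ (-κ) 0 * leg₂ 2 1 0 (c.R p (2 * ξ)) *
      dynShift spinWt (fun x => leg₁ 2 0 (c.K z₁ x)) ξ (-κ) 1 *
      leg₂ 2 0 1 (c.R m (2 * ξ)) := by
  have s0 : ξ + -κ * spinWt 0 = ξ - κ := by simp [spinWt]; ring
  have s1 : ξ + -κ * spinWt 1 = ξ + κ := by simp [spinWt]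
  have n1 : -(ξ - κ) = κ - ξ := by ring
  have n2 : κ - -ξ = ξ + κ := by ring
  have n3 : -ξ - κ = -(ξ + κ) := by ring
  have n4 : -ξ + κ = κ - ξ := by ring
  have n5 : 2 * -ξ = -(2 * ξ) := by ring
  have n6 : -(κ - ξ) = ξ - κ := by ring
  obtain ⟨h00, h10, h20, h30, h01, h11, h21, h31⟩ := h
  obtain ⟨k00, k10, k20, k30, k01, k11, k21, k31⟩ := h'
  simp only [n2, n3, n4, n5, n6, neg_neg] at k00 k10 k20 k30 k01 k11 k21 k31
  refine matrix_ext_two fun a₁ a₂ b₁ b₂ => ?_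
  simp only [Matrix.mul_apply, sum_fin_two_fun, dynShift, leg₂_two_zero_one, leg₂_two_one_zero,
    leg₁_two_zero, leg₁_two_one, Matrix.cons_val_zero, Matrix.cons_val_one,
    Fin.sum_univ_two, Coeffs.R_apply, Coeffs.K_apply]
  fin_cases a₁ <;> fin_cases a₂ <;> fin_cases b₁ <;> fin_cases b₂ <;>
  simp only [Fin.zero_eta, Fin.mk_one, zero_ne_one, one_ne_zero, and_true, and_false, if_true, if_false, zero_mul, mul_zero, add_zero, zero_add, one_mul, mul_one, and_self,
    s0, s1, n1] <;>
  first
    | linear_combination h00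
    | linear_combination h10
    | linear_combination h20
    | linear_combination h30
    | linear_combination h01
    | linear_combination h11
    | linear_combination h21
    | linear_combination h31
    | linear_combination k00
    | linear_combination k10
    | linear_combination k20
    | linear_combination k30
    | linear_combination k01
    | linear_combination k11
    | linear_combination k21
    | linear_combination k31

end Spin

/-! ### The reflection equation from its linear entries and the determinant -/

/-- Since β separates variables, `r00` and `r30` are trivial, and the entries with one β are
multiples of the linear equations, `r01` also using `hA`. The entry `r11` needs only `hA`; the
genuinely quadratic entry is `r21`. -/
theorem ReflectionEntries.of_linear {A B α β : ℂ → ℂ → ℂ} {z₁ z₂ m p κ ξ : ℂ} {φ₁ φ₂ b : ℂ → ℂ}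
    {c₁ c₂ D : ℂ} (h : FaceLinear A B φ₁ φ₂ (2 * κ) m p (2 * ξ))
    (hA : A m (-(2 * ξ)) * A p (2 * ξ) = A m (2 * ξ) * A p (-(2 * ξ)))
    (hα₁ : ∀ y ∈ ({ξ - κ, κ - ξ, ξ + κ, -(ξ + κ)} : Set ℂ), α z₁ y = c₁ * φ₁ (2 * y))
    (hα₂ : ∀ y ∈ ({ξ - κ, κ - ξ, ξ + κ, -(ξ + κ)} : Set ℂ), α z₂ y = c₂ * φ₂ (2 * y))
    (hβ₁ : ∀ y ∈ ({ξ - κ, κ - ξ, ξ + κ, -(ξ + κ)} : Set ℂ), β z₁ y = c₁ * b y)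
    (hβ₂ : ∀ y ∈ ({ξ - κ, κ - ξ, ξ + κ, -(ξ + κ)} : Set ℂ), β z₂ y = c₂ * b y)
    (hD : ∀ y ∈ ({ξ - κ, ξ + κ} : Set ℂ), φ₂ (2 * y) * φ₂ (-(2 * y)) - b y * b (-y) = D) :
    ReflectionEntries A B α β z₁ z₂ m p κ ξ := by
  have e1 : 2 * (ξ - κ) = 2 * ξ - 2 * κ := by ring
  have e2 : 2 * (κ - ξ) = 2 * κ - 2 * ξ := by ring
  have e3 : 2 * (ξ + κ) = 2 * ξ + 2 * κ := by ring
  have e4 : 2 * -(ξ + κ) = -(2 * ξ) - 2 * κ := by ring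
  have e5 : -(2 * (ξ - κ)) = 2 * κ - 2 * ξ := by ring
  have e6 : -(2 * (ξ + κ)) = -(2 * ξ) - 2 * κ := by ring
  have e7 : -(ξ - κ) = κ - ξ := by ring
  have d1 := hD (ξ - κ) (by simp)
  have d2 := hD (ξ + κ) (by simp)
  have a11 := hα₁ (ξ - κ) (by simp)
  have a12 := hα₁ (κ - ξ) (by simp)
  have a13 := hα₁ (ξ + κ) (by simp)
  have a21 := hα₂ (ξ - κ) (by simp)
  have a22 := hα₂ (κ - ξ) (by simp)
  have a23 := hα₂ (ξ + κ) (by simp)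
  have a24 := hα₂ (-(ξ + κ)) (by simp)
  have b11 := hβ₁ (ξ - κ) (by simp)
  have b12 := hβ₁ (κ - ξ) (by simp)
  have b14 := hβ₁ (-(ξ + κ)) (by simp)
  have b21 := hβ₂ (ξ - κ) (by simp)
  have b22 := hβ₂ (κ - ξ) (by simp)
  have b23 := hβ₂ (ξ + κ) (by simp)
  have b24 := hβ₂ (-(ξ + κ)) (by simp)
  rw [e5, e1, e7] at d1
  rw [e6, e3] at d2
  rw [e1] at a11 a21
  rw [e2] at a12 a22
  rw [e3] at a13 a23
  rw [e4] at a24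
  obtain ⟨l1, l2, l3⟩ := h
  constructor <;> simp only [a11, a12, a13, a21, a22, a23, a24, b11, b12,
    b14, b21, b22, b23, b24]
  · ring
  · linear_combination c₁ * c₂ * b (κ - ξ) * l1
  · linear_combination c₁ * c₂ * b (κ - ξ) * l2
  · ring
  · linear_combination -c₁ * c₂ * b (ξ - κ) * l1 +
      c₁ * c₂ * b (ξ - κ) * φ₁ (2 * ξ + 2 * κ) * hA
  · linear_combination c₁ * c₂ * φ₂ (2 * κ - 2 * ξ) * φ₁ (2 * ξ + 2 * κ) * hA
  -- The terms quadratic in φ₂ and in b enter through the determinant at ξ - κ and at ξ + κ; its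
  -- value D is the same at both points and cancels.
  · linear_combination c₁ * c₂ * φ₂ (2 * κ - 2 * ξ) * l2 - c₁ * c₂ * φ₂ (2 * ξ + 2 * κ) * l3 -
      c₁ * c₂ * A m (2 * ξ) * d1 + c₁ * c₂ * A m (2 * ξ) * d2
  · linear_combination -c₁ * c₂ * b (-(ξ + κ)) * l3

/-! ### Gauge transformations -/

theorem eq_of_scale {a b a' b' : ℂ} (c : ℂ) (h : a = b) (ha : a' = c * a) (hb : b' = c * b) :
    a' = b' := by
  rw [ha, hb, h]

/-- Used in the direction from Baxter's coefficients to R_cm. Every term of a given entry picks up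
the same factor, because the third spectral parameter is u + v and g(x) g(-x) = g(x - k) g(k - x) =
1. -/
theorem FaceYangBaxter.gauge {A B A' B' : ℂ → ℂ → ℂ} {q : ℝ} (hq0 : 0 < q) {k u v x : ℂ}
    {g : ℂ → ℂ} (hg : g x * g (-x) = 1) (hg' : g (x - k) * g (k - x) = 1)
    (hA : ∀ z, ∀ y ∈ ({x, -x, x - k, k - x} : Set ℂ),
      A' z y = g y * qpow q (k * (z - y)) * A z y)
    (hB : ∀ z y, B' z y = qpow q (z * (k + y)) * B z y)
    (h : FaceYangBaxter A B k u v (u + v) x) : FaceYangBaxter A' B' k u v (u + v) x := by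
  have g0 : g x ≠ 0 := left_ne_zero_of_mul_eq_one hg
  have g0' : g (x - k) ≠ 0 := left_ne_zero_of_mul_eq_one hg'
  have g1 : g (-x) = (g x)⁻¹ := eq_inv_of_mul_eq_one_right hg
  have g1' : g (k - x) = (g (x - k))⁻¹ := eq_inv_of_mul_eq_one_right hg'
  have hA1 : ∀ z, A' z x = g x * (qpow q (k * z) / qpow q (k * x)) * A z x := fun z => by
    rw [hA z x (by simp), mul_sub, qpow_sub hq0]
  have hA2 : ∀ z, A' z (-x) = (g x)⁻¹ * (qpow q (k * z) * qpow q (k * x)) * A z (-x) := fun z => by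
    rw [hA z (-x) (by simp), sub_neg_eq_add, mul_add, qpow_add hq0, g1]
  have hA3 : ∀ z, A' z (x - k) =
      g (x - k) * (qpow q (k * z) / qpow q (k * (x - k))) * A z (x - k) := fun z => by
    rw [hA z (x - k) (by simp), mul_sub, qpow_sub hq0]
  have hA4 : ∀ z, A' z (k - x) =
      (g (x - k))⁻¹ * (qpow q (k * z) * qpow q (k * (x - k))) * A z (k - x) := fun z => by
    rw [hA z (k - x) (by simp), ← qpow_add hq0, g1']
    ring_nf
  have hB1 : ∀ z, B' z x = qpow q (k * z) * qpow q (x * z) * B z x := fun z => by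
    rw [hB, ← qpow_add hq0]
    ring_nf
  have hB2 : ∀ z, B' z (-x) = qpow q (k * z) / qpow q (x * z) * B z (-x) := fun z => by
    rw [hB, ← qpow_sub hq0]
    ring_nf
  have hB3 : ∀ z, B' z (x - k) = qpow q (x * z) * B z (x - k) := fun z => by
    rw [hB]
    ring_nf
  have hB4 : ∀ z, B' z (k - x) = qpow q (k * z) * qpow q (k * z) / qpow q (x * z) * B z (k - x) :=
    fun z => by
      rw [hB, ← qpow_add hq0, ← qpow_sub hq0]
      ring_nf
  have hs : ∀ a, qpow q (a * (u + v)) = qpow q (a * u) * qpow q (a * v) := fun a => by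
    rw [mul_add, qpow_add hq0]
  -- The powers of q are replaced by opaque nonvanishing functions, so that `field_simp` treats
  -- their values as atoms.
  obtain ⟨P, hP⟩ : ∃ P : ℂ → ℂ, ∀ z, qpow q (k * z) = P z := ⟨_, fun _ => rfl⟩
  obtain ⟨T, hT⟩ : ∃ T : ℂ → ℂ, ∀ z, qpow q (x * z) = T z := ⟨_, fun _ => rfl⟩
  have hP0 : ∀ z, P z ≠ 0 := fun z => hP z ▸ qpow_ne_zero hq0 _
  have hT0 : ∀ z, T z ≠ 0 := fun z => hT z ▸ qpow_ne_zero hq0 _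
  obtain ⟨h11, h21, h31, h12, h22, h32, h13, h23, h33⟩ := h
  constructor <;> simp only [hA1, hA2, hA3, hA4, hB1, hB2, hB3, hB4, hs, hP, hT]
  · refine eq_of_scale (P u * P v * P u * P x *
      P (x - k) / (g x * g (x - k))) h11 ?_ ?_ <;> field_simp [hP0, hT0]
  · refine eq_of_scale (P u * P v * T u * P x / g x)
      h21 ?_ ?_ <;> field_simp [hP0, hT0]
  · refine eq_of_scale (P u * P v * T u * T v)
      h31 ?_ ?_ <;> field_simp [hP0, hT0]
  · refine eq_of_scale (P u ^ 2 * P v * P (x - k) /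
      (T u * g (x - k))) h12 ?_ ?_ <;> field_simp [hP0, hT0]
  · refine eq_of_scale (P u * P v) h22 ?_ ?_ <;> field_simp [hP0, hT0]
  · refine eq_of_scale (P u * P v * T v * g x / P x)
      h32 ?_ ?_ <;> field_simp [hP0, hT0]
  · refine eq_of_scale (P u ^ 2 * P v ^ 2 / (T u * T v))
      h13 ?_ ?_ <;> field_simp [hP0, hT0]
  · refine eq_of_scale (P u * P v ^ 2 * g (x - k) /
      (T v * P (x - k))) h23 ?_ ?_ <;> field_simp [hP0, hT0]
  · refine eq_of_scale (P u * P v * P v * g x * g (x - k) /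
      (P x * P (x - k))) h33 ?_ ?_ <;> field_simp [hP0, hT0]

theorem FaceUnitary.gauge {A B A' B' : ℂ → ℂ → ℂ} {q : ℝ} (hq0 : 0 < q) {k z x : ℂ}
    {g : ℂ → ℂ} (hg : g x * g (-x) = 1)
    (hA : ∀ z, ∀ y ∈ ({x, -x} : Set ℂ), A' z y = g y * qpow q (k * (z - y)) * A z y)
    (hB : ∀ z y, B' z y = qpow q (z * (k + y)) * B z y)
    (h : FaceUnitary A B z x) : FaceUnitary A' B' z x := by
  have g0 : g x ≠ 0 := left_ne_zero_of_mul_eq_one hg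
  have g1 : g (-x) = (g x)⁻¹ := eq_inv_of_mul_eq_one_right hg
  have hA1 : ∀ z, A' z x = g x * (qpow q (k * z) / qpow q (k * x)) * A z x := fun z => by
    rw [hA z x (by simp), mul_sub, qpow_sub hq0]
  have hA2 : ∀ z, A' z (-x) = (g x)⁻¹ * (qpow q (k * z) * qpow q (k * x)) * A z (-x) := fun z => by
    rw [hA z (-x) (by simp), sub_neg_eq_add, mul_add, qpow_add hq0, g1]
  have hB1 : ∀ z, B' z x = qpow q (k * z) * qpow q (x * z) * B z x := fun z => by
    rw [hB, ← qpow_add hq0]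
    ring_nf
  have hB2 : ∀ z, B' z (-x) = qpow q (k * z) / qpow q (x * z) * B z (-x) := fun z => by
    rw [hB, ← qpow_sub hq0]
    ring_nf
  obtain ⟨P, hP⟩ : ∃ P : ℂ → ℂ, ∀ z, qpow q (k * z) = P z := ⟨_, fun _ => rfl⟩
  obtain ⟨T, hT⟩ : ∃ T : ℂ → ℂ, ∀ z, qpow q (x * z) = T z := ⟨_, fun _ => rfl⟩
  have hP0 : ∀ z, P z ≠ 0 := fun z => hP z ▸ qpow_ne_zero hq0 _
  have hT0 : ∀ z, T z ≠ 0 := fun z => hT z ▸ qpow_ne_zero hq0 _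
  obtain ⟨h1, h2⟩ := h
  constructor <;> simp only [hA1, hA2, hB1, hB2, mul_neg, qpow_neg, hP, hT]
  · refine eq_of_scale 1 h1 ?_ (one_mul _).symm
    field_simp [hP0, hT0]
  · refine eq_of_scale (T z * g x / P x) h2 ?_ (mul_zero _).symm
    field_simp [hP0, hT0]

theorem ReflectionEntries.gauge {A B α β A' B' α' β' : ℂ → ℂ → ℂ} {q : ℝ} (hq0 : 0 < q)
    {z₁ z₂ κ ξ : ℂ} {g : ℂ → ℂ} (hg : g (2 * ξ) * g (-(2 * ξ)) = 1)
    (hA : ∀ z, ∀ y ∈ ({2 * ξ, -(2 * ξ)} : Set ℂ), A' z y = g y * qpow q (2 * κ * (z - y)) * A z y)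
    (hB : ∀ z y, B' z y = qpow q (z * (2 * κ + y)) * B z y)
    (hα : ∀ z y, α' z y = qpow q (-(2 * z * y)) * α z y)
    (hβ : ∀ z y, β' z y = β z y)
    (h : ReflectionEntries A B α β z₁ z₂ (z₁ - z₂) (z₁ + z₂) κ ξ) :
    ReflectionEntries A' B' α' β' z₁ z₂ (z₁ - z₂) (z₁ + z₂) κ ξ := by
  have g0 : g (2 * ξ) ≠ 0 := left_ne_zero_of_mul_eq_one hg
  have g1 : g (-(2 * ξ)) = (g (2 * ξ))⁻¹ := eq_inv_of_mul_eq_one_right hg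
  have hA1 : ∀ z, A' z (2 * ξ) =
      g (2 * ξ) * (qpow q (2 * κ * z) / qpow q (2 * κ * (2 * ξ))) * A z (2 * ξ) := fun z => by
    rw [hA z _ (by simp), mul_sub, qpow_sub hq0]
  have hA2 : ∀ z, A' z (-(2 * ξ)) =
      (g (2 * ξ))⁻¹ * (qpow q (2 * κ * z) * qpow q (2 * κ * (2 * ξ))) * A z (-(2 * ξ)) :=
    fun z => by
      rw [hA z _ (by simp), sub_neg_eq_add, mul_add, qpow_add hq0, g1]
  have hB1 : ∀ z, B' z (2 * ξ) = qpow q (2 * κ * z) * qpow q (2 * ξ * z) * B z (2 * ξ) :=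
    fun z => by
      rw [hB, ← qpow_add hq0]
      ring_nf
  have hB2 : ∀ z, B' z (-(2 * ξ)) = qpow q (2 * κ * z) / qpow q (2 * ξ * z) * B z (-(2 * ξ)) :=
    fun z => by
      rw [hB, ← qpow_sub hq0]
      ring_nf
  have hα1 : ∀ z, α' z (ξ - κ) = qpow q (2 * κ * z) / qpow q (2 * ξ * z) * α z (ξ - κ) :=
    fun z => by
      rw [hα, ← qpow_sub hq0]
      ring_nf
  have hα2 : ∀ z, α' z (κ - ξ) = qpow q (2 * ξ * z) / qpow q (2 * κ * z) * α z (κ - ξ) :=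
    fun z => by
      rw [hα, ← qpow_sub hq0]
      ring_nf
  have hα3 : ∀ z, α' z (ξ + κ) = (qpow q (2 * ξ * z) * qpow q (2 * κ * z))⁻¹ * α z (ξ + κ) :=
    fun z => by
      rw [hα, ← qpow_add hq0, ← qpow_neg]
      ring_nf
  have hα4 : ∀ z, α' z (-(ξ + κ)) = qpow q (2 * ξ * z) * qpow q (2 * κ * z) * α z (-(ξ + κ)) :=
    fun z => by
      rw [hα, ← qpow_add hq0]
      ring_nf
  have hs : ∀ a, qpow q (a * (z₁ + z₂)) = qpow q (a * z₁) * qpow q (a * z₂) := fun a => by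
    rw [mul_add, qpow_add hq0]
  have hd : ∀ a, qpow q (a * (z₁ - z₂)) = qpow q (a * z₁) / qpow q (a * z₂) := fun a => by
    rw [mul_sub, qpow_sub hq0]
  obtain ⟨P, hP⟩ : ∃ P : ℂ → ℂ, ∀ z, qpow q (2 * κ * z) = P z := ⟨_, fun _ => rfl⟩
  obtain ⟨T, hT⟩ : ∃ T : ℂ → ℂ, ∀ z, qpow q (2 * ξ * z) = T z := ⟨_, fun _ => rfl⟩
  have hP0 : ∀ z, P z ≠ 0 := fun z => hP z ▸ qpow_ne_zero hq0 _
  have hT0 : ∀ z, T z ≠ 0 := fun z => hT z ▸ qpow_ne_zero hq0 _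
  obtain ⟨h00, h10, h20, h30, h01, h11, h21, h31⟩ := h
  constructor <;> simp only [hA1, hA2, hB1, hB2, hα1, hα2, hα3, hα4, hβ, hs, hd, hP, hT]
  · refine eq_of_scale (P z₁ * P z₂ /
      (T z₁ * T z₂)) h00 ?_ ?_ <;> field_simp [hP0, hT0]
  · refine eq_of_scale (P z₁ / T z₁) h10 ?_ ?_ <;> field_simp [hP0, hT0]
  · refine eq_of_scale (P z₁ * g (2 * ξ) / (T z₂ *
      P (2 * ξ))) h20 ?_ ?_ <;> field_simp [hP0, hT0]
  · refine eq_of_scale (P z₁ * P z₂ * g (2 * ξ) /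
      P (2 * ξ)) h30 ?_ ?_ <;> field_simp [hP0, hT0]
  · refine eq_of_scale (P z₁ / T z₁) h01 ?_ ?_ <;> field_simp [hP0, hT0]
  · refine eq_of_scale (P z₁ * T z₂ / (T z₁ *
      P z₂)) h11 ?_ ?_ <;> field_simp [hP0, hT0]
  · refine eq_of_scale (P z₁ / P z₂ * g (2 * ξ) /
      P (2 * ξ)) h21 ?_ ?_ <;> field_simp [hP0, hT0]
  · refine eq_of_scale (P z₁ * T z₂ * g (2 * ξ) /
      P (2 * ξ)) h31 ?_ ?_ <;> field_simp [hP0, hT0]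

/-! ### The coefficients of the `K`-matrix -/

/-- The product of four theta functions in the numerators of the coefficients of the `K`-matrix. -/
noncomputable def kNum (q : ℝ) (ζ ζ' υ υ' z : ℂ) : ℂ :=
  jac q 0 (ζ + υ + z) * jac q 1 (ζ - υ + z) * jac q 2 (ζ' + υ' + z) * jac q 3 (ζ' - υ' - z)

/-- The diagonal coefficient of the `K`-matrix, up to a factor that depends only on `z`. -/
noncomputable def kDiag (q : ℝ) (ζ ζ' υ υ' z ξ : ℂ) : ℂ :=
  (kNum q ζ υ ζ' υ' ξ * jac q 3 (z - ξ + (ζ + υ')) / sig q (2 * ξ) -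
    kNum q ζ ζ' υ υ' z * jac q 3 (ξ - z + (ζ + υ')) / sig q (2 * z)) / jac q 3 (z + ξ + (ζ + υ'))

/-- The translates of the spectral parameter in the numerator of `kDiag`. -/
noncomputable def kShift (ζ ζ' υ υ' : ℂ) : Fin 4 → ℂ := ![ζ + υ, ζ - υ, ζ' + υ', υ' - ζ']

section

variable {q : ℝ} (hq0 : 0 < q) (hq1 : q < 1)

include hq0 in
theorem sig_add_halfPeriod (i : Fin 4) (x : ℂ) :
    sig q (x + halfPeriod q i) = qpow q (-(halfExp i * x)) * jac q i x := by
  rw [jac, ← mul_assoc, ← qpow_add hq0, neg_add_cancel, qpow_zero, one_mul]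

include hq0 hq1

theorem jac_even {i : Fin 4} (hi : i ≠ 0) (x : ℂ) : jac q i (-x) = jac q i x := by
  rw [jac_parity hq0 hq1]
  fin_cases i
  · exact absurd rfl hi
  all_goals simp [jacSign]

/-- The difference ω₃ - ωᵢ is the half-period with index 3 - i, about which σ is even or odd up to
an exponential. So this ratio involves no theta functions. -/
theorem sig_halfPeriod_ratio (i : Fin 4) : ∃ η : ℂ, ∀ x,
    sig q (halfPeriod q 3 - halfPeriod q i - x) =
      η * qpow q ((1 - 2 * halfExp i) * x) * sig q (halfPeriod q 3 - halfPeriod q i + x) := by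
  have key : ∀ j : Fin 4, j ≠ 0 → ∀ x, sig q (halfPeriod q j - x) =
      qpow q (2 * halfExp j * x) * sig q (halfPeriod q j + x) := fun j hj x => by
    have h := jac_even hq0 hq1 hj x
    rw [jac, jac] at h
    rw [show halfPeriod q j - x = -x + halfPeriod q j by ring,
      show 2 * halfExp j * x = halfExp j * x + halfExp j * x by ring, qpow_add hq0, mul_assoc,
      add_comm _ x, ← h, ← mul_assoc, ← qpow_add hq0]
    rw [show halfExp j * x + halfExp j * -x = 0 by ring, qpow_zero, one_mul]
  fin_cases i
  · refine ⟨1, fun x => ?_⟩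
    have h := key 3 (by decide) x
    simp [halfPeriod, halfExp] at h ⊢
    exact h
  · refine ⟨1, fun x => ?_⟩
    have h := key 2 (by decide) x
    simp [halfPeriod, halfExp] at h ⊢
    exact h
  · refine ⟨1, fun x => ?_⟩
    have h := key 1 (by decide) x
    simp [halfPeriod, halfExp] at h ⊢
    rw [h]
  · refine ⟨-1, fun x => ?_⟩
    simp [halfPeriod, halfExp, sig_neg hq0 hq1, qpow_zero]

theorem sig_add_two_halfPeriod_three (x : ℂ) :
    sig q (x + 2 * halfPeriod q 3) = qpow q (-x - 1 / 2) * sig q x := by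
  have h := sig_add_two_tau hq0 hq1 (x + 1)
  rw [sig_add_one hq0 hq1] at h
  rw [show x + 2 * halfPeriod q 3 = x + 1 + 2 * tau q by simp [halfPeriod]; ring, h]
  ring

/-- Translation by ω₃ reverses the order of the four Jacobi functions, which turns the shifts into
those with ζ' and υ interchanged. This is how the residue at the fifth pole produces the other half
of `kDiag`. -/
theorem prod_jac_sub_halfPeriod (ζ ζ' υ υ' ξ : ℂ) :
    ∏ i, jac q i (-halfPeriod q 3 - ξ - (ζ + υ') + kShift ζ ζ' υ υ' i) =
      -qpow q (-(ζ + υ') - 2 * ξ - 1 / 2) * kNum q ζ υ ζ' υ' ξ := by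
  have h0 : jac q 0 (-halfPeriod q 3 - ξ - (ζ + υ') + kShift ζ ζ' υ υ' 0) =
      -qpow q ((υ - υ' - ξ) / 2) * jac q 3 (υ - υ' - ξ) := by
    have h := jac_even hq0 hq1 (i := 3) (by decide) (υ - υ' - ξ)
    rw [← h, jac_three, jac_zero, show -halfPeriod q 3 - ξ - (ζ + υ') + kShift ζ ζ' υ υ' 0 =
      -(-(υ - υ' - ξ) + 1 / 2 + tau q) by simp [halfPeriod, kShift]; ring, sig_neg hq0 hq1,
      neg_mul, ← mul_assoc, ← qpow_add hq0,
      show (υ - υ' - ξ) / 2 + -(υ - υ' - ξ) / 2 = 0 by ring, qpow_zero, one_mul]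
  have h1 : jac q 1 (-halfPeriod q 3 - ξ - (ζ + υ') + kShift ζ ζ' υ υ' 1) =
      -qpow q (-(υ + υ' + ξ) / 2) * jac q 2 (υ + υ' + ξ) := by
    rw [jac_two, jac_one, show -halfPeriod q 3 - ξ - (ζ + υ') + kShift ζ ζ' υ υ' 1 + tau q =
      -(υ + υ' + ξ + 1 / 2) by simp [halfPeriod, kShift]; ring, sig_neg hq0 hq1,
      neg_mul, ← mul_assoc, ← qpow_add hq0,
      show -(υ + υ' + ξ) / 2 + (υ + υ' + ξ) / 2 = 0 by ring, qpow_zero, one_mul]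
  have h2 : jac q 2 (-halfPeriod q 3 - ξ - (ζ + υ') + kShift ζ ζ' υ υ' 2) =
      -qpow q ((ζ' - ζ - ξ - (1 / 2 + tau q)) / 2) * jac q 1 (ζ - ζ' + ξ) := by
    rw [jac_two, jac_one, show -halfPeriod q 3 - ξ - (ζ + υ') + kShift ζ ζ' υ υ' 2 + 1 / 2 =
      -(ζ - ζ' + ξ + tau q) by simp [halfPeriod, kShift]; ring, sig_neg hq0 hq1,
      show -halfPeriod q 3 - ξ - (ζ + υ') + kShift ζ ζ' υ υ' 2 =
        ζ' - ζ - ξ - (1 / 2 + tau q) by simp [halfPeriod, kShift]; ring]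
    ring
  have h3 : jac q 3 (-halfPeriod q 3 - ξ - (ζ + υ') + kShift ζ ζ' υ υ' 3) =
      -qpow q ((-(ζ + ζ' + ξ) - (1 / 2 + tau q)) / 2) * jac q 0 (ζ + ζ' + ξ) := by
    have e : -halfPeriod q 3 - ξ - (ζ + υ') + kShift ζ ζ' υ υ' 3 =
        -(ζ + ζ' + ξ) - (1 / 2 + tau q) := by simp [halfPeriod, kShift]; ring
    rw [e, jac_three, jac_zero,
      show -(ζ + ζ' + ξ) - (1 / 2 + tau q) + 1 / 2 + tau q = -(ζ + ζ' + ξ) by ring,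
      sig_neg hq0 hq1]
    ring
  have e : qpow q ((υ - υ' - ξ) / 2) * qpow q (-(υ + υ' + ξ) / 2) *
      qpow q ((ζ' - ζ - ξ - (1 / 2 + tau q)) / 2) *
      qpow q ((-(ζ + ζ' + ξ) - (1 / 2 + tau q)) / 2) = -qpow q (-(ζ + υ') - 2 * ξ - 1 / 2) := by
    rw [← qpow_add hq0, ← qpow_add hq0, ← qpow_add hq0,
      show (υ - υ' - ξ) / 2 + -(υ + υ' + ξ) / 2 + (ζ' - ζ - ξ - (1 / 2 + tau q)) / 2 +
        (-(ζ + ζ' + ξ) - (1 / 2 + tau q)) / 2 = -(ζ + υ') - 2 * ξ - 1 / 2 - tau q by ring,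
      qpow_sub hq0 _ (tau q), qpow_tau hq0 hq1, div_neg, div_one]
  rw [Fin.prod_univ_four, h0, h1, h2, h3, ← e, kNum]
  ring

theorem prod_jac_shift (ζ ζ' υ υ' z : ℂ) :
    ∏ i, jac q i (z + kShift ζ ζ' υ υ' i) = kNum q ζ ζ' υ υ' z := by
  have h := jac_even hq0 hq1 (i := 3) (by decide) (ζ' - υ' - z)
  simp only [Fin.prod_univ_four, kShift, kNum, Matrix.cons_val_zero, Matrix.cons_val_one,
    Matrix.cons_val, ← h]
  ring_nf

-- The duplication formula turns the four denominators into σ(2z), and the exponents satisfy -∑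
-- `halfExp i` · `kShift i` = -υ'.
omit hq1 in
theorem prod_sig_ratio (ζ ζ' υ υ' : ℂ) {C : ℂ}
    (h : ∀ x, jac q 0 x * jac q 1 x * jac q 2 x * jac q 3 x = C * sig q (2 * x)) (z : ℂ) :
    ∏ i, sig q (z - -halfPeriod q i + kShift ζ ζ' υ υ' i) / sig q (z - -halfPeriod q i) =
      qpow q (-υ') * (∏ i, jac q i (z + kShift ζ ζ' υ υ' i)) / (C * sig q (2 * z)) := by
  have e : ∀ i, sig q (z - -halfPeriod q i + kShift ζ ζ' υ υ' i) / sig q (z - -halfPeriod q i) =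
      qpow q (-(halfExp i * kShift ζ ζ' υ υ' i)) *
        (jac q i (z + kShift ζ ζ' υ υ' i) / jac q i z) := fun i => by
    rw [sub_neg_eq_add, add_right_comm, sig_add_halfPeriod hq0, sig_add_halfPeriod hq0,
      mul_div_mul_comm, ← qpow_sub hq0]
    ring_nf
  simp only [e, Finset.prod_mul_distrib, Finset.prod_div_distrib]
  rw [Fin.prod_univ_four (fun i => jac q i z), h, mul_div_assoc, Fin.prod_univ_four,
    ← qpow_add hq0, ← qpow_add hq0, ← qpow_add hq0]
  congr 2
  simp [halfExp, kShift]
  ring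

/-- The expansion of the diagonal coefficient of the `K`-matrix, with coefficients that do not
depend on `z` and `ξ`. -/
theorem exists_kDiag_expansion (ζ ζ' υ υ' : ℂ) : ∃ r : Fin 4 → ℂ, ∀ z ξ,
    sig q (2 * z) ≠ 0 → sig q (2 * ξ) ≠ 0 → jac q 3 (z + ξ + (ζ + υ')) ≠ 0 →
    (∀ i, sig q (-halfPeriod q 3 - ξ - (ζ + υ') + halfPeriod q i) ≠ 0) →
    (∀ s : Finset (Fin 4), sig q (-2 * ξ - 2 * (ζ + υ') + ∑ i ∈ s, kShift ζ ζ' υ υ' i) ≠ 0) →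
    kDiag q ζ ζ' υ υ' z ξ = ∑ i, r i * faceφ (sig q) (jac q i) z (2 * ξ) := by
  obtain ⟨C, hC, hprod⟩ := jac_prod hq0 hq1
  choose η hη using sig_halfPeriod_ratio hq0 hq1
  -- The contribution of the pole -ωⱼ in the expansion below, once the common factor q^{ξ+ζ} σ(2ξ)/C
  -- has been taken out.
  refine ⟨fun j => C * qpow q (-ζ) * sig q (kShift ζ ζ' υ υ' j) * η j *
    qpow q ((1 - 2 * halfExp j) * (ζ + υ')) *
    ∏ i ∈ Finset.univ.erase j, sig q (-halfPeriod q j - -halfPeriod q i + kShift ζ ζ' υ υ' i) /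
      sig q (-halfPeriod q j - -halfPeriod q i), fun z ξ hz hξ hP hb₀ ht => ?_⟩
  have hjz : ∀ i, jac q i z ≠ 0 := by
    have := hprod z ▸ mul_ne_zero hC hz
    simp only [ne_eq, mul_eq_zero, not_or] at this
    obtain ⟨⟨⟨n0, n1⟩, n2⟩, n3⟩ := this
    intro i
    fin_cases i <;> assumption
  set s := ζ + υ' with hs
  have hbij : ∀ i j : Fin 4, i ≠ j → sig q (-halfPeriod q i - -halfPeriod q j) ≠ 0 :=
    fun i j hij => by
      rw [show -halfPeriod q i - -halfPeriod q j = halfPeriod q j - halfPeriod q i by ring]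
      exact sig_halfPeriod_sub_ne_zero hq0 hq1 hij.symm
  -- Four poles at -ωᵢ, with the shifts in the numerator of `kDiag`, and a fifth at b₀ = -ω₃ - ξ - s
  -- with shift d₀ = -2ξ - 2s. The shift d₀ reflects σ about a half-period when evaluated at -ωⱼ, so
  -- the coefficients depend on ξ only through exponentials; the total shift is -2ξ, as `faceφ`
  -- requires.
  have pf := (sigmaPair_sig hq0 hq1).partialFractions (kShift ζ ζ' υ υ') (fun i => -halfPeriod q i)
    (-2 * ξ - 2 * s) (-halfPeriod q 3 - ξ - s) hbij (by simpa using hb₀) ht Finset.univ z ?_ ?_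
  rotate_left
  · rw [show z - (-halfPeriod q 3 - ξ - s) = z + ξ + s + halfPeriod q 3 by ring,
      sig_add_halfPeriod hq0]
    exact mul_ne_zero (qpow_ne_zero hq0 _) hP
  · intro i _
    rw [sub_neg_eq_add, sig_add_halfPeriod hq0]
    exact mul_ne_zero (qpow_ne_zero hq0 _) (hjz i)
  have hsum : -2 * ξ - 2 * s + ∑ i, kShift ζ ζ' υ υ' i = -(2 * ξ) := by
    simp [Fin.sum_univ_four, kShift, hs]
    ring
  rw [hsum, prod_sig_ratio hq0 ζ ζ' υ υ' hprod, prod_sig_ratio hq0 ζ ζ' υ υ' hprod,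
    prod_jac_shift hq0 hq1, prod_jac_sub_halfPeriod hq0 hq1] at pf
  have ratio : ∀ (i : Fin 4) (w v : ℂ), sig q (w + halfPeriod q i + v) / sig q (w + halfPeriod q i) =
      qpow q (-(halfExp i * v)) * (jac q i (w + v) / jac q i w) := fun i w v => by
    rw [add_right_comm, sig_add_halfPeriod hq0, sig_add_halfPeriod hq0, mul_div_mul_comm,
      ← qpow_sub hq0]
    ring_nf
  have ez : z - (-halfPeriod q 3 - ξ - s) = z + ξ + s + halfPeriod q 3 := by ring
  have r1 : sig q (z - (-halfPeriod q 3 - ξ - s) + (-2 * ξ - 2 * s)) /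
      sig q (z - (-halfPeriod q 3 - ξ - s)) =
      qpow q (ξ + s) * (jac q 3 (ξ - z + s) / jac q 3 (z + ξ + s)) := by
    rw [ez, ratio, show z + ξ + s + (-2 * ξ - 2 * s) = -(ξ - z + s) by ring,
      jac_even hq0 hq1 (by decide)]
    congr 2
    simp [halfExp]
    ring
  have r2 : sig q (z - (-halfPeriod q 3 - ξ - s) + -(2 * ξ)) /
      sig q (z - (-halfPeriod q 3 - ξ - s)) =
      qpow q ξ * (jac q 3 (z - ξ + s) / jac q 3 (z + ξ + s)) := by
    rw [ez, ratio, show z + ξ + s + -(2 * ξ) = z - ξ + s by ring]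
    congr 2
    simp [halfExp]
  -- As d₀ = 2b₀ + 2ω₃, the factor σ(d₀) cancels the σ(2b₀) in the denominator of the product at b₀.
  have r3 : sig q (-2 * ξ - 2 * s) =
      qpow q (2 * ξ + 2 * s + 1 / 2) * sig q (2 * (-halfPeriod q 3 - ξ - s)) := by
    have h := sig_add_two_halfPeriod_three hq0 hq1 (2 * (-halfPeriod q 3 - ξ - s))
    rw [show 2 * (-halfPeriod q 3 - ξ - s) + 2 * halfPeriod q 3 = -2 * ξ - 2 * s by ring] at h
    rw [h]
    congr 1
    rw [show -(2 * (-halfPeriod q 3 - ξ - s)) - 1 / 2 =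
      2 * ξ + 2 * s + 1 / 2 + (tau q + tau q) by simp [halfPeriod]; ring, qpow_add hq0 _ (tau q + tau q),
      qpow_add hq0 (tau q), qpow_tau hq0 hq1]
    ring
  have n3 : sig q (2 * (-halfPeriod q 3 - ξ - s)) ≠ 0 := by
    have := ht ∅
    rw [Finset.sum_empty, add_zero, r3] at this
    exact right_ne_zero_of_mul this
  have m : qpow q (-υ') * qpow q (ξ + s) = qpow q (ξ + ζ) := by
    rw [← qpow_add hq0, hs]
    ring_nf
  have m' : qpow q (2 * ξ + 2 * s + 1 / 2) * (qpow q (-υ') * qpow q (-s - 2 * ξ - 1 / 2) *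
      qpow q ξ) = qpow q (ξ + ζ) := by
    rw [← qpow_add hq0, ← qpow_add hq0, ← qpow_add hq0, hs]
    ring_nf
  have n0 : qpow q (ξ + ζ) ≠ 0 := qpow_ne_zero hq0 _
  rw [r1, r2, r3, sig_neg hq0 hq1, ← hs] at pf
  have term : ∀ j, (sig q (kShift ζ ζ' υ υ' j) *
      (sig q (-halfPeriod q j - (-halfPeriod q 3 - ξ - s) + (-2 * ξ - 2 * s)) /
        sig q (-halfPeriod q j - (-halfPeriod q 3 - ξ - s))) *
      ∏ i ∈ Finset.univ.erase j, sig q (-halfPeriod q j - -halfPeriod q i + kShift ζ ζ' υ υ' i) /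
        sig q (-halfPeriod q j - -halfPeriod q i)) *
      (sig q (z - -halfPeriod q j + -(2 * ξ)) / sig q (z - -halfPeriod q j)) =
      qpow q (ξ + ζ) * sig q (2 * ξ) / C * (C * qpow q (-ζ) * sig q (kShift ζ ζ' υ υ' j) * η j *
        qpow q ((1 - 2 * halfExp j) * s) *
        (∏ i ∈ Finset.univ.erase j, sig q (-halfPeriod q j - -halfPeriod q i + kShift ζ ζ' υ υ' i) /
          sig q (-halfPeriod q j - -halfPeriod q i)) *
        faceφ (sig q) (jac q j) z (2 * ξ)) := fun j => by
    have n : sig q (halfPeriod q 3 - halfPeriod q j + (ξ + s)) ≠ 0 := by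
      have h := neg_ne_zero.2 (hb₀ j)
      rwa [← sig_neg hq0 hq1, show -(-halfPeriod q 3 - ξ - s + halfPeriod q j) =
        halfPeriod q 3 - halfPeriod q j + (ξ + s) by ring] at h
    rw [sub_neg_eq_add z, ratio, show -halfPeriod q j - (-halfPeriod q 3 - ξ - s) +
        (-2 * ξ - 2 * s) = halfPeriod q 3 - halfPeriod q j - (ξ + s) by ring,
      show -halfPeriod q j - (-halfPeriod q 3 - ξ - s) =
        halfPeriod q 3 - halfPeriod q j + (ξ + s) by ring, hη, mul_div_cancel_right₀ _ n, faceφ]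
    have e : qpow q ((1 - 2 * halfExp j) * (ξ + s)) * qpow q (-(halfExp j * -(2 * ξ))) =
        qpow q (ξ + ζ) * qpow q (-ζ) * qpow q ((1 - 2 * halfExp j) * s) := by
      rw [← qpow_add hq0, ← qpow_add hq0, ← qpow_add hq0]
      ring_nf
    have hz' := hjz j
    rw [← sub_eq_add_neg]
    generalize (∏ i ∈ Finset.univ.erase j,
      sig q (-halfPeriod q j - -halfPeriod q i + kShift ζ ζ' υ υ' i) /
        sig q (-halfPeriod q j - -halfPeriod q i)) = p
    generalize qpow q (-(halfExp j * -(2 * ξ))) = E at e ⊢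
    generalize qpow q ((1 - 2 * halfExp j) * (ξ + s)) = E' at e ⊢
    field_simp
    linear_combination sig q (kShift ζ ζ' υ υ' j) * η j * p * jac q j (z - 2 * ξ) * e
  rw [Finset.sum_congr rfl fun j _ => term j, ← Finset.mul_sum] at pf
  have l : -sig q (2 * ξ) * (qpow q (ξ + s) * (jac q 3 (ξ - z + s) / jac q 3 (z + ξ + s)) *
      (qpow q (-υ') * kNum q ζ ζ' υ υ' z / (C * sig q (2 * z)))) =
      qpow q (ξ + ζ) * (-sig q (2 * ξ) * (jac q 3 (ξ - z + s) / jac q 3 (z + ξ + s)) *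
        (kNum q ζ ζ' υ υ' z / (C * sig q (2 * z)))) := by
    rw [← m]
    ring
  have r : qpow q (2 * ξ + 2 * s + 1 / 2) * sig q (2 * (-halfPeriod q 3 - ξ - s)) *
      (qpow q (-υ') * (-qpow q (-s - 2 * ξ - 1 / 2) * kNum q ζ υ ζ' υ' ξ) /
        (C * sig q (2 * (-halfPeriod q 3 - ξ - s)))) *
      (qpow q ξ * (jac q 3 (z - ξ + s) / jac q 3 (z + ξ + s))) =
      qpow q (ξ + ζ) * (-(kNum q ζ υ ζ' υ' ξ / C) *
        (jac q 3 (z - ξ + s) / jac q 3 (z + ξ + s))) := by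
    rw [← m']
    generalize qpow q (2 * ξ + 2 * s + 1 / 2) = E
    generalize qpow q (-s - 2 * ξ - 1 / 2) = E'
    generalize sig q (2 * (-halfPeriod q 3 - ξ - s)) = E'' at n3 ⊢
    field_simp
  rw [l, r, mul_div_assoc (qpow q _), mul_assoc (qpow q _) (sig q _ / C), ← mul_add] at pf
  -- Moving the b₀ term to the other side assembles exactly the two terms of `kDiag`.
  have solve : ∀ S : ℂ, -sig q (2 * ξ) * (jac q 3 (ξ - z + s) / jac q 3 (z + ξ + s)) *
      (kNum q ζ ζ' υ υ' z / (C * sig q (2 * z))) = -(kNum q ζ υ ζ' υ' ξ / C) *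
        (jac q 3 (z - ξ + s) / jac q 3 (z + ξ + s)) + sig q (2 * ξ) / C * S →
      kDiag q ζ ζ' υ υ' z ξ = S := fun S h => by
    rw [kDiag, ← hs]
    generalize jac q 3 (ξ - z + s) = N' at *
    generalize jac q 3 (z - ξ + s) = N at *
    field_simp at h ⊢
    linear_combination h
  exact solve _ (mul_left_cancel₀ n0 pf)

end

/-! ### The coefficients of the `K`-matrix at generic points -/

/-- The spectral factor of the coefficients of the `K`-matrix. -/
noncomputable def kScale (q : ℝ) (ζ ζ' υ υ' z : ℂ) : ℂ :=
  qpow q (2 * z * (ζ + ζ')) * sig q (-(2 * z)) /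
    (jac q 0 (ζ + υ - z) * jac q 1 (ζ - υ - z) * jac q 2 (ζ' + υ' - z) * jac q 3 (ζ' - υ' - z))

/-- The off-diagonal coefficient of the `K`-matrix, up to a factor that depends only on `z`. -/
noncomputable def kOff (q : ℝ) (ζ ζ' υ υ' ξ : ℂ) : ℂ :=
  qpow q (2 * ξ * (ζ + υ)) * (jac q 0 (ζ + ζ' + ξ) * jac q 1 (ζ - ζ' + ξ) *
    jac q 2 (υ + υ' + ξ) * jac q 3 (υ - υ' + ξ)) / sig q (2 * ξ)

/-- The genericity conditions under which the coefficients of the `K`-matrix are evaluated. -/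
structure KGeneric (q : ℝ) (ζ ζ' υ υ' z ξ : ℂ) : Prop where
  two_z : sig q (2 * z) ≠ 0
  two_xi : sig q (2 * ξ) ≠ 0
  add : jac q 3 (z + ξ + (ζ + υ')) ≠ 0
  pole : ∀ i, sig q (-halfPeriod q 3 - ξ - (ζ + υ') + halfPeriod q i) ≠ 0
  shift : ∀ s : Finset (Fin 4), sig q (-2 * ξ - 2 * (ζ + υ') + ∑ i ∈ s, kShift ζ ζ' υ υ' i) ≠ 0
  num : jac q 0 (ζ + υ - z) * jac q 1 (ζ - υ - z) * jac q 2 (ζ' + υ' - z) *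
    jac q 3 (ζ' - υ' - z) ≠ 0
  den : jac q 3 (υ - υ' - ξ) ≠ 0

section

variable {q : ℝ} (hq0 : 0 < q) (hq1 : q < 1) {ζ ζ' υ υ' z ξ : ℂ}

include hq0 in
theorem theta_qpow_eq (x : ℂ) : theta q (qpow q x) = qpow q (x / 2) * jac q 0 x := by
  rw [jac_zero, sig, ← mul_assoc, ← qpow_add hq0, show x / 2 + -x / 2 = 0 by ring, qpow_zero,
    one_mul]

include hq0 hq1

theorem theta_neg_qpow_eq (x : ℂ) :
    theta q (-qpow q x) = qpow q ((x + tau q) / 2) * jac q 1 x := by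
  rw [jac_one, ← jac_zero, ← theta_qpow_eq hq0, qpow_add hq0, qpow_tau hq0 hq1, mul_neg_one]

omit hq1 in
theorem theta_half_qpow_eq (x : ℂ) :
    theta q (qpow q (1 / 2 + x)) = qpow q (1 / 4) * jac q 2 x := by
  rw [jac_two, ← jac_zero, theta_qpow_eq hq0, ← mul_assoc, ← qpow_add hq0, add_comm (1 / 2) x]
  ring_nf

theorem theta_neg_half_qpow_eq (x : ℂ) :
    theta q (-qpow q (1 / 2 + x)) = qpow q ((1 / 2 + tau q) / 2) * jac q 3 x := by
  rw [jac_three, ← jac_zero, ← mul_assoc, ← qpow_add hq0,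
    show (1 / 2 + tau q) / 2 + x / 2 = (x + 1 / 2 + tau q) / 2 by ring, ← theta_qpow_eq hq0,
    qpow_add hq0 _ (tau q), qpow_tau hq0 hq1, mul_neg_one, add_comm x]

/-- The constant prefactor contains neither υ nor ζ', so it cancels in every quotient of 𝒞 by 𝒞~. -/
theorem calC_eq (ζ ζ' υ υ' z ξ : ℂ) : calC q ζ ζ' υ υ' z ξ =
    qpow q (ζ + tau q / 2 + 1 / 4) * qpow q (-(ζ + υ - z) * (ζ + ζ' - ξ)) *
      (jac q 0 (ζ + ζ' + ξ) * jac q 1 (ζ - ζ' + ξ) * jac q 2 (υ + υ' + ξ) *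
        jac q 3 (ξ - z - (ζ + υ')) / (sig q (2 * ξ) * jac q 3 (ζ' - υ' - z))) := by
  have e1 : qpow q (ζ + ζ') * qpow q ξ = qpow q (ζ + ζ' + ξ) := (qpow_add hq0 _ _).symm
  have e2 : -qpow q (ζ - ζ') * qpow q ξ = -qpow q (ζ - ζ' + ξ) := by
    rw [qpow_add hq0, neg_mul]
  have e3 : qpow q (1 / 2 + υ + υ') * qpow q ξ = qpow q (1 / 2 + (υ + υ' + ξ)) := by
    rw [← qpow_add hq0]
    ring_nf
  have e4 : -qpow q (1 / 2 + ζ' - υ') * qpow q (ξ - z) / qpow q (ζ + ζ') =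
      -qpow q (1 / 2 + (ξ - z - (ζ + υ'))) := by
    rw [neg_mul, neg_div, ← qpow_add hq0, ← qpow_sub hq0]
    ring_nf
  have e5 : -qpow q (1 / 2 + ζ' - υ') * qpow q (-z) = -qpow q (1 / 2 + (ζ' - υ' - z)) := by
    rw [neg_mul, ← qpow_add hq0]
    ring_nf
  simp only [calC]
  rw [e1, e2, e3, e4, e5, theta_qpow_eq hq0, theta_neg_qpow_eq hq0 hq1, theta_half_qpow_eq hq0,
    theta_neg_half_qpow_eq hq0 hq1, theta_neg_half_qpow_eq hq0 hq1, theta_qpow_eq hq0,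
    jac_zero (2 * ξ)]
  have e : qpow q (ζ + tau q / 2 + 1 / 4) * (qpow q (2 * ξ / 2) * qpow q ((1 / 2 + tau q) / 2)) =
      qpow q ((ζ + ζ' + ξ) / 2) * qpow q ((ζ - ζ' + ξ + tau q) / 2) * qpow q (1 / 4) *
        qpow q ((1 / 2 + tau q) / 2) := by
    simp only [← qpow_add hq0]
    ring_nf
  have n : qpow q (2 * ξ / 2) * qpow q ((1 / 2 + tau q) / 2) ≠ 0 :=
    mul_ne_zero (qpow_ne_zero hq0 _) (qpow_ne_zero hq0 _)
  rw [eq_div_of_mul_eq n e]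
  simp only [div_eq_mul_inv, mul_inv]
  ring

/-- The only theta factor mixing z and ξ occurs in both numerator and denominator, and the products
zξ in the exponents cancel; hence the separation of variables. -/
theorem betacm_eq (h : jac q 3 (ξ - z - (ζ + υ')) ≠ 0) :
    βcm q ζ ζ' υ υ' z ξ = kScale q ζ ζ' υ υ' z * kOff q ζ ζ' υ υ' ξ := by
  rw [βcm, calCt, calC_eq hq0 hq1, calC_eq hq0 hq1, kScale, kOff]
  have n := qpow_ne_zero hq0 (ζ + tau q / 2 + 1 / 4)
  have e : qpow q (-(ζ + υ - z) * (ζ + ζ' - ξ)) =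
      qpow q (2 * z * (ζ + ζ')) * qpow q (2 * ξ * (ζ + υ)) *
        qpow q (-(ζ + ζ' - -ξ) * (ζ + υ - -z)) := by
    simp only [← qpow_add hq0]
    ring_nf
  have n' := qpow_ne_zero hq0 (-(ζ + ζ' - -ξ) * (ζ + υ - -z))
  rw [e, show -z - -ξ - (ζ + υ') = ξ - z - (ζ + υ') by ring, show υ - υ' - -ξ = υ - υ' + ξ by ring,
    mul_neg, ← sub_eq_add_neg, ← sub_eq_add_neg, ← sub_eq_add_neg]
  generalize qpow q (-(ζ + ζ' - -ξ) * (ζ + υ - -z)) = E at n' ⊢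
  generalize jac q 3 (ξ - z - (ζ + υ')) = P at h ⊢
  generalize qpow q (ζ + tau q / 2 + 1 / 4) = E' at n ⊢
  simp only [div_eq_mul_inv, mul_inv, inv_inv]
  have h1 := mul_inv_cancel₀ h
  have h2 := mul_inv_cancel₀ n
  have h3 := mul_inv_cancel₀ n'
  trans (E' * E'⁻¹) * (E * E⁻¹) * (P * P⁻¹) * (qpow q (2 * z * (ζ + ζ')) *
    qpow q (2 * ξ * (ζ + υ)) * (jac q 0 (ζ + ζ' + ξ) * jac q 1 (ζ - ζ' + ξ) *
      jac q 2 (υ + υ' + ξ)) * (sig q (2 * ξ))⁻¹ * (jac q 3 (ζ' - υ' - z))⁻¹ *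
      ((jac q 0 (ζ + υ - z))⁻¹ * (jac q 1 (ζ - υ - z))⁻¹ * (jac q 2 (ζ' + υ' - z))⁻¹) *
      (sig q (-(2 * z)) * jac q 3 (υ - υ' + ξ)))
  · ring
  · rw [h1, h2, h3]
    ring

/-- The powers of q in the quotient contribute q^{2z(ζ+ζ'-ξ)}, and Baxter's gauge factor q^{2zξ}
removes exactly its dependence on ξ. -/
theorem KGeneric.alphaBa_eq (h : KGeneric q ζ ζ' υ υ' z ξ) :
    αcm q ζ ζ' υ υ' z ξ * qpow q (2 * z * ξ) =
      kScale q ζ ζ' υ υ' z * kDiag q ζ ζ' υ υ' z ξ := by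
  obtain ⟨h2z, h2ξ, hP, -, -, hn, hd⟩ := h
  rw [αcm, calCt, calCt, calC_eq hq0 hq1, calC_eq hq0 hq1, calC_eq hq0 hq1, kScale, kDiag, kNum,
    kNum]
  have n := qpow_ne_zero hq0 (ζ + tau q / 2 + 1 / 4)
  have e : qpow q (-(ζ + υ - z) * (ζ + ζ' - ξ)) * qpow q (2 * z * ξ) =
      qpow q (2 * z * (ζ + ζ')) * qpow q (-(ζ + ζ' - ξ) * (ζ + υ - -z)) := by
    simp only [← qpow_add hq0]
    ring_nf
  have n' := qpow_ne_zero hq0 (-(ζ + ζ' - ξ) * (ζ + υ - -z))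
  have p1 : jac q 3 (ξ - z - (ζ + υ')) = jac q 3 (z - ξ + (ζ + υ')) := by
    rw [← jac_even hq0 hq1 (by decide)]
    ring_nf
  have p2 : jac q 3 (z - ξ - (ζ + υ')) = jac q 3 (ξ - z + (ζ + υ')) := by
    rw [← jac_even hq0 hq1 (by decide)]
    ring_nf
  have p3 : jac q 3 (-z - ξ - (ζ + υ')) = jac q 3 (z + ξ + (ζ + υ')) := by
    rw [← jac_even hq0 hq1 (by decide)]
    ring_nf
  rw [show -(ζ + ζ' - ξ) * (ζ + υ - z) = -(ζ + υ - z) * (ζ + ζ' - ξ) by ring, p1, p2, p3, mul_neg,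
    ← sub_eq_add_neg, ← sub_eq_add_neg, ← sub_eq_add_neg]
  have hm : sig q (-(2 * z)) ≠ 0 := by
    rw [sig_neg hq0 hq1]
    exact neg_ne_zero.2 h2z
  simp only [ne_eq, mul_eq_zero, not_or] at hn
  obtain ⟨⟨⟨hn0, hn1⟩, hn2⟩, hn3⟩ := hn
  generalize qpow q (-(ζ + ζ' - ξ) * (ζ + υ - -z)) = E at n' e ⊢
  generalize qpow q (-(ζ + υ - z) * (ζ + ζ' - ξ)) = E₁ at e ⊢
  generalize qpow q (2 * z * (ζ + ζ')) = E₂ at e ⊢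
  generalize qpow q (ζ + tau q / 2 + 1 / 4) = E' at n ⊢
  generalize qpow q (2 * z * ξ) = E₃ at e ⊢
  generalize jac q 3 (z + ξ + (ζ + υ')) = P at hP ⊢
  generalize jac q 3 (z - ξ + (ζ + υ')) = N
  generalize jac q 3 (ξ - z + (ζ + υ')) = N'
  generalize jac q 3 (ζ' - υ' - z) = x₁ at hn3 ⊢
  generalize jac q 3 (υ - υ' - ξ) = x₂ at hd ⊢
  generalize jac q 0 (ζ + υ - z) = y₀ at hn0 ⊢
  generalize jac q 1 (ζ - υ - z) = y₁ at hn1 ⊢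
  generalize jac q 2 (ζ' + υ' - z) = y₂ at hn2 ⊢
  generalize jac q 0 (ζ + υ + z) = w₀
  generalize jac q 1 (ζ - υ + z) = w₁
  generalize jac q 2 (ζ' + υ' + z) = w₂
  generalize jac q 0 (ζ + ζ' + ξ) = v₀
  generalize jac q 1 (ζ - ζ' + ξ) = v₁
  generalize jac q 2 (υ + υ' + ξ) = v₂
  generalize sig q (2 * z) = s₁ at h2z ⊢
  generalize sig q (2 * ξ) = s₂ at h2ξ ⊢
  generalize sig q (-(2 * z)) = s₃ at hm ⊢
  have key : E₁ * E₃ / E = E₂ := by rw [e, mul_div_assoc, div_self n', mul_one]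
  rw [← key]
  field_simp

/-- Each `faceφ` is odd under a joint change of sign, the parity of the Jacobi function cancelling
in the quotient, and the coefficients of the expansion are constants. -/
theorem KGeneric.kDiag_neg (h : KGeneric q ζ ζ' υ υ' z ξ) (h' : KGeneric q ζ ζ' υ υ' (-z) (-ξ)) :
    kDiag q ζ ζ' υ υ' (-z) (-ξ) = -kDiag q ζ ζ' υ υ' z ξ := by
  obtain ⟨r, hr⟩ := exists_kDiag_expansion hq0 hq1 ζ ζ' υ υ'
  rw [hr _ _ h.two_z h.two_xi h.add h.pole h.shift,
    hr _ _ h'.two_z h'.two_xi h'.add h'.pole h'.shift, ← Finset.sum_neg_distrib]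
  refine Finset.sum_congr rfl fun i _ => ?_
  rw [faceφ, faceφ, show -z - 2 * -ξ = -(z - 2 * ξ) by ring, mul_neg, sig_neg hq0 hq1,
    jac_parity hq0 hq1, jac_parity hq0 hq1, ← mul_neg]
  congr 1
  have : jacSign i ≠ 0 := by fin_cases i <;> simp [jacSign]
  rw [mul_assoc, mul_div_mul_left _ _ this, mul_neg, div_neg]

theorem KGeneric.kDiag_mul (h : KGeneric q ζ ζ' υ υ' z ξ) (h' : KGeneric q ζ ζ' υ υ' (-z) (-ξ))
    (h'' : KGeneric q ζ ζ' υ υ' z (-ξ)) :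
    kDiag q ζ ζ' υ υ' z ξ * kDiag q ζ ζ' υ υ' z (-ξ) =
      kNum q ζ υ ζ' υ' ξ / sig q (2 * ξ) * (kNum q ζ υ ζ' υ' (-ξ) / sig q (2 * -ξ)) -
        kNum q ζ ζ' υ υ' z / sig q (2 * z) * (kNum q ζ ζ' υ υ' (-z) / sig q (2 * -z)) := by
  have h1 := h.kDiag_neg hq0 hq1 h'
  have nP := h.add
  have nP' := h'.add
  have nN := h''.add
  have e1 : kDiag q ζ ζ' υ υ' z ξ * jac q 3 (z + ξ + (ζ + υ')) =
      kNum q ζ υ ζ' υ' ξ / sig q (2 * ξ) * jac q 3 (z - ξ + (ζ + υ')) -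
        kNum q ζ ζ' υ υ' z / sig q (2 * z) * jac q 3 (ξ - z + (ζ + υ')) := by
    rw [kDiag, div_mul_cancel₀ _ nP]
    ring
  have e2 : kDiag q ζ ζ' υ υ' (-z) (-ξ) * jac q 3 (-z + -ξ + (ζ + υ')) =
      kNum q ζ υ ζ' υ' (-ξ) / sig q (2 * -ξ) * jac q 3 (ξ - z + (ζ + υ')) -
        kNum q ζ ζ' υ υ' (-z) / sig q (2 * -z) * jac q 3 (z - ξ + (ζ + υ')) := by
    rw [kDiag, div_mul_cancel₀ _ nP', show -z - -ξ + (ζ + υ') = ξ - z + (ζ + υ') by ring,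
      show -ξ - -z + (ζ + υ') = z - ξ + (ζ + υ') by ring]
    ring
  have e3 : kDiag q ζ ζ' υ υ' z (-ξ) * jac q 3 (z - ξ + (ζ + υ')) =
      kNum q ζ υ ζ' υ' (-ξ) / sig q (2 * -ξ) * jac q 3 (z + ξ + (ζ + υ')) -
        kNum q ζ ζ' υ υ' z / sig q (2 * z) * jac q 3 (-z + -ξ + (ζ + υ')) := by
    rw [← sub_eq_add_neg] at nN
    rw [kDiag, ← sub_eq_add_neg z ξ, div_mul_cancel₀ _ nN, sub_neg_eq_add,
      show -ξ - z + (ζ + υ') = -z + -ξ + (ζ + υ') by ring]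
    ring
  rw [h1] at e2
  rw [← sub_eq_add_neg] at nN
  refine mul_right_cancel₀ nN ?_
  -- Multiply `e3` by kDiag(z, ξ) and substitute `e1` and, by oddness, `e2`: the mixed terms cancel
  -- and the common theta factor divides out.
  linear_combination kDiag q ζ ζ' υ υ' z ξ * e3 +
    kNum q ζ υ ζ' υ' (-ξ) / sig q (2 * -ξ) * e1 +
    kNum q ζ ζ' υ υ' z / sig q (2 * z) * e2

-- Matches the ξ-dependent part of `KGeneric.kDiag_mul`, so the determinant depends on z alone.
omit hq1 in
theorem kOff_mul (ζ ζ' υ υ' ξ : ℂ) : kOff q ζ ζ' υ υ' ξ * kOff q ζ ζ' υ υ' (-ξ) =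
    kNum q ζ υ ζ' υ' ξ / sig q (2 * ξ) * (kNum q ζ υ ζ' υ' (-ξ) / sig q (2 * -ξ)) := by
  have e : qpow q (2 * ξ * (ζ + υ)) * qpow q (2 * -ξ * (ζ + υ)) = 1 := by
    rw [← qpow_add hq0, ← qpow_zero (q := q)]
    ring_nf
  simp only [kOff, kNum, sub_neg_eq_add, ← sub_eq_add_neg]
  generalize sig q (2 * -ξ) = s'
  generalize sig q (2 * ξ) = s
  simp only [div_eq_mul_inv]
  linear_combination (jac q 0 (ζ + ζ' + ξ) * jac q 1 (ζ - ζ' + ξ) *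
    jac q 2 (υ + υ' + ξ) * jac q 3 (υ - υ' + ξ)) * (jac q 0 (ζ + ζ' - ξ) * jac q 1 (ζ - ζ' - ξ) *
    jac q 2 (υ + υ' - ξ) * jac q 3 (υ - υ' - ξ)) * s⁻¹ * s'⁻¹ * e

-- The scale normalises the determinant left by `KGeneric.kDiag_mul` and `kOff_mul`; this is the
-- source of unitarity of K.
omit hq1 in
theorem KGeneric.kScale_mul (h : KGeneric q ζ ζ' υ υ' z ξ) (h' : KGeneric q ζ ζ' υ υ' (-z) ξ) :
    kScale q ζ ζ' υ υ' z * kScale q ζ ζ' υ υ' (-z) *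
      (kNum q ζ ζ' υ υ' z / sig q (2 * z) * (kNum q ζ ζ' υ υ' (-z) / sig q (2 * -z))) = 1 := by
  have e : qpow q (2 * z * (ζ + ζ')) * qpow q (2 * -z * (ζ + ζ')) = 1 := by
    rw [← qpow_add hq0, ← qpow_zero (q := q)]
    ring_nf
  have n := h.num
  have n' := h'.num
  have s := h.two_z
  have s' := h'.two_z
  simp only [sub_neg_eq_add, ne_eq, mul_eq_zero, not_or] at n n'
  obtain ⟨⟨⟨n0, n1⟩, n2⟩, n3⟩ := n
  obtain ⟨⟨⟨m0, m1⟩, m2⟩, m3⟩ := n'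
  simp only [kScale, kNum, sub_neg_eq_add, ← sub_eq_add_neg]
  rw [← mul_neg, show -(2 * -z) = 2 * z by ring]
  generalize sig q (2 * -z) = s' at *
  generalize sig q (2 * z) = s at *
  rw [← e]
  generalize qpow q (2 * z * (ζ + ζ')) = E
  generalize qpow q (2 * -z * (ζ + ζ')) = E'
  field_simp

end

/-! ### Generic points -/

/-- The filter of the sets that contain a dense open set. -/
def generic (E : Type*) [TopologicalSpace E] : Filter E where
  sets := {s | Dense (interior s)}
  univ_sets := by simp
  sets_of_superset h hst := h.mono (interior_mono hst)
  inter_sets {s t} hs ht := by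
    simpa only [Set.mem_ofPred_eq, interior_inter] using hs.inter_of_isOpen_left ht isOpen_interior

theorem eventually_generic_iff {E : Type*} [TopologicalSpace E] {P : E → Prop} :
    (∀ᶠ x in generic E, P x) ↔ ∃ U : Set E, IsOpen U ∧ Dense U ∧ ∀ x ∈ U, P x :=
  ⟨fun h => ⟨_, isOpen_interior, h, fun _ hx => interior_subset hx⟩,
    fun ⟨_, hU, hd, h⟩ => hd.mono (interior_maximal h hU)⟩

theorem merEq_iff {E β : Type*} [TopologicalSpace E] {f g : E → β} :
    MerEq f g ↔ ∀ᶠ x in generic E, f x = g x :=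
  eventually_generic_iff.symm

theorem frequently_nhds_of_generic {E : Type*} [TopologicalSpace E] {P : E → Prop}
    (h : ∀ᶠ x in generic E, P x) (x : E) : ∃ᶠ y in 𝓝 x, P y :=
  (mem_closure_iff_frequently.1 (Dense.closure_eq h ▸ Set.mem_univ x)).mono
    fun _ hy => interior_subset hy

/-- Generic properties pull back along a continuous map with a continuous family of local
sections. -/
theorem tendsto_generic {E F : Type*} [AddCommGroup E] [TopologicalSpace E] [ContinuousAdd E]
    [AddCommGroup F] [TopologicalSpace F] [ContinuousAdd F] (m : E → F) (s : F → E)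
    (hm : Continuous m) (hs : Continuous s) (hs0 : s 0 = 0) (h : ∀ p y, m (p + s y) = m p + y) :
    Filter.Tendsto m (generic E) (generic F) := by
  intro S hS
  have hU : IsOpen (m ⁻¹' interior S) := isOpen_interior.preimage hm
  refine Dense.mono (interior_maximal (Set.preimage_mono interior_subset) hU) ?_
  intro x
  rw [mem_closure_iff_frequently]
  have hd : Dense {y | m x + y ∈ interior S} := by
    have := Dense.preimage (f := fun y => m x + y) hS (Homeomorph.addLeft (m x)).isOpenMap
    exact this
  have hf : ∃ᶠ y in 𝓝 (0 : F), m x + y ∈ interior S :=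
    mem_closure_iff_frequently.1 (hd 0)
  have ht : Filter.Tendsto (fun y => x + s y) (𝓝 0) (𝓝 x) := by
    have : Continuous fun y => x + s y := continuous_const.add hs
    simpa [hs0] using this.tendsto 0
  refine ht.frequently (hf.mono fun y hy => ?_)
  rwa [Set.mem_preimage, h]

/-- The zeros of a nonzero entire function are not generic. -/
theorem eventually_generic_ne_zero {f : ℂ → ℂ} (hf : Differentiable ℂ f) (h : ∃ x, f x ≠ 0) :
    ∀ᶠ x in generic ℂ, f x ≠ 0 := by
  have hU : IsOpen {x | f x ≠ 0} := isOpen_ne_fun hf.continuous continuous_const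
  have ha : AnalyticOnNhd ℂ f Set.univ := fun x _ => hf.analyticAt x
  refine eventually_generic_iff.2 ⟨_, hU, fun x => ?_, fun _ hx => hx⟩
  rw [mem_closure_iff_frequently]
  intro hx
  obtain ⟨y, hy⟩ := h
  refine hy (ha.eqOn_zero_of_preconnected_of_eventuallyEq_zero isPreconnected_univ
    (Set.mem_univ x) ?_ (Set.mem_univ y))
  filter_upwards [hx] with z hz
  simpa using hz

/-! ### Quotients of entire functions -/

/-- `f` is a quotient of two analytic functions whose denominator is generically nonzero. -/
def IsEntireQuotient {E : Type*} [NormedAddCommGroup E] [NormedSpace ℂ E] (f : E → ℂ) : Prop :=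
  ∃ g h : E → ℂ, (∀ x, AnalyticAt ℂ g x) ∧ (∀ x, AnalyticAt ℂ h x) ∧
    (∀ᶠ x in generic E, h x ≠ 0) ∧ ∀ x, h x ≠ 0 → f x = g x / h x

namespace IsEntireQuotient

variable {E : Type*} [NormedAddCommGroup E] [NormedSpace ℂ E] {f f' : E → ℂ}

theorem isMeromorphic (hf : IsEntireQuotient f) : IsMeromorphic f := by
  obtain ⟨g, h, hg, hh, hn, he⟩ := hf
  exact fun x => ⟨g, h, hg x, hh x, frequently_nhds_of_generic hn x, Filter.Eventually.of_forall he⟩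

theorem of_analytic (hf : ∀ x, AnalyticAt ℂ f x) : IsEntireQuotient f :=
  ⟨f, 1, hf, fun _ => analyticAt_const, Filter.Eventually.of_forall fun _ => one_ne_zero,
    fun x _ => by simp⟩

theorem mul (hf : IsEntireQuotient f) (hf' : IsEntireQuotient f') :
    IsEntireQuotient fun x => f x * f' x := by
  obtain ⟨g, h, hg, hh, hn, he⟩ := hf
  obtain ⟨g', h', hg', hh', hn', he'⟩ := hf'
  refine ⟨fun x => g x * g' x, fun x => h x * h' x, fun x => (hg x).mul (hg' x),
    fun x => (hh x).mul (hh' x), ?_, fun x hx => ?_⟩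
  · filter_upwards [hn, hn'] with x h1 h2 using mul_ne_zero h1 h2
  · dsimp only
    rw [he x (left_ne_zero_of_mul hx), he' x (right_ne_zero_of_mul hx), div_mul_div_comm]

theorem sub (hf : IsEntireQuotient f) (hf' : IsEntireQuotient f') :
    IsEntireQuotient fun x => f x - f' x := by
  obtain ⟨g, h, hg, hh, hn, he⟩ := hf
  obtain ⟨g', h', hg', hh', hn', he'⟩ := hf'
  refine ⟨fun x => g x * h' x - h x * g' x, fun x => h x * h' x,
    fun x => ((hg x).mul (hh' x)).sub ((hh x).mul (hg' x)),
    fun x => (hh x).mul (hh' x), ?_, fun x hx => ?_⟩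
  · filter_upwards [hn, hn'] with x h1 h2 using mul_ne_zero h1 h2
  · dsimp only
    rw [he x (left_ne_zero_of_mul hx), he' x (right_ne_zero_of_mul hx),
      div_sub_div _ _ (left_ne_zero_of_mul hx) (right_ne_zero_of_mul hx)]

theorem div (hf : IsEntireQuotient f) (hf' : IsEntireQuotient f')
    (hne : ∀ᶠ x in generic E, f' x ≠ 0) : IsEntireQuotient fun x => f x / f' x := by
  have hi : IsEntireQuotient fun x => (f' x)⁻¹ := by
    obtain ⟨g, h, hg, hh, hn, he⟩ := hf'
    -- The extra factor h excludes the points where the value of f' is not controlled by g / h.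
    refine ⟨fun x => h x * h x, fun x => g x * h x, fun x => (hh x).mul (hh x),
      fun x => (hg x).mul (hh x), ?_, fun x hx => ?_⟩
    · filter_upwards [hn, hne] with x h1 h2
      refine mul_ne_zero (fun h0 => h2 ?_) h1
      rw [he x h1, h0, zero_div]
    · dsimp only
      rw [he x (right_ne_zero_of_mul hx), inv_div, mul_div_mul_right _ _ (right_ne_zero_of_mul hx)]
  simpa only [div_eq_mul_inv] using hf.mul hi

end IsEntireQuotient

/-! ### Genericity of the conditions on theta functions -/

section

variable {q : ℝ} (hq0 : 0 < q) (hq1 : q < 1)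
include hq0 hq1

theorem generic_theta : ∀ᶠ x in generic ℂ, theta q (qpow q x) ≠ 0 := by
  refine eventually_generic_ne_zero (differentiable_theta_qpow hq0 hq1) ⟨(tau q), ?_⟩
  rw [qpow_tau hq0 hq1]
  exact theta_neg_one_ne_zero hq0 hq1

theorem generic_sig : ∀ᶠ x in generic ℂ, sig q x ≠ 0 :=
  (generic_theta hq0 hq1).mono fun _ h => mul_ne_zero (qpow_ne_zero hq0 _) h

theorem generic_jac (i : Fin 4) : ∀ᶠ x in generic ℂ, jac q i x ≠ 0 := by
  have := (tendsto_generic (fun x : ℂ => x + halfPeriod q i) id (by fun_prop) continuous_id rfl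
    fun p y => by simp; ring).eventually (generic_sig hq0 hq1)
  exact this.mono fun _ h => mul_ne_zero (qpow_ne_zero hq0 _) h

end

/-! ### The defining properties from generic identities between the coefficients -/

theorem tendsto_generic_neg_last :
    Filter.Tendsto (fun p : ℂ × ℂ × ℂ => (p.1, p.2.1, -p.2.2)) (generic _) (generic _) :=
  tendsto_generic _ (fun p => (p.1, p.2.1, -p.2.2)) (by fun_prop) (by fun_prop) (by simp)
    fun p y => by ext <;> (simp; try ring)

theorem tendsto_generic_neg_snd :
    Filter.Tendsto (fun p : ℂ × ℂ => (p.1, -p.2)) (generic _) (generic _) :=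
  tendsto_generic _ (fun p => (p.1, -p.2)) (by fun_prop) (by fun_prop) (by simp)
    fun p y => by ext <;> (simp; try ring)

theorem tendsto_generic_neg_fst :
    Filter.Tendsto (fun p : ℂ × ℂ => (-p.1, p.2)) (generic _) (generic _) :=
  tendsto_generic _ (fun p => (-p.1, p.2)) (by fun_prop) (by fun_prop) (by simp)
    fun p y => by ext <;> (simp; try ring)

theorem Coeffs.isMeromorphicFamily_R {c : Coeffs}
    (hA : IsEntireQuotient fun p : ℂ × ℂ => c.A p.1 p.2)
    (hA' : IsEntireQuotient fun p : ℂ × ℂ => c.A p.1 (-p.2))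
    (hB : IsEntireQuotient fun p : ℂ × ℂ => c.B p.1 p.2)
    (hB' : IsEntireQuotient fun p : ℂ × ℂ => c.B p.1 (-p.2)) : IsMeromorphicFamily c.R := by
  have h0 : IsEntireQuotient fun _ : ℂ × ℂ => (0 : ℂ) :=
    .of_analytic fun _ => analyticAt_const
  have h1 : IsEntireQuotient fun _ : ℂ × ℂ => (1 : ℂ) :=
    .of_analytic fun _ => analyticAt_const
  rintro ⟨a, b⟩ ⟨a', b'⟩
  refine IsEntireQuotient.isMeromorphic ?_
  simp only [Coeffs.R_apply]
  split_ifs <;> assumption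

theorem Coeffs.isMeromorphicFamily_K {c : Coeffs}
    (hα : IsEntireQuotient fun p : ℂ × ℂ => c.α p.1 p.2)
    (hα' : IsEntireQuotient fun p : ℂ × ℂ => c.α p.1 (-p.2))
    (hβ : IsEntireQuotient fun p : ℂ × ℂ => c.β p.1 p.2)
    (hβ' : IsEntireQuotient fun p : ℂ × ℂ => c.β p.1 (-p.2)) : IsMeromorphicFamily c.K := by
  intro a a'
  refine IsEntireQuotient.isMeromorphic ?_
  simp only [Coeffs.K_apply]
  split_ifs <;> assumption

theorem Coeffs.isDynamicalR_of_generic {c : Coeffs} {κ : ℂ} (hm : IsMeromorphicFamily c.R)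
    (h : ∀ᶠ p : ℂ × ℂ × ℂ in generic _,
      FaceYangBaxter c.A c.B (2 * κ) p.1 p.2.1 (p.1 + p.2.1) p.2.2) :
    IsDynamicalR spinWt κ c.R := by
  refine ⟨hm, merEq_iff.2 ?_⟩
  -- Only differences of spectral parameters matter: u = z₁ - z₂ and v = z₂ - z₃, with section z₁ =
  -- u + v, z₂ = v, z₃ = 0.
  have t : Filter.Tendsto (fun p : ℂ × ℂ × ℂ × ℂ => (p.1 - p.2.1, p.2.1 - p.2.2.1, p.2.2.2))
      (generic _) (generic _) :=
    tendsto_generic _ (fun y => (y.1 + y.2.1, y.2.1, 0, y.2.2)) (by fun_prop) (by fun_prop)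
      (by simp) fun p y => by
        ext <;> simp
        all_goals ring
  filter_upwards [t.eventually h, t.eventually (tendsto_generic_neg_last.eventually h)]
    with ⟨z₁, z₂, z₃, ξ⟩ h1 h2
  simp only [sub_add_sub_cancel] at h1 h2
  exact c.yangBaxter_of_entries h1 h2

theorem Coeffs.isUnitaryR_of_generic {c : Coeffs}
    (h : ∀ᶠ p : ℂ × ℂ in generic _, FaceUnitary c.A c.B p.1 p.2) : IsUnitaryR c.R := by
  refine merEq_iff.2 ?_
  filter_upwards [h, tendsto_generic_neg_snd.eventually h] with p h1 h2
  exact c.unitaryR_of_entries h1 h2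

theorem Coeffs.isRightDynamicalK_of_generic {c : Coeffs} {κ : ℂ} (hm : IsMeromorphicFamily c.K)
    (h : ∀ᶠ p : ℂ × ℂ × ℂ in generic _,
      ReflectionEntries c.A c.B c.α c.β p.1 p.2.1 (p.1 - p.2.1) (p.1 + p.2.1) κ p.2.2) :
    IsRightDynamicalK spinWt κ c.R c.K := by
  refine ⟨hm, merEq_iff.2 ?_⟩
  filter_upwards [h, tendsto_generic_neg_last.eventually h] with ⟨z₁, z₂, ξ⟩ h1 h2
  exact c.reflection_of_entries h1 h2

/-- The entries of the unitarity of the `K`-matrix in the first row. -/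
structure UnitaryKEntries (α β : ℂ → ℂ → ℂ) (z ξ : ℂ) : Prop where
  diag : α z ξ * α (-z) ξ + β z ξ * β (-z) (-ξ) = 1
  offDiag : α z ξ * β (-z) ξ + β z ξ * α (-z) (-ξ) = 0

theorem Coeffs.isUnitaryK_of_generic {c : Coeffs}
    (h : ∀ᶠ p : ℂ × ℂ in generic _, UnitaryKEntries c.α c.β p.1 p.2) : IsUnitaryK c.K := by
  refine merEq_iff.2 ?_
  filter_upwards [h, tendsto_generic_neg_snd.eventually h] with p h1 h2
  obtain ⟨k1, k2⟩ := h2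
  obtain ⟨h1, h2⟩ := h1
  simp only [neg_neg] at k1 k2
  ext a a'
  fin_cases a <;> fin_cases a' <;>
    simp only [Matrix.mul_apply, Fin.sum_univ_two, Coeffs.K, Matrix.one_apply, Fin.zero_eta,
      Fin.mk_one, Matrix.of_apply, Matrix.cons_val_zero, Matrix.cons_val_one, if_true, zero_ne_one,
      one_ne_zero, if_false]
  · exact h1
  · exact h2
  · linear_combination k2
  · linear_combination k1

theorem UnitaryKEntries.gauge {α β α' : ℂ → ℂ → ℂ} {q : ℝ} (hq0 : 0 < q) {z ξ : ℂ}
    (hα : ∀ z y, α' z y = qpow q (-(2 * z * y)) * α z y) (h : UnitaryKEntries α β z ξ) :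
    UnitaryKEntries α' β z ξ := by
  obtain ⟨h1, h2⟩ := h
  have e : qpow q (-(2 * z * ξ)) * qpow q (-(2 * -z * ξ)) = 1 := by
    rw [← qpow_add hq0, ← qpow_zero (q := q)]
    ring_nf
  have e' : qpow q (-(2 * -z * -ξ)) = qpow q (-(2 * z * ξ)) := by ring_nf
  constructor
  · rw [hα, hα]
    linear_combination h1 + α z ξ * α (-z) ξ * e
  · rw [hα, hα, e']
    linear_combination qpow q (-(2 * z * ξ)) * h2

/-! ### The coefficients of the `R`-matrices -/

section

variable {q : ℝ} (hq0 : 0 < q)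
include hq0

/-- The factors q^{x/2} converting θ to σ have equal total exponents in numerator and denominator.
-/
theorem ABa_eq (κ : ℂ) : ABa q κ = faceA (sig q) (2 * κ) := by
  ext z x
  rw [ABa, faceA]
  simp only [theta_qpow_eq hq0, jac_zero]
  have e : qpow q (-z / 2) * qpow q ((2 * κ + x) / 2) =
      qpow q ((2 * κ - z) / 2) * qpow q (x / 2) := by
    simp only [← qpow_add hq0]
    ring_nf
  rw [mul_mul_mul_comm, e, mul_mul_mul_comm _ (sig q (2 * κ - z)), mul_div_mul_left]
  exact mul_ne_zero (qpow_ne_zero hq0 _) (qpow_ne_zero hq0 _)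

theorem BBa_eq (hq1 : q < 1) (κ : ℂ) : BBa q κ = faceB (sig q) (2 * κ) := by
  ext z x
  rw [BBa, faceB]
  simp only [theta_qpow_eq hq0, jac_zero]
  have e : qpow q ((-z - x) / 2) * qpow q ((2 * κ) / 2) =
      qpow q ((2 * κ - z) / 2) * qpow q (-x / 2) := by
    simp only [← qpow_add hq0]
    ring_nf
  rw [mul_mul_mul_comm, e, mul_mul_mul_comm _ (sig q (2 * κ - z)), mul_div_mul_left,
    ← neg_add', sig_neg hq0 hq1, sig_neg hq0 hq1, neg_mul, mul_neg, neg_div_neg_eq]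
  exact mul_ne_zero (qpow_ne_zero hq0 _) (qpow_ne_zero hq0 _)

omit hq0 in
theorem theta_ne_zero_of_sig {x : ℂ} (h : sig q x ≠ 0) : theta q (qpow q x) ≠ 0 :=
  right_ne_zero_of_mul h

omit hq0 in
theorem uBa_mul {κ x : ℂ} (h : theta q (qpow q x) ≠ 0) (h' : theta q (qpow q (-x)) ≠ 0)
    (h₁ : theta q (qpow q (2 * κ + x)) ≠ 0) (h₂ : theta q (qpow q (2 * κ - x)) ≠ 0) :
    uBa q κ x * uBa q κ (-x) = 1 := by
  simp only [uBa, neg_neg, sub_neg_eq_add, ← sub_eq_add_neg]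
  field_simp

omit hq0 in
theorem Acm_eq_gauge {κ z x : ℂ} (h : theta q (qpow q x) ≠ 0)
    (h₁ : theta q (qpow q (2 * κ + x)) ≠ 0) :
    Acm q κ z x = (uBa q κ x)⁻¹ * qpow q (2 * κ * (z - x)) * ABa q κ z x := by
  rw [Acm, uBa, ABa, inv_div]
  simp only [div_eq_mul_inv, mul_inv]
  field_simp

theorem ABa_eq_gauge {κ z x : ℂ} (h' : theta q (qpow q (-x)) ≠ 0)
    (h₂ : theta q (qpow q (2 * κ - x)) ≠ 0) :
    ABa q κ z x = qpow q (2 * κ * (x - z)) * (uBa q κ x * Acm q κ z x) := by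
  have e : qpow q (2 * κ * (x - z)) * qpow q (2 * κ * (z - x)) = 1 := by
    rw [← qpow_add hq0, ← qpow_zero (q := q)]
    ring_nf
  rw [Acm, uBa, ABa]
  trans (qpow q (2 * κ * (x - z)) * qpow q (2 * κ * (z - x))) *
    (theta q (qpow q (-x)) * (theta q (qpow q (-x)))⁻¹) *
    (theta q (qpow q (2 * κ - x)) * (theta q (qpow q (2 * κ - x)))⁻¹) *
    (theta q (qpow q (-z)) * theta q (qpow q (2 * κ + x)) /
      (theta q (qpow q (2 * κ - z)) * theta q (qpow q x)))
  · rw [e, mul_inv_cancel₀ h', mul_inv_cancel₀ h₂]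
    ring
  · simp only [div_eq_mul_inv, mul_inv]
    ring

omit hq0 in
theorem Bcm_eq_gauge (κ z x : ℂ) : Bcm q κ z x = qpow q (z * (2 * κ + x)) * BBa q κ z x := by
  rw [Bcm, BBa]
  ring_nf

theorem BBa_eq_gauge (κ z x : ℂ) : BBa q κ z x = qpow q (-z * (2 * κ + x)) * Bcm q κ z x := by
  rw [Bcm_eq_gauge, ← mul_assoc, ← qpow_add hq0, neg_mul, neg_add_cancel, qpow_zero, one_mul]

end

/-! ### The identities between the coefficients hold generically -/

section

variable {q : ℝ} (hq0 : 0 < q) (hq1 : q < 1)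
include hq0 hq1

/-- Here `s` is a direction along which `m` grows at unit speed; it provides the section needed to
pull genericity back. The default proofs cover affine `m`. -/
theorem generic_sig_comp {E : Type*} [AddCommGroup E] [TopologicalSpace E] [ContinuousAdd E]
    (m : E → ℂ) (s : ℂ → E) (hm : Continuous m := by fun_prop) (hs : Continuous s := by fun_prop)
    (hs0 : s 0 = 0 := by simp) (h : ∀ p y, m (p + s y) = m p + y := by
      intro p y; beta_reduce; first | (simp; done) | (simp; ring) | ring) :
    ∀ᶠ p in generic E, sig q (m p) ≠ 0 :=
  (tendsto_generic m s hm hs hs0 h).eventually (generic_sig hq0 hq1)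

theorem generic_jac_comp {E : Type*} [AddCommGroup E] [TopologicalSpace E] [ContinuousAdd E]
    (i : Fin 4) (m : E → ℂ) (s : ℂ → E) (hm : Continuous m := by fun_prop)
    (hs : Continuous s := by fun_prop) (hs0 : s 0 = 0 := by simp)
    (h : ∀ p y, m (p + s y) = m p + y := by
      intro p y; beta_reduce; first | (simp; done) | (simp; ring) | ring) :
    ∀ᶠ p in generic E, jac q i (m p) ≠ 0 :=
  (tendsto_generic m s hm hs hs0 h).eventually (generic_jac hq0 hq1 i)

theorem generic_kGeneric (ζ ζ' υ υ' : ℂ) :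
    ∀ᶠ p : ℂ × ℂ in generic _, KGeneric q ζ ζ' υ υ' p.1 p.2 := by
  filter_upwards [generic_sig_comp hq0 hq1 (fun p : ℂ × ℂ => 2 * p.1) (fun y => (y / 2, 0)),
    generic_sig_comp hq0 hq1 (fun p : ℂ × ℂ => 2 * p.2) (fun y => (0, y / 2)),
    generic_jac_comp hq0 hq1 3 (fun p : ℂ × ℂ => p.1 + p.2 + (ζ + υ')) (fun y => (y, 0)),
    Filter.eventually_all.2 fun i => generic_sig_comp hq0 hq1
      (fun p : ℂ × ℂ => -halfPeriod q 3 - p.2 - (ζ + υ') + halfPeriod q i) (fun y => (0, -y)),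
    Filter.eventually_all.2 fun s : Finset (Fin 4) => generic_sig_comp hq0 hq1
      (fun p : ℂ × ℂ => -2 * p.2 - 2 * (ζ + υ') + ∑ i ∈ s, kShift ζ ζ' υ υ' i)
      (fun y => (0, -y / 2)),
    generic_jac_comp hq0 hq1 0 (fun p : ℂ × ℂ => ζ + υ - p.1) (fun y => (-y, 0)),
    generic_jac_comp hq0 hq1 1 (fun p : ℂ × ℂ => ζ - υ - p.1) (fun y => (-y, 0)),
    generic_jac_comp hq0 hq1 2 (fun p : ℂ × ℂ => ζ' + υ' - p.1) (fun y => (-y, 0)),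
    generic_jac_comp hq0 hq1 3 (fun p : ℂ × ℂ => ζ' - υ' - p.1) (fun y => (-y, 0)),
    generic_jac_comp hq0 hq1 3 (fun p : ℂ × ℂ => υ - υ' - p.2) (fun y => (0, -y))]
    with p h1 h2 h3 h4 h5 h6 h7 h8 h9 h10
  exact ⟨h1, h2, h3, h4, h5, mul_ne_zero (mul_ne_zero (mul_ne_zero h6 h7) h8) h9, h10⟩

theorem generic_faceYangBaxter (k : ℂ) : ∀ᶠ p : ℂ × ℂ × ℂ in generic _,
    FaceYangBaxter (faceA (sig q) k) (faceB (sig q) k) k p.1 p.2.1 (p.1 + p.2.1) p.2.2 := by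
  filter_upwards [generic_sig_comp hq0 hq1 (fun p : ℂ × ℂ × ℂ => p.2.2) (fun y => (0, 0, y)),
    generic_sig_comp hq0 hq1 (fun p : ℂ × ℂ × ℂ => k - p.2.2) (fun y => (0, 0, -y)),
    generic_sig_comp hq0 hq1 (fun p : ℂ × ℂ × ℂ => k - p.1) (fun y => (-y, 0, 0)),
    generic_sig_comp hq0 hq1 (fun p : ℂ × ℂ × ℂ => k - p.2.1) (fun y => (0, -y, 0)),
    generic_sig_comp hq0 hq1 (fun p : ℂ × ℂ × ℂ => k - (p.1 + p.2.1)) (fun y => (-y, 0, 0))]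
    with p h1 h2 h3 h4 h5
  exact (sigmaPair_sig hq0 hq1).faceYangBaxter h1 h2 h3 h4 h5

theorem generic_faceUnitary (k : ℂ) : ∀ᶠ p : ℂ × ℂ in generic _,
    FaceUnitary (faceA (sig q) k) (faceB (sig q) k) p.1 p.2 := by
  filter_upwards [generic_sig_comp hq0 hq1 (fun p : ℂ × ℂ => p.2) (fun y => (0, y)),
    generic_sig_comp hq0 hq1 (fun p : ℂ × ℂ => k - p.1) (fun y => (-y, 0)),
    generic_sig_comp hq0 hq1 (fun p : ℂ × ℂ => k + p.1) (fun y => (y, 0))] with p h1 h2 h3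
  exact (sigmaPair_sig hq0 hq1).faceUnitary h1 h2 h3

/-- `u(ξ) u(-ξ) = 1`, together with the genericity conditions of the first gauge. -/
theorem generic_uBa (κ : ℂ) : ∀ᶠ x in generic ℂ, uBa q κ x * uBa q κ (-x) = 1 ∧
    (∀ z, Acm q κ z x = (uBa q κ x)⁻¹ * qpow q (2 * κ * (z - x)) * ABa q κ z x) ∧
    (∀ z, ABa q κ z x = qpow q (2 * κ * (x - z)) * (uBa q κ x * Acm q κ z x)) := by
  filter_upwards [generic_sig_comp hq0 hq1 (fun x : ℂ => x) (fun y => y),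
    generic_sig_comp hq0 hq1 (fun x : ℂ => -x) (fun y => -y),
    generic_sig_comp hq0 hq1 (fun x : ℂ => 2 * κ + x) (fun y => y),
    generic_sig_comp hq0 hq1 (fun x : ℂ => 2 * κ - x) (fun y => -y)] with x h1 h2 h3 h4
  replace h1 := theta_ne_zero_of_sig h1
  replace h2 := theta_ne_zero_of_sig h2
  replace h3 := theta_ne_zero_of_sig h3
  replace h4 := theta_ne_zero_of_sig h4
  exact ⟨uBa_mul h1 h2 h3 h4, fun z => Acm_eq_gauge h1 h3, fun z => ABa_eq_gauge hq0 h2 h4⟩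

variable (κ ζ ζ' υ υ' : ℂ)

-- The diagonal coefficient is a function of the spectral parameter times a function of the
-- dynamical one.
omit hq0 hq1 in
theorem faceA_mul_symm (f : ℂ → ℂ) (k m p x : ℂ) :
    faceA f k m (-x) * faceA f k p x = faceA f k m x * faceA f k p (-x) := by
  simp only [faceA, div_eq_mul_inv, mul_inv]
  ring

omit hq1 in
theorem alphacm_eq_gauge (z ξ : ℂ) : αcm q ζ ζ' υ υ' z ξ =
    qpow q (-(2 * z * ξ)) * (αcm q ζ ζ' υ υ' z ξ * qpow q (2 * z * ξ)) := by
  rw [mul_left_comm, ← qpow_add hq0, neg_add_cancel, qpow_zero, mul_one]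

/-- The sign of y is reversed because the cancelled factor at y - z - (ζ + υ') is, by evenness, the
one in condition `add` at (z, -y). -/
theorem betacm_eq_of_kGeneric {z y : ℂ} (h : KGeneric q ζ ζ' υ υ' z (-y)) :
    βcm q ζ ζ' υ υ' z y = kScale q ζ ζ' υ υ' z * kOff q ζ ζ' υ υ' y := by
  refine betacm_eq hq0 hq1 ?_
  rw [← jac_even hq0 hq1 (by decide), show -(y - z - (ζ + υ')) = z + -y + (ζ + υ') by ring]
  exact h.add

theorem generic_reflectionEntries_Ba : ∀ᶠ p : ℂ × ℂ × ℂ in generic _,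
    ReflectionEntries (Ba q κ ζ ζ' υ υ').A (Ba q κ ζ ζ' υ υ').B (Ba q κ ζ ζ' υ υ').α
      (Ba q κ ζ ζ' υ υ').β p.1 p.2.1 (p.1 - p.2.1) (p.1 + p.2.1) κ p.2.2 := by
  have hK := generic_kGeneric hq0 hq1 ζ ζ' υ υ'
  have t1 : Filter.Tendsto (fun p : ℂ × ℂ × ℂ => (p.1, p.2.2)) (generic _) (generic _) :=
    tendsto_generic _ (fun y => (y.1, 0, y.2)) (by fun_prop) (by fun_prop) (by simp)
      fun p y => by ext <;> simp
  have t2 : Filter.Tendsto (fun p : ℂ × ℂ × ℂ => (p.2.1, p.2.2)) (generic _) (generic _) :=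
    tendsto_generic _ (fun y => (0, y.1, y.2)) (by fun_prop) (by fun_prop) (by simp)
      fun p y => by ext <;> simp
  have t3 : ∀ a : ℂ, Filter.Tendsto (fun p : ℂ × ℂ => (p.1, p.2 + a)) (generic _) (generic _) :=
    fun a => tendsto_generic _ id (by fun_prop) (by fun_prop) (by simp) fun p y => by
      ext <;> (simp; try ring)
  -- All sign combinations are needed: β at y requires genericity at -y, and the determinant uses
  -- the points (z, y), (-z, -y) and (z, -y).
  have hall : ∀ᶠ p : ℂ × ℂ in generic _, ∀ y ∈ ({p.2 - κ, κ - p.2, p.2 + κ, -(p.2 + κ)} : Set ℂ),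
      KGeneric q ζ ζ' υ υ' p.1 y ∧ KGeneric q ζ ζ' υ υ' p.1 (-y) ∧
        KGeneric q ζ ζ' υ υ' (-p.1) y ∧ KGeneric q ζ ζ' υ υ' (-p.1) (-y) := by
    have hs := tendsto_generic_neg_snd.eventually hK
    have hf := tendsto_generic_neg_fst.eventually hK
    have hsf := tendsto_generic_neg_fst.eventually hs
    filter_upwards [(t3 κ).eventually (((hK.and hs).and hf).and hsf),
      (t3 (-κ)).eventually (((hK.and hs).and hf).and hsf)] with p h h'
    obtain ⟨⟨⟨a1, a2⟩, a3⟩, a4⟩ := h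
    obtain ⟨⟨⟨b1, b2⟩, b3⟩, b4⟩ := h'
    simp only [← sub_eq_add_neg] at b1 b2 b3 b4
    rintro y (rfl | rfl | rfl | rfl)
    · exact ⟨b1, b2, b3, b4⟩
    · rw [neg_sub] at b2 b4
      rw [neg_sub]
      exact ⟨b2, b1, b4, b3⟩
    · exact ⟨a1, a2, a3, a4⟩
    · rw [neg_neg]
      exact ⟨a2, a1, a4, a3⟩
  obtain ⟨r, hr⟩ := exists_kDiag_expansion hq0 hq1 ζ ζ' υ υ'
  filter_upwards [t1.eventually hall, t2.eventually hall,
    generic_sig_comp hq0 hq1 (fun p : ℂ × ℂ × ℂ => 2 * p.2.2) (fun y => (0, 0, y / 2)),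
    generic_sig_comp hq0 hq1 (fun p : ℂ × ℂ × ℂ => 2 * κ - 2 * p.2.2) (fun y => (0, 0, -y / 2)),
    generic_sig_comp hq0 hq1 (fun p : ℂ × ℂ × ℂ => 2 * κ + 2 * p.2.2) (fun y => (0, 0, y / 2)),
    generic_sig_comp hq0 hq1 (fun p : ℂ × ℂ × ℂ => 2 * κ - (p.1 - p.2.1)) (fun y => (-y, 0, 0)),
    generic_sig_comp hq0 hq1 (fun p : ℂ × ℂ × ℂ => 2 * κ - (p.1 + p.2.1)) (fun y => (-y, 0, 0)),
    Filter.eventually_all.2 fun i => generic_jac_comp hq0 hq1 i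
      (fun p : ℂ × ℂ × ℂ => p.1) (fun y => (y, 0, 0)),
    Filter.eventually_all.2 fun i => generic_jac_comp hq0 hq1 i
      (fun p : ℂ × ℂ × ℂ => p.2.1) (fun y => (0, y, 0))]
    with ⟨z₁, z₂, ξ⟩ k₁ k₂ h1 h2 h3 h4 h5 h6 h7
  have hα : ∀ {z y}, KGeneric q ζ ζ' υ υ' z y → (Ba q κ ζ ζ' υ υ').α z y =
      kScale q ζ ζ' υ υ' z * ∑ i, r i * faceφ (sig q) (jac q i) z (2 * y) := fun h =>
    (h.alphaBa_eq hq0 hq1).trans (by rw [hr _ _ h.two_z h.two_xi h.add h.pole h.shift])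
  change ReflectionEntries (ABa q κ) (BBa q κ) _ _ _ _ _ _ _ _
  rw [ABa_eq hq0, BBa_eq hq0 hq1]
  refine ReflectionEntries.of_linear
    (φ₁ := fun x => ∑ i, r i * faceφ (sig q) (jac q i) z₁ x)
    (φ₂ := fun x => ∑ i, r i * faceφ (sig q) (jac q i) z₂ x)
    (b := kOff q ζ ζ' υ υ') (c₁ := kScale q ζ ζ' υ υ' z₁) (c₂ := kScale q ζ ζ' υ υ' z₂)
    -- The value of the determinant, as left by `KGeneric.kDiag_mul` after subtracting `kOff_mul`.
    (D := -(kNum q ζ ζ' υ υ' z₂ / sig q (2 * z₂) * (kNum q ζ ζ' υ υ' (-z₂) / sig q (2 * -z₂))))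
    (FaceLinear.sum _ _ fun i => (sigmaPair_jac hq0 hq1 i).faceLinear h1 h2 h3 h4 h5 (h6 i) (h7 i))
    (faceA_mul_symm _ _ _ _ _) (fun y hy => hα (k₁ y hy).1) (fun y hy => hα (k₂ y hy).1)
    (fun y hy => betacm_eq_of_kGeneric hq0 hq1 _ _ _ _ (k₁ y hy).2.1)
    (fun y hy => betacm_eq_of_kGeneric hq0 hq1 _ _ _ _ (k₂ y hy).2.1) fun y hy => ?_
  have hy' : y ∈ ({ξ - κ, κ - ξ, ξ + κ, -(ξ + κ)} : Set ℂ) := by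
    rcases hy with rfl | rfl <;> simp
  obtain ⟨g1, g2, -, g4⟩ := k₂ y hy'
  have m := g1.kDiag_mul hq0 hq1 g4 g2
  rw [hr _ _ g1.two_z g1.two_xi g1.add g1.pole g1.shift,
    hr _ _ g2.two_z g2.two_xi g2.add g2.pole g2.shift] at m
  rw [← mul_neg 2 y, m, kOff_mul hq0]
  ring

/-- By oddness, kDiag(-z, ξ) = -kDiag(z, -ξ): the diagonal entry is minus the determinant times c(z)
c(-z), which is 1, and the two off-diagonal terms cancel. -/
theorem generic_unitaryKEntries_Ba : ∀ᶠ p : ℂ × ℂ in generic _,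
    UnitaryKEntries (Ba q κ ζ ζ' υ υ').α (Ba q κ ζ ζ' υ υ').β p.1 p.2 := by
  have hK := generic_kGeneric hq0 hq1 ζ ζ' υ υ'
  have hs := tendsto_generic_neg_snd.eventually hK
  filter_upwards [hK, hs, tendsto_generic_neg_fst.eventually hK,
    tendsto_generic_neg_fst.eventually hs] with p a1 a2 a3 a4
  have e := a1.kScale_mul hq0 a3
  have e' := kOff_mul hq0 ζ ζ' υ υ' p.2
  have m := a1.kDiag_mul hq0 hq1 a4 a2
  have n1 := a1.kDiag_neg hq0 hq1 a4
  have n2 : kDiag q ζ ζ' υ υ' (-p.1) p.2 = -kDiag q ζ ζ' υ υ' p.1 (-p.2) := by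
    have := a2.kDiag_neg hq0 hq1 (by rwa [neg_neg])
    rwa [neg_neg] at this
  have b1 := betacm_eq_of_kGeneric hq0 hq1 _ _ _ _ a2
  have b2 := betacm_eq_of_kGeneric hq0 hq1 _ _ _ _ a4
  have b3 : βcm q ζ ζ' υ υ' (-p.1) (-p.2) = _ :=
    betacm_eq_of_kGeneric hq0 hq1 ζ ζ' υ υ' (by rwa [neg_neg])
  have c1 : (Ba q κ ζ ζ' υ υ').α p.1 p.2 = _ := a1.alphaBa_eq hq0 hq1
  have c2 : (Ba q κ ζ ζ' υ υ').α (-p.1) p.2 = _ := a3.alphaBa_eq hq0 hq1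
  have c3 : (Ba q κ ζ ζ' υ υ').α (-p.1) (-p.2) = _ := a4.alphaBa_eq hq0 hq1
  constructor
  · rw [c1, c2, n2]
    change _ + βcm q ζ ζ' υ υ' p.1 p.2 * βcm q ζ ζ' υ υ' (-p.1) (-p.2) = 1
    rw [b1, b3]
    linear_combination kScale q ζ ζ' υ υ' p.1 * kScale q ζ ζ' υ υ' (-p.1) * (e' - m) + e
  · rw [c1, c3, n1]
    change _ * βcm q ζ ζ' υ υ' (-p.1) p.2 + βcm q ζ ζ' υ υ' p.1 p.2 * _ = 0
    rw [b1, b2]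
    ring

end

/-! ### Meromorphy of the coefficients -/

attribute [fun_prop] analyticAt_fst analyticAt_snd

theorem IsEntireQuotient.comp {E F : Type*} [NormedAddCommGroup E] [NormedSpace ℂ E]
    [NormedAddCommGroup F] [NormedSpace ℂ F] {f : F → ℂ} {m : E → F} (hf : IsEntireQuotient f)
    (hm : ∀ x, AnalyticAt ℂ m x) (ht : Filter.Tendsto m (generic E) (generic F)) :
    IsEntireQuotient fun x => f (m x) := by
  obtain ⟨g, h, hg, hh, hn, he⟩ := hf
  exact ⟨fun x => g (m x), fun x => h (m x), fun x => (hg _).fun_comp (hm x),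
    fun x => (hh _).fun_comp (hm x), ht.eventually hn, fun x hx => he _ hx⟩

section

variable {q : ℝ} (hq0 : 0 < q) (hq1 : q < 1)
include hq0

theorem isEntireQuotient_qpow {E : Type*} [NormedAddCommGroup E] [NormedSpace ℂ E] {m : E → ℂ}
    (hm : ∀ x, AnalyticAt ℂ m x) : IsEntireQuotient fun p => qpow q (m p) :=
  .of_analytic fun x => ((differentiable_qpow hq0).analyticAt _).fun_comp (hm x)

include hq1

theorem isEntireQuotient_theta {E : Type*} [NormedAddCommGroup E] [NormedSpace ℂ E] {m : E → ℂ}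
    (hm : ∀ x, AnalyticAt ℂ m x) : IsEntireQuotient fun p => theta q (qpow q (m p)) :=
  .of_analytic fun x => ((differentiable_theta_qpow hq0 hq1).analyticAt _).fun_comp (hm x)

theorem isEntireQuotient_jac {E : Type*} [NormedAddCommGroup E] [NormedSpace ℂ E] (i : Fin 4)
    {m : E → ℂ} (hm : ∀ x, AnalyticAt ℂ m x) : IsEntireQuotient fun p => jac q i (m p) :=
  (isEntireQuotient_qpow hq0 fun x => analyticAt_const.fun_mul (hm x)).mul
    ((isEntireQuotient_qpow hq0 fun x => by have := hm x; fun_prop).mul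
      (isEntireQuotient_theta hq0 hq1 fun x => (hm x).fun_add analyticAt_const))

theorem generic_theta_comp {E : Type*} [AddCommGroup E] [TopologicalSpace E] [ContinuousAdd E]
    (m : E → ℂ) (s : ℂ → E) (hm : Continuous m := by fun_prop) (hs : Continuous s := by fun_prop)
    (hs0 : s 0 = 0 := by simp) (h : ∀ p y, m (p + s y) = m p + y := by
      intro p y; beta_reduce; first | (simp; done) | (simp; ring) | ring) :
    ∀ᶠ p in generic E, theta q (qpow q (m p)) ≠ 0 :=
  (generic_sig_comp hq0 hq1 m s hm hs hs0 h).mono fun _ => theta_ne_zero_of_sig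

theorem isEntireQuotient_ABa (κ : ℂ) : IsEntireQuotient fun p : ℂ × ℂ => ABa q κ p.1 p.2 := by
  refine .div (.mul ?_ ?_) (.mul ?_ ?_) ?_
  any_goals exact isEntireQuotient_theta hq0 hq1 fun x => by fun_prop
  filter_upwards [generic_theta_comp hq0 hq1 (fun p : ℂ × ℂ => 2 * κ - p.1) (fun y => (-y, 0)),
    generic_theta_comp hq0 hq1 (fun p : ℂ × ℂ => p.2) (fun y => (0, y))] with p h1 h2
  exact mul_ne_zero h1 h2

theorem isEntireQuotient_BBa (κ : ℂ) : IsEntireQuotient fun p : ℂ × ℂ => BBa q κ p.1 p.2 := by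
  refine .div (.mul ?_ ?_) (.mul ?_ ?_) ?_
  any_goals exact isEntireQuotient_theta hq0 hq1 fun x => by fun_prop
  filter_upwards [generic_theta_comp hq0 hq1 (fun p : ℂ × ℂ => 2 * κ - p.1) (fun y => (-y, 0)),
    generic_theta_comp hq0 hq1 (fun p : ℂ × ℂ => -p.2) (fun y => (0, -y))] with p h1 h2
  exact mul_ne_zero h1 h2

theorem isEntireQuotient_Acm (κ : ℂ) : IsEntireQuotient fun p : ℂ × ℂ => Acm q κ p.1 p.2 := by
  refine .mul (.div (.mul ?_ ?_) (.mul ?_ ?_) ?_) (isEntireQuotient_qpow hq0 fun x => by fun_prop)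
  any_goals exact isEntireQuotient_theta hq0 hq1 fun x => by fun_prop
  filter_upwards [generic_theta_comp hq0 hq1 (fun p : ℂ × ℂ => 2 * κ - p.1) (fun y => (-y, 0)),
    generic_theta_comp hq0 hq1 (fun p : ℂ × ℂ => -p.2) (fun y => (0, -y))] with p h1 h2
  exact mul_ne_zero h1 h2

theorem isEntireQuotient_Bcm (κ : ℂ) : IsEntireQuotient fun p : ℂ × ℂ => Bcm q κ p.1 p.2 := by
  simp only [Bcm_eq_gauge]
  exact (isEntireQuotient_qpow hq0 fun x => by fun_prop).mul (isEntireQuotient_BBa hq0 hq1 κ)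

theorem isEntireQuotient_uBa (κ : ℂ) : IsEntireQuotient (uBa q κ) := by
  refine .div (.mul ?_ ?_) (.mul ?_ ?_) ?_
  any_goals exact isEntireQuotient_theta hq0 hq1 fun x => by fun_prop
  filter_upwards [generic_theta_comp hq0 hq1 (fun x : ℂ => 2 * κ - x) (fun y => -y),
    generic_theta_comp hq0 hq1 (fun x : ℂ => x) (fun y => y)] with p h1 h2
  exact mul_ne_zero h1 h2

variable (ζ ζ' υ υ' : ℂ)

theorem generic_calC_den : ∀ᶠ p : ℂ × ℂ in generic _,
    jac q 0 (2 * p.2) * jac q 3 (ζ' - υ' - p.1) ≠ 0 := by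
  filter_upwards [generic_jac_comp hq0 hq1 0 (fun p : ℂ × ℂ => 2 * p.2) (fun y => (0, y / 2)),
    generic_jac_comp hq0 hq1 3 (fun p : ℂ × ℂ => ζ' - υ' - p.1) (fun y => (-y, 0))] with p h1 h2
  exact mul_ne_zero h1 h2

theorem isEntireQuotient_calC :
    IsEntireQuotient fun p : ℂ × ℂ => calC q ζ ζ' υ υ' p.1 p.2 := by
  simp only [calC_eq hq0 hq1, ← jac_zero]
  refine .mul (.mul ?_ ?_) (.div (.mul (.mul (.mul ?_ ?_) ?_) ?_) (.mul ?_ ?_)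
    (generic_calC_den hq0 hq1 ζ' υ'))
  any_goals exact isEntireQuotient_jac hq0 hq1 _ fun x => by fun_prop
  all_goals exact isEntireQuotient_qpow hq0 fun x => by fun_prop

theorem generic_calC : ∀ᶠ p : ℂ × ℂ in generic _, calC q ζ ζ' υ υ' p.1 p.2 ≠ 0 := by
  filter_upwards [generic_calC_den hq0 hq1 ζ' υ',
    generic_jac_comp hq0 hq1 0 (fun p : ℂ × ℂ => ζ + ζ' + p.2) (fun y => (0, y)),
    generic_jac_comp hq0 hq1 1 (fun p : ℂ × ℂ => ζ - ζ' + p.2) (fun y => (0, y)),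
    generic_jac_comp hq0 hq1 2 (fun p : ℂ × ℂ => υ + υ' + p.2) (fun y => (0, y)),
    generic_jac_comp hq0 hq1 3 (fun p : ℂ × ℂ => p.2 - p.1 - (ζ + υ')) (fun y => (0, y))]
    with p h h0 h1 h2 h3
  rw [calC_eq hq0 hq1, ← jac_zero]
  exact mul_ne_zero (mul_ne_zero (qpow_ne_zero hq0 _) (qpow_ne_zero hq0 _))
    (div_ne_zero (mul_ne_zero (mul_ne_zero (mul_ne_zero h0 h1) h2) h3) h)

theorem isEntireQuotient_alphacm :
    IsEntireQuotient fun p : ℂ × ℂ => αcm q ζ ζ' υ υ' p.1 p.2 := by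
  have h := isEntireQuotient_calC hq0 hq1 ζ υ ζ' υ'
  have t : Filter.Tendsto (fun p : ℂ × ℂ => (p.2, p.1)) (generic _) (generic _) :=
    tendsto_generic _ (fun p => (p.2, p.1)) (by fun_prop) (by fun_prop) (by simp)
      fun p y => by ext <;> simp
  have t' : Filter.Tendsto (fun p : ℂ × ℂ => (p.2, -p.1)) (generic _) (generic _) :=
    tendsto_generic _ (fun p => (-p.2, p.1)) (by fun_prop) (by fun_prop) (by simp)
      fun p y => by ext <;> (simp; try ring)
  have h₁ := h.comp (fun _ => analyticAt_snd.prod analyticAt_fst) t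
  have h₂ := h.comp (fun _ => analyticAt_snd.prod analyticAt_fst.neg) t'
  have n := t'.eventually (generic_calC hq0 hq1 ζ υ ζ' υ')
  simp only [αcm, calCt]
  exact ((isEntireQuotient_calC hq0 hq1 ζ ζ' υ υ').sub h₁).div h₂ n

theorem isEntireQuotient_betacm :
    IsEntireQuotient fun p : ℂ × ℂ => βcm q ζ ζ' υ υ' p.1 p.2 := by
  have t : Filter.Tendsto (fun p : ℂ × ℂ => (-p.2, -p.1)) (generic _) (generic _) :=
    tendsto_generic _ (fun p => (-p.2, -p.1)) (by fun_prop) (by fun_prop) (by simp)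
      fun p y => by ext <;> (simp; try ring)
  have h := (isEntireQuotient_calC hq0 hq1 ζ υ ζ' υ').comp
    (fun _ => analyticAt_snd.neg.prod analyticAt_fst.neg) t
  have n := t.eventually (generic_calC hq0 hq1 ζ υ ζ' υ')
  simp only [βcm, calCt]
  exact (isEntireQuotient_calC hq0 hq1 ζ ζ' υ υ').div h n

end

theorem IsEntireQuotient.neg_snd {f : ℂ → ℂ → ℂ}
    (hf : IsEntireQuotient fun p : ℂ × ℂ => f p.1 p.2) :
    IsEntireQuotient fun p : ℂ × ℂ => f p.1 (-p.2) := by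
  have h := hf.comp (fun _ => analyticAt_fst.prod analyticAt_snd.neg) tendsto_generic_neg_snd
  exact h

end DynFace

/-! ### Proof of the theorem -/

open DynFace in
theorem corollary2p13 (q : ℝ) (hq0 : 0 < q) (hq1 : q < 1) (κ ζ ζ' υ υ' : ℂ) :
    -- `R_cm` is a unitary dynamical `R`-matrix, `K_cm` an associated unitary right `K`-matrix
    (IsDynamicalR spinWt κ (cm q κ ζ ζ' υ υ').R ∧ IsUnitaryR (cm q κ ζ ζ' υ υ').R ∧
      IsRightDynamicalK spinWt κ (cm q κ ζ ζ' υ υ').R (cm q κ ζ ζ' υ υ').K ∧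
      IsUnitaryK (cm q κ ζ ζ' υ υ').K) ∧
    -- `R_Ba`, `K_Ba` arise from `R_cm`, `K_cm` by the first gauge followed by the second
    (IsGaugeFactor (uBa q κ) ∧
      MerEq (fun p : ℂ × ℂ => (Ba q κ ζ ζ' υ υ').R p.1 p.2)
        (fun p => (((cm q κ ζ ζ' υ υ').gauge₁ (uBa q κ)).gauge₂ q κ).R p.1 p.2) ∧
      MerEq (fun p : ℂ × ℂ => (Ba q κ ζ ζ' υ υ').K p.1 p.2)
        (fun p => (((cm q κ ζ ζ' υ υ').gauge₁ (uBa q κ)).gauge₂ q κ).K p.1 p.2)) ∧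
    -- `R_Ba` is a unitary dynamical `R`-matrix, `K_Ba` an associated unitary right `K`-matrix
    (IsDynamicalR spinWt κ (Ba q κ ζ ζ' υ υ').R ∧ IsUnitaryR (Ba q κ ζ ζ' υ υ').R ∧
      IsRightDynamicalK spinWt κ (Ba q κ ζ ζ' υ υ').R (Ba q κ ζ ζ' υ υ').K ∧
      IsUnitaryK (Ba q κ ζ ζ' υ υ').K) := by
  have hα := isEntireQuotient_alphacm hq0 hq1 ζ ζ' υ υ'
  have hβ := isEntireQuotient_betacm hq0 hq1 ζ ζ' υ υ'
  have hα' : IsEntireQuotient fun p : ℂ × ℂ => (Ba q κ ζ ζ' υ υ').α p.1 p.2 :=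
    hα.mul (isEntireQuotient_qpow hq0 fun x => by fun_prop)
  have hu := generic_uBa hq0 hq1 κ
  have hYB : ∀ᶠ p : ℂ × ℂ × ℂ in generic _,
      FaceYangBaxter (ABa q κ) (BBa q κ) (2 * κ) p.1 p.2.1 (p.1 + p.2.1) p.2.2 := by
    rw [ABa_eq hq0, BBa_eq hq0 hq1]
    exact generic_faceYangBaxter hq0 hq1 (2 * κ)
  have hU : ∀ᶠ p : ℂ × ℂ in generic _, FaceUnitary (ABa q κ) (BBa q κ) p.1 p.2 := by
    rw [ABa_eq hq0, BBa_eq hq0 hq1]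
    exact generic_faceUnitary hq0 hq1 (2 * κ)
  have hRE := generic_reflectionEntries_Ba hq0 hq1 κ ζ ζ' υ υ'
  have hKU := generic_unitaryKEntries_Ba hq0 hq1 κ ζ ζ' υ υ'
  -- Transfers the generic facts about u from one variable to any affine coordinate on the parameter
  -- space.
  have pull : ∀ (E : Type) [NormedAddCommGroup E] (m : E → ℂ) (s : ℂ → E), Continuous m →
      Continuous s → s 0 = 0 → (∀ p y, m (p + s y) = m p + y) →
      ∀ᶠ p in generic E, uBa q κ (m p) * uBa q κ (-(m p)) = 1 ∧
        (∀ z, Acm q κ z (m p) =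
          (uBa q κ (m p))⁻¹ * qpow q (2 * κ * (z - m p)) * ABa q κ z (m p)) ∧
        (∀ z, ABa q κ z (m p) =
          qpow q (2 * κ * (m p - z)) * (uBa q κ (m p) * Acm q κ z (m p))) :=
    fun E _ m s hm hs hs0 h => (tendsto_generic m s hm hs hs0 h).eventually hu
  have inv_mul : ∀ {x : ℂ}, uBa q κ x * uBa q κ (-x) = 1 →
      (uBa q κ x)⁻¹ * (uBa q κ (-x))⁻¹ = 1 := fun h => by rw [← mul_inv, h, inv_one]
  refine ⟨⟨?_, ?_, ?_, ?_⟩, ⟨⟨?_, ?_⟩, ?_, ?_⟩, ?_, ?_, ?_, ?_⟩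
  · refine Coeffs.isDynamicalR_of_generic (Coeffs.isMeromorphicFamily_R
      (isEntireQuotient_Acm hq0 hq1 κ) (isEntireQuotient_Acm hq0 hq1 κ).neg_snd
      (isEntireQuotient_Bcm hq0 hq1 κ) (isEntireQuotient_Bcm hq0 hq1 κ).neg_snd) ?_
    filter_upwards [hYB,
      pull _ (fun p : ℂ × ℂ × ℂ => p.2.2) (fun y => (0, 0, y)) (by fun_prop) (by fun_prop)
        (by simp) (by simp),
      pull _ (fun p : ℂ × ℂ × ℂ => -p.2.2) (fun y => (0, 0, -y)) (by fun_prop) (by fun_prop)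
        (by simp) (by intros; simp; ring),
      pull _ (fun p : ℂ × ℂ × ℂ => p.2.2 - 2 * κ) (fun y => (0, 0, y)) (by fun_prop) (by fun_prop)
        (by simp) (by intros; simp; ring),
      pull _ (fun p : ℂ × ℂ × ℂ => 2 * κ - p.2.2) (fun y => (0, 0, -y)) (by fun_prop) (by fun_prop)
        (by simp) (by intros; simp; ring)] with p h h1 h2 h3 h4
    -- The inverse gauge, with u⁻¹ in place of u, carries Baxter's identities to R_cm. The relation
    -- for A holds only generically, hence the four dynamical values at which it is checked.
    refine h.gauge hq0 (g := fun x => (uBa q κ x)⁻¹) (inv_mul h1.1)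
      (by simpa only [neg_sub] using inv_mul h3.1) ?_ (fun z y => Bcm_eq_gauge κ z y)
    rintro z y (rfl | rfl | rfl | rfl)
    exacts [h1.2.1 z, h2.2.1 z, h3.2.1 z, h4.2.1 z]
  · refine Coeffs.isUnitaryR_of_generic ?_
    filter_upwards [hU,
      pull _ (fun p : ℂ × ℂ => p.2) (fun y => (0, y)) (by fun_prop) (by fun_prop)
        (by simp) (by simp),
      pull _ (fun p : ℂ × ℂ => -p.2) (fun y => (0, -y)) (by fun_prop) (by fun_prop)
        (by simp) (by intros; simp; ring)] with p h h1 h2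
    refine h.gauge hq0 (g := fun x => (uBa q κ x)⁻¹) (inv_mul h1.1) ?_
      (fun z y => Bcm_eq_gauge κ z y)
    rintro z y (rfl | rfl)
    exacts [h1.2.1 z, h2.2.1 z]
  · refine Coeffs.isRightDynamicalK_of_generic
      (Coeffs.isMeromorphicFamily_K hα hα.neg_snd hβ hβ.neg_snd) ?_
    filter_upwards [hRE,
      pull _ (fun p : ℂ × ℂ × ℂ => 2 * p.2.2) (fun y => (0, 0, y / 2)) (by fun_prop) (by fun_prop)
        (by simp) (by intros; simp; ring),
      pull _ (fun p : ℂ × ℂ × ℂ => -(2 * p.2.2)) (fun y => (0, 0, -y / 2)) (by fun_prop)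
        (by fun_prop) (by simp) (by intros; simp; ring)] with p h h1 h2
    refine h.gauge hq0 (g := fun x => (uBa q κ x)⁻¹) (inv_mul h1.1) ?_
      (fun z y => Bcm_eq_gauge κ z y) (fun z y => alphacm_eq_gauge hq0 ζ ζ' υ υ' z y)
      (fun _ _ => rfl)
    rintro z y (rfl | rfl)
    exacts [h1.2.1 z, h2.2.1 z]
  · refine Coeffs.isUnitaryK_of_generic (hKU.mono fun p h => ?_)
    exact h.gauge hq0 fun z y => alphacm_eq_gauge hq0 ζ ζ' υ υ' z y
  · exact (isEntireQuotient_uBa hq0 hq1 κ).isMeromorphic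
  · exact merEq_iff.2 (hu.mono fun _ h => h.1)
  · refine merEq_iff.2 ?_
    filter_upwards [pull _ (fun p : ℂ × ℂ => p.2) (fun y => (0, y)) (by fun_prop) (by fun_prop)
        (by simp) (by simp),
      pull _ (fun p : ℂ × ℂ => -p.2) (fun y => (0, -y)) (by fun_prop) (by fun_prop)
        (by simp) (by intros; simp; ring)] with p h1 h2
    have a1 := h1.2.2 p.1
    have a2 := h2.2.2 p.1
    simp only [Coeffs.R, Coeffs.gauge₂, Coeffs.gauge₁, Ba, cm]
    rw [a1, a2, BBa_eq_gauge hq0, BBa_eq_gauge hq0]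
  -- For K the gauge relation holds at every point, since neither u nor a division by theta
  -- functions enters.
  · refine merEq_iff.2 (Filter.Eventually.of_forall fun p => ?_)
    simp only [Coeffs.K, Coeffs.gauge₂, Coeffs.gauge₁, Ba, cm, mul_comm (qpow q _)]
  · exact Coeffs.isDynamicalR_of_generic (Coeffs.isMeromorphicFamily_R
      (isEntireQuotient_ABa hq0 hq1 κ) (isEntireQuotient_ABa hq0 hq1 κ).neg_snd
      (isEntireQuotient_BBa hq0 hq1 κ) (isEntireQuotient_BBa hq0 hq1 κ).neg_snd) hYB
  · exact Coeffs.isUnitaryR_of_generic hU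
  · exact Coeffs.isRightDynamicalK_of_generic
      (Coeffs.isMeromorphicFamily_K hα' hα'.neg_snd hβ hβ.neg_snd) hRE
  · exact Coeffs.isUnitaryK_of_generic hKU
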